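/- **Setting.** For $g\in C^0[0,1]$ with $g(0)=0$, $g>0$ on $(0,1]$ put $K_g:=\sup_{x\in(0,1]}\frac{x|g'(x)|}{g(x)}$. Call $g$ *weakly degenerate* (WD) if $g\in C^0[0,1]\cap C^1(0,1]$ and $K_g\in(0,1)$, and *strongly degenerate* (SD) if $g\in C^1[0,1]$ and $K_g\in[1,2)$. Let $a,b,d:[0,1]\to\mathbb R$, $\lambda\in\mathbb R$, $\beta\ge 0$, and set $$\eta(x)=\exp\Big\{\int_{1/2}^x\frac{b}{a}\,ds\Big\},\qquad \sigma=\frac a\eta .$$ Let $L^2_{1/\sigma}=\{u\in L^2(0,1):\int_0^1 u^2/\sigma\,dx<\infty\}$ with squared norm $\int_0^1u^2/\sigma\,dx$, and let $H^1_{1/\sigma,0}=\{u\in L^2_{1/\sigma}\cap H^1(0,1): u(0)=0\}$ with squared norm $\int_0^1 u^2/\sigma\,dx+\int_0^1\eta (u')^2dx$. Put $Au=au''+bu'$, $D(A)=\{u\in H^1_{1/\sigma,0}:Au\in L^2_{1/\sigma}\}$, $A_\lambda u=Au+\lambda u/d$, $D(A_\lambda)=\{u\in D(A):A_\lambda u\in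 L^2_{1/\sigma}\}$ with the graph norm. Let $\tilde C_{HP}$ and $C_{HP}$ be the best constants in $$\int_0^1\frac{u^2}{\sigma}dx\le \tilde C_{HP}\int_0^1(u')^2dx,\qquad \int_0^1\frac{u^2}{\sigma d}dx\le C_{HP}\int_0^1\eta(u')^2dx\qquad (u\in H^1_{1/\sigma,0}).$$ **Assumptions.** $a$ and $d$ are each (WD) or (SD); $b\in C^0[0,1]$ and $b/a\in L^1(0,1)$; $K_a+2K_d\le 2$; if $K_a>1$ then $xb/a\in L^\infty(0,1)$; $\lambda<1/C_{HP}$; and there is $\varepsilon_0>0$ with $(2-K_a-2K_d)\,a-2x|b|\ge\varepsilon_0 a$ on $[0,1]$. Let $y$ be a classical solution of $$y_{tt}-a y_{xx}-b y_x-\frac{\lambda}{d}y=0\ \text{ in }(0,\infty)\times(0,1),\qquad y(t,0)=0,\qquad y_t(t,1)+\eta(1) y_x(t,1)+\beta y(t,1)=0,$$ that is, $y\in C^2([0,\infty);L^2_{1/\sigma})\cap C^1([0,\infty);H^1_{1/\sigma,0})\cap C([0,\infty);D(A_\lambda))$, the equation holds for all $t\ge0$ (a.e. in $x$) and the boundary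 condition at $x=1$ holds for all $t>0$. Its energy is $$E_y(t)=\frac12\Big[\int_0^1\Big(\frac{y_t^2}{\sigma}+\eta y_x^2-\frac{\lambda}{\sigma d}y^2\Big)dx+\beta y^2(t,1)\Big].$$ Set $\mathbf 1_\varepsilon=1$ if $\lambda\le0$ and $\mathbf 1_\varepsilon=1-\lambda C_{HP}$ if $\lambda>0$, $$\Theta=\frac{2}{\mathbf 1_\varepsilon}\max\Big\{\frac1{a(1)}+\frac{K_a\tilde C_{HP}}{4\min_{[0,1]}\eta},\,1+\frac{K_a}4\Big\},\qquad M=\begin{cases}\|b\|_{L^\infty(0,1)}/a(1),&K_a\le1,\\ \|xb/a\|_{L^\infty(0,1)},&K_a>1.\end{cases}$$ **Proposition.** Under these assumptions, for all $T>s>0$ and $Q_s=(s,T)\times(0,1)$, the function $\frac{y_t^2}{\sigma}+\eta y_x^2-\lambda\frac{y^2}{\sigma d}$ is integrable on $Q_s$, and: * if $\lambda\ge0$, then $$\begin{aligned}\frac{\varepsilon_0}2\int_{Q_s}\Big(\frac{y_t^2}{\sigma}+\eta y_x^2-\lambda\frac{y^2}{\sigma d}\Big)dx\,dt\le{}&\Big(2\Theta+\frac1{\sigma(1)}+\frac1{\eta(1)}+\frac{\beta}{\eta(1)}+\frac{K_a}4\Big)E_y(s)\\&+\Big(\frac{\beta^2}{\eta(1)}+\frac{K_a\beta}2+\frac{\beta}{\eta(1)}+\frac{K_a}4+\frac{\lambda}{\sigma(1)d(1)}\Big)\int_s^Ty^2(t,1)\,dt;\end{aligned}$$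 * if $\lambda<0$, then $$\begin{aligned}\frac{\varepsilon_0}2\int_{Q_s}\Big(\frac{y_t^2}{\sigma}+\eta y_x^2-\lambda\frac{y^2}{\sigma d}\Big)dx\,dt\le{}&\Big(2\Theta+\frac1{\sigma(1)}+\frac1{\eta(1)}+\frac{\beta}{\eta(1)}+\frac{K_a}4\Big)E_y(s)\\&+\Big(\frac{\beta^2}{\eta(1)}+\frac{K_a\beta}2+\frac{\beta}{\eta(1)}+\frac{K_a}4\Big)\int_s^Ty^2(t,1)\,dt\\&-2\lambda C_{HP}\Big(1+\frac32K_a+K_d+M\Big)\int_s^TE_y(t)\,dt.\end{aligned}$$ -/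

import Mathlib

open Set Filter Topology MeasureTheory

namespace DegWave

/-- Spatial derivative on `[0,1]` (two-sided inside, one-sided at the endpoints). -/
noncomputable def dx (u : ℝ → ℝ) : ℝ → ℝ := fun x => derivWithin u (Icc 0 1) x

/-- The time derivative of `y = y(t,x)` on `[0,∞)` (one-sided at `t = 0`). -/
noncomputable def dt (y : ℝ → ℝ → ℝ) : ℝ → ℝ → ℝ :=
  fun t x => derivWithin (fun τ => y τ x) (Ici 0) t

/-- `K_g = sup_{x ∈ (0,1]} x |g'(x)| / g(x)`. When the supremum is infinite the value is `0`,
which is excluded by both degeneracy conditions below. -/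
noncomputable def degIndex (g : ℝ → ℝ) : ℝ :=
  sSup ((fun x => x * |dx g x| / g x) '' Ioc 0 1)

/-- Weak degeneracy at `0`. -/
structure IsWD (g : ℝ → ℝ) : Prop where
  continuousOn : ContinuousOn g (Icc 0 1)
  contDiffOn : ContDiffOn ℝ 1 g (Ioc 0 1)
  zero : g 0 = 0
  pos : ∀ x ∈ Ioc (0 : ℝ) 1, 0 < g x
  index : degIndex g ∈ Ioo (0 : ℝ) 1

/-- Strong degeneracy at `0`. -/
structure IsSD (g : ℝ → ℝ) : Prop where
  contDiffOn : ContDiffOn ℝ 1 g (Icc 0 1)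
  zero : g 0 = 0
  pos : ∀ x ∈ Ioc (0 : ℝ) 1, 0 < g x
  index : degIndex g ∈ Ico (1 : ℝ) 2

/-- The weight `η(x) = exp (∫_{1/2}^x b/a)`. -/
noncomputable def eta (a b : ℝ → ℝ) (x : ℝ) : ℝ :=
  Real.exp (∫ s in (1 / 2 : ℝ)..x, b s / a s)

/-- `min_{[0,1]} η`. -/
noncomputable def etaMin (a b : ℝ → ℝ) : ℝ := sInf (eta a b '' Icc 0 1)

/-- `σ = a / η`. -/
noncomputable def sigma (a b : ℝ → ℝ) (x : ℝ) : ℝ := a x / eta a b x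

/-- `u ∈ L²_{1/σ}(0,1)`. -/
def MemL2 (a b : ℝ → ℝ) (u : ℝ → ℝ) : Prop :=
  MemLp u 2 (volume.restrict (Ioo 0 1)) ∧
    IntegrableOn (fun x => u x ^ 2 / sigma a b x) (Ioo 0 1)

/-- `u ∈ H¹_{1/σ,0}(0,1)`: `u ∈ L²_{1/σ}(0,1) ∩ H¹(0,1)` with `u(0) = 0`. Elements of `H¹(0,1)` are
given by their continuous representative on `[0,1]`: the absolutely continuous functions with
square integrable derivative. -/
structure MemH1 (a b : ℝ → ℝ) (u : ℝ → ℝ) : Prop where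
  memL2 : MemL2 a b u
  absCont : AbsolutelyContinuousOnInterval u 0 1
  deriv_memLp : MemLp (dx u) 2 (volume.restrict (Ioo 0 1))
  zero : u 0 = 0

/-- `A u = a u'' + b u'`. -/
noncomputable def opA (a b : ℝ → ℝ) (u : ℝ → ℝ) : ℝ → ℝ :=
  fun x => a x * dx (dx u) x + b x * dx u x

/-- `A_lam u = A u + lam u / d`. -/
noncomputable def opAlam (a b d : ℝ → ℝ) (lam : ℝ) (u : ℝ → ℝ) : ℝ → ℝ :=
  fun x => opA a b u x + lam * u x / d x

/-- `u ∈ D(A) = H²_{1/σ,0}(0,1)`: `u ∈ H¹_{1/σ,0}(0,1)` and `A u ∈ L²_{1/σ}(0,1)`. That `u'` is locally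
absolutely continuous on `(0,1]` expresses that `u''` is a weak derivative: as `a` is continuous
and positive on `(0,1]`, `A u ∈ L²_{1/σ}(0,1)` in the weak sense forces `u ∈ H²(r,1)` for `0 < r < 1`. -/
structure MemDA (a b : ℝ → ℝ) (u : ℝ → ℝ) : Prop where
  memH1 : MemH1 a b u
  deriv_absCont : ∀ r ∈ Ioo (0 : ℝ) 1, AbsolutelyContinuousOnInterval (dx u) r 1
  opA_memL2 : MemL2 a b (opA a b u)

/-- `u ∈ D(A_lam)`. -/
structure MemDAlam (a b d : ℝ → ℝ) (lam : ℝ) (u : ℝ → ℝ) : Prop where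
  memDA : MemDA a b u
  opAlam_memL2 : MemL2 a b (opAlam a b d lam u)

/-- Squared norm of `L²_{1/σ}(0,1)`. -/
noncomputable def sqL2 (a b : ℝ → ℝ) (u : ℝ → ℝ) : ℝ :=
  ∫ x in (0 : ℝ)..1, u x ^ 2 / sigma a b x

/-- Squared norm of `H¹_{1/σ}(0,1)`. -/
noncomputable def sqH1 (a b : ℝ → ℝ) (u : ℝ → ℝ) : ℝ :=
  sqL2 a b u + ∫ x in (0 : ℝ)..1, eta a b x * dx u x ^ 2

/-- Squared graph norm of `D(A_lam)`. -/
noncomputable def sqDAlam (a b d : ℝ → ℝ) (lam : ℝ) (u : ℝ → ℝ) : ℝ :=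
  sqH1 a b u + sqL2 a b (opAlam a b d lam u)

/-- The curve `t ↦ y(t,·)` is continuous on `[0,∞)` for the norm whose square is `N`. -/
def CurveCont (N : (ℝ → ℝ) → ℝ) (y : ℝ → ℝ → ℝ) : Prop :=
  ∀ t₀ : ℝ, 0 ≤ t₀ → Tendsto (fun t => N (fun x => y t x - y t₀ x)) (𝓝[Ici 0] t₀) (𝓝 0)

/-- The curve `t ↦ y(t,·)` is differentiable on `[0,∞)` with derivative `v`, for the norm whose
square is `N`. -/
def CurveDeriv (N : (ℝ → ℝ) → ℝ) (y v : ℝ → ℝ → ℝ) : Prop :=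
  ∀ t₀ : ℝ, 0 ≤ t₀ →
    Tendsto (fun t => N (fun x => (y t x - y t₀ x) / (t - t₀) - v t₀ x))
      (𝓝[Ici 0 \ {t₀}] t₀) (𝓝 0)

/-- `y` is a classical solution of
`y_tt - a y_xx - b y_x - (lam / d) y = 0` on `(0,∞) × (0,1)`, `y(t,0) = 0`,
`y_t(t,1) + η(1) y_x(t,1) + β y(t,1) = 0`, with initial data its own values at `t = 0`. The regularity is
`y ∈ C²([0,∞); L²_{1/σ}) ∩ C¹([0,∞); H¹_{1/σ,0}) ∩ C([0,∞); D(A_lam))`; the condition `y(t,0) = 0` is part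
of it. Functions in `H¹_{1/σ,0}(0,1)` are evaluated pointwise, so that the derivative of
`t ↦ y(t,·)` in this space is the pointwise derivative `dt y`. -/
structure IsClassicalSolution (a b d : ℝ → ℝ) (lam β : ℝ) (y : ℝ → ℝ → ℝ) : Prop where
  mem_dom : ∀ t, 0 ≤ t → MemDAlam a b d lam (y t)
  cont_dom : CurveCont (sqDAlam a b d lam) y
  dt_mem : ∀ t, 0 ≤ t → MemH1 a b (dt y t)
  dt_deriv : CurveDeriv (sqH1 a b) y (dt y)
  dt_cont : CurveCont (sqH1 a b) (dt y)
  /-- `w` is the second time derivative, with values in `L²_{1/σ}(0,1)`. -/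
  second_deriv : ∃ w : ℝ → ℝ → ℝ,
    (∀ t, 0 ≤ t → MemL2 a b (w t)) ∧
    CurveDeriv (sqL2 a b) (dt y) w ∧
    CurveCont (sqL2 a b) w ∧
    ∀ t, 0 ≤ t → ∀ᵐ x ∂(volume.restrict (Ioo (0 : ℝ) 1)),
      w t x - a x * dx (dx (y t)) x - b x * dx (y t) x - lam / d x * y t x = 0
  boundary : ∀ t, 0 < t → dt y t 1 + eta a b 1 * dx (y t) 1 + β * y t 1 = 0

/-- `C̃_HP`, the best constant in `∫ u²/σ ≤ C ∫ (u')²` on `H¹_{1/σ,0}(0,1)`. -/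
noncomputable def CHPtilde (a b : ℝ → ℝ) : ℝ :=
  sInf {C : ℝ | 0 ≤ C ∧ ∀ u : ℝ → ℝ, MemH1 a b u →
    ∫ x in (0 : ℝ)..1, u x ^ 2 / sigma a b x ≤ C * ∫ x in (0 : ℝ)..1, dx u x ^ 2}

/-- `C_HP`, the best constant in `∫ u²/(σ d) ≤ C ∫ η (u')²` on `H¹_{1/σ,0}(0,1)`. -/
noncomputable def CHP (a b d : ℝ → ℝ) : ℝ :=
  sInf {C : ℝ | 0 ≤ C ∧ ∀ u : ℝ → ℝ, MemH1 a b u →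
    ∫ x in (0 : ℝ)..1, u x ^ 2 / (sigma a b x * d x)
      ≤ C * ∫ x in (0 : ℝ)..1, eta a b x * dx u x ^ 2}

/-- The norm of `L^∞(0,1)`. -/
noncomputable def supNorm (f : ℝ → ℝ) : ℝ :=
  (eLpNorm f ⊤ (volume.restrict (Ioo 0 1))).toReal

/-- The standing assumptions on `a`, `b`, `d`, `lam`, together with the strengthened condition with
constant `ε₀`. -/
structure Assumptions (a b d : ℝ → ℝ) (lam ε₀ : ℝ) : Prop where
  deg_a : IsWD a ∨ IsSD a
  deg_d : IsWD d ∨ IsSD d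
  cont_b : ContinuousOn b (Icc 0 1)
  b_div_a : IntegrableOn (fun x => b x / a x) (Ioo 0 1)
  index_le : degIndex a + 2 * degIndex d ≤ 2
  bdd : 1 < degIndex a → MemLp (fun x => x * b x / a x) ⊤ (volume.restrict (Ioo 0 1))
  lam_lt : lam < 1 / CHP a b d
  ε₀_pos : 0 < ε₀
  strong : ∀ x ∈ Icc (0 : ℝ) 1,
    (2 - degIndex a - 2 * degIndex d) * a x - 2 * x * |b x| ≥ ε₀ * a x

/-- `y_t²/σ + η y_x² - lam y²/(σ d)`. -/
noncomputable def density (a b d : ℝ → ℝ) (lam : ℝ) (y : ℝ → ℝ → ℝ) (t x : ℝ) : ℝ :=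
  dt y t x ^ 2 / sigma a b x + eta a b x * dx (y t) x ^ 2
    - lam * y t x ^ 2 / (sigma a b x * d x)

/-- The energy `E_y(t)`. -/
noncomputable def energy (a b d : ℝ → ℝ) (lam β : ℝ) (y : ℝ → ℝ → ℝ) (t : ℝ) : ℝ :=
  1 / 2 * ((∫ x in (0 : ℝ)..1, density a b d lam y t x) + β * y t 1 ^ 2)

/-- The constant equal to `1` for `lam ≤ 0`, and to the `ε` with `lam = (1 - ε)/C_HP` for `lam > 0`. -/
noncomputable def oneEps (a b d : ℝ → ℝ) (lam : ℝ) : ℝ :=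
  if lam ≤ 0 then 1 else 1 - lam * CHP a b d

/-- The constant `Θ`. -/
noncomputable def Theta (a b d : ℝ → ℝ) (lam : ℝ) : ℝ :=
  2 / oneEps a b d lam *
    max (1 / a 1 + degIndex a * CHPtilde a b / (4 * etaMin a b)) (1 + degIndex a / 4)

/-- The constant `M`. -/
noncomputable def constM (a b : ℝ → ℝ) : ℝ :=
  if degIndex a ≤ 1 then supNorm b / a 1 else supNorm (fun x => x * b x / a x)

end DegWave

/-! Write `q = ε₀/2` and let `K_a`, `K_d` be the degeneracy indices. The proof is a multiplier
argument: the equation is tested against `(2 x y_x + γ y)/σ` for a constant `γ`. Differentiating the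
cross term `∫ y_t (2 x y_x + γ y)/σ` in time and integrating by parts in `x` gives boundary terms at
`x = 1` minus a quadratic form (`exists_deriv_cross`). The form has kinetic coefficient `1 - γ -
x(a' - b)/a`, elastic coefficient `1 + γ - x b/a`, and, in front of `λ y²/(σ d)`, the kinetic
coefficient minus `x d'/d`.

The strengthened assumption says `|x b/a| ≤ 1 - K_a/2 - K_d - q`. With `γ = -K_a/2` the first two
coefficients are at least `q` and the third is nonnegative, so for `λ ≥ 0` the form dominates `q`
times the density (`le_multForm_of_nonneg`). The rest is integration in time. The cross term is at
most `Θ E` by Cauchy–Schwarz and Hardy–Poincaré. The boundary condition expresses `y_x(t,1)` through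
`y_t(t,1)` and `y(t,1)`. The dissipation law `E' = -y_t(t,1)²` turns `∫ y_t(t,1)² dt` into `E(s) -
E(T)`, and also makes `E` nonincreasing.

For `λ < 0` the third coefficient has the wrong sign and is only bounded above, by `S - θ` when `γ =
θ - K_a/2`, with `S = 1 + 3K_a/2 + K_d + M`. Put `z = |λ| C_HP`, so that `|λ| ∫ y²/(σ d) ≤ z ∫ η
y_x²`. If `q ≤ z S`, the estimate is immediate from `density ≤ 2E` after integration in `x`.
Otherwise `θ = 0` leaves a deficit `(q - z S)|λ| ∫ y²/(σ d)`; the choice `θ = z(q - z S)` adds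
enough elastic energy to pay for it, and the kinetic energy it costs is covered by the term `2 z S
E` (`density_le_multForm_of_neg`). This `θ` is at most `q²/4`. When `|γ| ≤ K_a/2` the argument ends
as for `λ ≥ 0`. When `γ > K_a/2` the constants in `Θ` do not directly cover the zero order part of
the multiplier; then `γ > 0` is small, a completed square controls the cross term, the boundary term
`γ y y_t` is an exact time derivative, and a trace inequality absorbs what remains
(`integral_density_le_of_pos`).

Two analytic points support this. Every spatial integration by parts meets the degenerate endpoint
`0`, where the boundary term must vanish (`integral_eq_of_absCont`). Differentiation in time takes
place in `L²(0,1)`: a solution is sent there by bounded linear maps such as `u ↦ η^{1/2} u'`, which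
transport differentiability and continuity of curves (`BddMap`). -/

open scoped RealInnerProductSpace

namespace DegWave

/-! ### Calculus on `(0,1]` up to a singular endpoint -/

/-- `φ` is continuously differentiable on `(0,1]` with derivative `φ'`. -/
structure HasC1 (φ φ' : ℝ → ℝ) : Prop where
  deriv : ∀ x ∈ Ioc (0 : ℝ) 1, HasDerivWithinAt φ (φ' x) (Icc 0 1) x
  cont : ContinuousOn φ' (Ioc 0 1)

namespace HasC1
variable {φ φ' ψ ψ' : ℝ → ℝ}

theorem continuousOn (h : HasC1 φ φ') : ContinuousOn φ (Ioc 0 1) := fun x hx =>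
  ((h.deriv x hx).continuousWithinAt).mono Ioc_subset_Icc_self

theorem hasDerivAt (h : HasC1 φ φ') {x : ℝ} (hx : x ∈ Ioo (0 : ℝ) 1) : HasDerivAt φ (φ' x) x :=
  (h.deriv x ⟨hx.1, hx.2.le⟩).hasDerivAt (Icc_mem_nhds hx.1 hx.2)

theorem mul (h : HasC1 φ φ') (k : HasC1 ψ ψ') :
    HasC1 (fun x => φ x * ψ x) (fun x => φ' x * ψ x + φ x * ψ' x) :=
  ⟨fun x hx => (h.deriv x hx).mul (k.deriv x hx),
    (h.cont.mul k.continuousOn).add (h.continuousOn.mul k.cont)⟩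

theorem div (h : HasC1 φ φ') (k : HasC1 ψ ψ') (hk : ∀ x ∈ Ioc (0 : ℝ) 1, ψ x ≠ 0) :
    HasC1 (fun x => φ x / ψ x) (fun x => (φ' x * ψ x - φ x * ψ' x) / ψ x ^ 2) :=
  ⟨fun x hx => (h.deriv x hx).div (k.deriv x hx) (hk x hx),
    ((h.cont.mul k.continuousOn).sub (h.continuousOn.mul k.cont)).div (k.continuousOn.pow 2)
      fun x hx => pow_ne_zero 2 (hk x hx)⟩

theorem id : HasC1 (fun x => x) (fun _ => 1) :=
  ⟨fun x _ => hasDerivWithinAt_id x _, continuousOn_const⟩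

theorem congr' (h : HasC1 φ φ') (e : ∀ x ∈ Ioc (0 : ℝ) 1, φ' x = ψ' x) : HasC1 φ ψ' :=
  ⟨fun x hx => e x hx ▸ h.deriv x hx, h.cont.congr fun x hx => (e x hx).symm⟩

theorem absCont (h : HasC1 φ φ') {r : ℝ} (hr : r ∈ Ioo (0 : ℝ) 1) :
    AbsolutelyContinuousOnInterval φ r 1 := by
  have hsub : Icc r 1 ⊆ Ioc (0 : ℝ) 1 := fun x hx => ⟨hr.1.trans_le hx.1, hx.2⟩
  obtain ⟨C, hC⟩ := isCompact_Icc.exists_bound_of_continuousOn (h.cont.mono hsub)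
  have hC0 : 0 ≤ C := (norm_nonneg _).trans (hC r ⟨le_rfl, hr.2.le⟩)
  have : LipschitzOnWith C.toNNReal φ (Icc r 1) :=
    (convex_Icc r 1).lipschitzOnWith_of_nnnorm_hasDerivWithin_le
      (fun x hx => (h.deriv x (hsub hx)).mono (hsub.trans Ioc_subset_Icc_self))
      (fun x hx => by
        rw [← NNReal.coe_le_coe, Real.coe_toNNReal _ hC0]; exact hC x hx)
  rw [← uIcc_of_le hr.2.le] at this
  exact this.absolutelyContinuousOnInterval

theorem monotoneOn (h : HasC1 φ φ') (h0 : ∀ x ∈ Ioo (0 : ℝ) 1, 0 ≤ φ' x) :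
    MonotoneOn φ (Ioc 0 1) := by
  refine monotoneOn_of_deriv_nonneg (convex_Ioc 0 1) h.continuousOn ?_ ?_
  · rw [interior_Ioc]
    exact fun x hx => (h.hasDerivAt hx).differentiableAt.differentiableWithinAt
  · rw [interior_Ioc]
    exact fun x hx => by rw [(h.hasDerivAt hx).deriv]; exact h0 x hx

theorem integral_eq (h : HasC1 φ φ') {r : ℝ} (hr : r ∈ Ioo (0 : ℝ) 1) :
    ∫ x in r..1, φ' x = φ 1 - φ r := by
  have hsub : Icc r 1 ⊆ Ioc (0 : ℝ) 1 := fun x hx => ⟨hr.1.trans_le hx.1, hx.2⟩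
  refine intervalIntegral.integral_eq_sub_of_hasDerivAt_of_le hr.2.le (h.continuousOn.mono hsub)
    (fun x hx => h.hasDerivAt ⟨hr.1.trans hx.1, hx.2⟩) ?_
  apply ContinuousOn.intervalIntegrable
  rw [uIcc_of_le hr.2.le]
  exact h.cont.mono hsub

end HasC1

theorem ae_restrict_Ioo_of_forall {p : ℝ → Prop} (h : ∀ x ∈ Ioo (0 : ℝ) 1, p x) :
    ∀ᵐ x ∂(volume.restrict (Ioo (0 : ℝ) 1)), p x :=
  (ae_restrict_iff' measurableSet_Ioo).2 (Eventually.of_forall h)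

theorem aestronglyMeasurable_of_continuousOn {f : ℝ → ℝ} (h : ContinuousOn f (Ioc 0 1)) :
    AEStronglyMeasurable f (volume.restrict (Ioo 0 1)) :=
  (h.mono Ioo_subset_Ioc_self).aestronglyMeasurable measurableSet_Ioo

theorem intervalIntegral_eq (f : ℝ → ℝ) :
    ∫ x in (0 : ℝ)..1, f x = ∫ x in Ioo (0 : ℝ) 1, f x := by
  rw [intervalIntegral.integral_of_le zero_le_one, integral_Ioc_eq_integral_Ioo]

/-- A nonnegative continuous function on `(0,1]` dominated by the derivative of a nonnegative
function is integrable. -/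
theorem integrableOn_of_le_deriv {φ φ' f : ℝ → ℝ} (h : HasC1 φ φ') (hφ : ∀ x ∈ Ioc (0 : ℝ) 1, 0 ≤ φ x)
    (hf : ContinuousOn f (Ioc 0 1)) (h0 : ∀ x ∈ Ioc (0 : ℝ) 1, 0 ≤ f x)
    (hle : ∀ x ∈ Ioc (0 : ℝ) 1, f x ≤ φ' x) : IntegrableOn f (Ioo 0 1) := by
  let r : ℕ → ℝ := fun n => 1 / ((n : ℝ) + 2)
  have hr : ∀ n, r n ∈ Ioo (0 : ℝ) 1 := fun n =>
    ⟨by positivity, by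
      rw [div_lt_one (by positivity)]; have : (0 : ℝ) ≤ n := n.cast_nonneg
      linarith⟩
  have hsub : ∀ n, Icc (r n) 1 ⊆ Ioc (0 : ℝ) 1 := fun n x hx => ⟨(hr n).1.trans_le hx.1, hx.2⟩
  have hi : ∀ n, IntegrableOn f (Icc (r n) 1) := fun n =>
    (hf.mono (hsub n)).integrableOn_compact isCompact_Icc
  have hi' : ∀ n, IntegrableOn φ' (Icc (r n) 1) := fun n =>
    (h.cont.mono (hsub n)).integrableOn_compact isCompact_Icc
  have ht : Tendsto r atTop (𝓝 0) := by
    have h1 : Tendsto (fun n : ℕ => (n : ℝ) + 2) atTop atTop :=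
      tendsto_atTop_add_const_right _ _ tendsto_natCast_atTop_atTop
    simpa [r, Pi.inv_def] using h1.inv_tendsto_atTop
  refine (integrableOn_Ioc_of_intervalIntegral_norm_bounded_left (I := φ 1) (l := atTop) (a := r)
    (fun n => (hi n).mono_set Ioc_subset_Icc_self) ht (Eventually.of_forall fun n => ?_)).mono_set
    Ioo_subset_Ioc_self
  calc ∫ x in Ioc (r n) 1, ‖f x‖ ≤ ∫ x in Ioc (r n) 1, φ' x := by
        refine setIntegral_mono_on ((hi n).mono_set Ioc_subset_Icc_self).norm
          ((hi' n).mono_set Ioc_subset_Icc_self) measurableSet_Ioc fun x hx => ?_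
        have hx' := hsub n (Ioc_subset_Icc_self hx)
        rw [Real.norm_of_nonneg (h0 x hx')]
        exact hle x hx'
    _ = φ 1 - φ (r n) := by
        rw [← intervalIntegral.integral_of_le (hr n).2.le, h.integral_eq (hr n)]
    _ ≤ φ 1 := by linarith [hφ (r n) (hsub n ⟨le_rfl, (hr n).2.le⟩)]

/-- Fundamental theorem of calculus up to the singular endpoint `0`, where the boundary term
vanishes because `|F|^p / x` is integrable. -/
theorem integral_eq_of_absCont {F F' : ℝ → ℝ} (p : ℕ)
    (hac : ∀ r ∈ Ioo (0 : ℝ) 1, AbsolutelyContinuousOnInterval F r 1)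
    (hd : ∀ᵐ x ∂(volume.restrict (Ioo (0 : ℝ) 1)), HasDerivAt F (F' x) x)
    (hi : IntegrableOn F' (Ioo 0 1)) (hp : IntegrableOn (fun x => |F x| ^ p / x) (Ioo 0 1)) :
    ∫ x in Ioo (0 : ℝ) 1, F' x = F 1 := by
  have hd' := (ae_restrict_iff' measurableSet_Ioo).1 hd
  have h1 : ∀ r ∈ Ioo (0 : ℝ) 1, F r = F 1 - ∫ x in r..1, F' x := by
    intro r hr
    have e := (hac r hr).integral_deriv_eq_sub
    have : ∫ x in r..1, deriv F x = ∫ x in r..1, F' x := by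
      rw [intervalIntegral.integral_of_le hr.2.le, intervalIntegral.integral_of_le hr.2.le,
        integral_Ioc_eq_integral_Ioo, integral_Ioc_eq_integral_Ioo]
      apply setIntegral_congr_ae measurableSet_Ioo
      filter_upwards [hd'] with x hx hxr
      exact (hx ⟨hr.1.trans hxr.1, hxr.2⟩).deriv
    linarith
  have hIcc : IntegrableOn F' (Icc 0 1) := by
    rw [integrableOn_Icc_iff_integrableOn_Ioo]; exact hi
  have hcont : ContinuousOn (fun r => ∫ x in r..1, F' x) (Icc 0 1) := by
    have := intervalIntegral.continuousOn_primitive_interval_left (μ := volume) (f := F')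
      (a := 0) (b := 1) (by rwa [uIcc_of_le zero_le_one])
    rwa [uIcc_of_le zero_le_one] at this
  have hlim : Tendsto F (𝓝[>] 0) (𝓝 (F 1 - ∫ x in (0 : ℝ)..1, F' x)) := by
    have h2 : Tendsto (fun r => ∫ x in r..1, F' x) (𝓝[>] 0) (𝓝 (∫ x in (0 : ℝ)..1, F' x)) := by
      have := (hcont 0 ⟨le_rfl, zero_le_one⟩).mono Ioo_subset_Icc_self
      rwa [ContinuousWithinAt, nhdsWithin_Ioo_eq_nhdsGT zero_lt_one] at this
    refine (tendsto_const_nhds.sub h2).congr' ?_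
    filter_upwards [Ioo_mem_nhdsGT zero_lt_one] with r hr
    exact (h1 r hr).symm
  -- `F` has a limit `L` at `0`. If `L ≠ 0`, then `|F|^p / x` exceeds a positive multiple of `1/x`
  -- near `0`, which is not integrable.
  set L := F 1 - ∫ x in (0 : ℝ)..1, F' x with hL
  have hL0 : L = 0 := by
    by_contra hne
    have hc : 0 < |L| ^ p / 2 := by positivity
    have hev : ∀ᶠ x in 𝓝[>] (0 : ℝ), |L| ^ p / 2 < |F x| ^ p :=
      (hlim.abs.pow p).eventually_const_lt (by linarith)
    obtain ⟨δ, hδ, hsub⟩ := mem_nhdsGT_iff_exists_Ioo_subset.1 hev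
    set e := min δ 1 with he
    have he0 : 0 < e := lt_min hδ zero_lt_one
    have hint : IntegrableOn (fun x : ℝ => x⁻¹) (Ioo 0 e) := by
      have h3 : IntegrableOn (fun x => (|L| ^ p / 2)⁻¹ * (|F x| ^ p / x)) (Ioo 0 e) :=
        (hp.mono_set (Ioo_subset_Ioo_right (min_le_right _ _))).const_mul _
      refine Integrable.mono' h3 (measurable_inv.aestronglyMeasurable) ?_
      refine (ae_restrict_iff' measurableSet_Ioo).2 (Eventually.of_forall fun x hx => ?_)
      have h4 : |L| ^ p / 2 < |F x| ^ p := hsub ⟨hx.1, hx.2.trans_le (min_le_left _ _)⟩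
      have hx0 : 0 < x := hx.1
      rw [Real.norm_of_nonneg (by positivity), inv_mul_eq_div, le_div_iff₀ hc, inv_mul_eq_div]
      gcongr
    have : IntervalIntegrable (fun x : ℝ => x⁻¹) volume 0 e := by
      rw [intervalIntegrable_iff_integrableOn_Ioo_of_le he0.le]; exact hint
    rw [intervalIntegrable_inv_iff] at this
    rcases this with h | h
    · exact he0.ne h
    · exact h left_mem_uIcc
  rw [← intervalIntegral_eq]; linarith

/-! ### Degenerate coefficients and the monotone quotients built from them -/

/-- The data of a degenerate function used below. -/
structure Deg (g : ℝ → ℝ) (K : ℝ) : Prop where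
  cont : ContinuousOn g (Icc 0 1)
  pos : ∀ x ∈ Ioc (0 : ℝ) 1, 0 < g x
  c1 : HasC1 g (dx g)
  bound : ∀ x ∈ Ioc (0 : ℝ) 1, |x * dx g x / g x| ≤ K
  index_pos : 0 < K

theorem deg_of_wd_or_sd {g : ℝ → ℝ} (h : IsWD g ∨ IsSD g) : Deg g (degIndex g) := by
  have key : ContinuousOn g (Icc 0 1) → ContDiffOn ℝ 1 g (Ioc 0 1) →
      (∀ x ∈ Ioc (0 : ℝ) 1, 0 < g x) → 0 < degIndex g → Deg g (degIndex g) := by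
    intro hc hd hp h0
    -- The derivative `dx` is taken within `[0,1]`, whereas weak degeneracy gives regularity on
    -- `(0,1]` only. Away from `0` both sets have the same neighbourhoods.
    have hnhds : ∀ x ∈ Ioc (0 : ℝ) 1, 𝓝[Icc 0 1] x = 𝓝[Ioc 0 1] x := by
      intro x hx
      refine le_antisymm ?_ (nhdsWithin_mono x Ioc_subset_Icc_self)
      rw [nhdsWithin_le_iff]
      filter_upwards [self_mem_nhdsWithin, mem_nhdsWithin_of_mem_nhds (Ioi_mem_nhds hx.1)] with z h1 h2
      exact ⟨h2, h1.2⟩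
    have hdx : ∀ x ∈ Ioc (0 : ℝ) 1, dx g x = derivWithin g (Ioc 0 1) x := fun x hx =>
      derivWithin_congr_set' x (by
        have := hnhds x hx
        rw [nhdsWithin_eq_iff_eventuallyEq] at this
        exact this.filter_mono nhdsWithin_le_nhds)
    have hu : UniqueDiffOn ℝ (Ioc (0 : ℝ) 1) := uniqueDiffOn_Ioc 0 1
    refine ⟨hc, hp, ⟨fun x hx => ?_, ?_⟩, fun x hx => ?_, h0⟩
    · have := ((hd.differentiableOn one_ne_zero) x hx).hasDerivWithinAt
      rw [← hdx x hx] at this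
      rw [HasDerivWithinAt, HasDerivAtFilter] at this ⊢
      simpa [hnhds x hx] using this
    · exact (hd.continuousOn_derivWithin hu le_rfl).congr hdx
    -- The supremum of an unbounded set of reals is `0` by default, which positivity of the index
    -- rules out; hence the index really bounds the ratio.
    · have hb : BddAbove ((fun x => x * |dx g x| / g x) '' Ioc 0 1) := by
        by_contra hn
        rw [degIndex, Real.sSup_of_not_bddAbove hn] at h0
        exact lt_irrefl _ h0
      rw [abs_div, abs_mul, abs_of_pos hx.1, abs_of_pos (hp x hx)]
      exact le_csSup hb ⟨x, hx, rfl⟩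
  rcases h with h | h
  · exact key h.continuousOn h.contDiffOn h.pos h.index.1
  · exact key h.contDiffOn.continuousOn (h.contDiffOn.mono Ioc_subset_Icc_self) h.pos
      (zero_lt_one.trans_le h.index.1)

/-- The consequences of the standing assumptions on the coefficients used in the spatial
estimates. -/
structure Coef (a b d : ℝ → ℝ) (q : ℝ) : Prop where
  deg_a : Deg a (degIndex a)
  deg_d : Deg d (degIndex d)
  cont_b : ContinuousOn b (Icc 0 1)
  b_div_a : IntegrableOn (fun x => b x / a x) (Ioo 0 1)
  q_pos : 0 < q
  strong : ∀ x ∈ Ioc (0 : ℝ) 1, |x * b x / a x| ≤ 1 - degIndex a / 2 - degIndex d - q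

/-- Dividing the strengthened condition by `2 a(x)` turns `ε₀` into the margin `q = ε₀/2`. -/
theorem Assumptions.coef {a b d : ℝ → ℝ} {lam ε₀ : ℝ} (h : Assumptions a b d lam ε₀) :
    Coef a b d (ε₀ / 2) := by
  have ha := deg_of_wd_or_sd h.deg_a
  refine ⟨ha, deg_of_wd_or_sd h.deg_d, h.cont_b, h.b_div_a, by linarith [h.ε₀_pos],
    fun x hx => ?_⟩
  have h1 := h.strong x ⟨hx.1.le, hx.2⟩
  have hp := ha.pos x hx
  rw [abs_div, abs_mul, abs_of_pos hx.1, abs_of_pos hp, div_le_iff₀ hp]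
  nlinarith

namespace Coef
variable {a b d : ℝ → ℝ} {q : ℝ}

theorem eta_pos (x : ℝ) : 0 < eta a b x := Real.exp_pos _

theorem a_pos (h : Coef a b d q) {x : ℝ} (hx : x ∈ Ioc (0 : ℝ) 1) : 0 < a x := h.deg_a.pos x hx

theorem d_pos (h : Coef a b d q) {x : ℝ} (hx : x ∈ Ioc (0 : ℝ) 1) : 0 < d x := h.deg_d.pos x hx

theorem sigma_pos (h : Coef a b d q) {x : ℝ} (hx : x ∈ Ioc (0 : ℝ) 1) : 0 < sigma a b x :=
  div_pos (h.a_pos hx) (eta_pos x)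

theorem one_mem : (1 : ℝ) ∈ Ioc (0 : ℝ) 1 := ⟨zero_lt_one, le_rfl⟩

theorem q_add_index (h : Coef a b d q) : q + degIndex a / 2 + degIndex d ≤ 1 := by
  have := (abs_nonneg _).trans (h.strong 1 one_mem)
  linarith

theorem b_div_a_cont (h : Coef a b d q) : ContinuousOn (fun x => b x / a x) (Ioc 0 1) :=
  (h.cont_b.mono Ioc_subset_Icc_self).div (h.deg_a.cont.mono Ioc_subset_Icc_self)
    fun _ hx => (h.a_pos hx).ne'

theorem b_div_a_Icc (h : Coef a b d q) : IntegrableOn (fun x => b x / a x) (Icc 0 1) := by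
  rw [integrableOn_Icc_iff_integrableOn_Ioo]; exact h.b_div_a

theorem drift_cont (h : Coef a b d q) : ContinuousOn (fun x => x * b x / a x) (Ioc 0 1) :=
  (continuousOn_id.mul (h.cont_b.mono Ioc_subset_Icc_self)).div
    (h.deg_a.cont.mono Ioc_subset_Icc_self) fun _ hx => (h.a_pos hx).ne'

theorem _root_.DegWave.Deg.ratio_cont {g : ℝ → ℝ} {K : ℝ} (h : Deg g K) :
    ContinuousOn (fun x => x * dx g x / g x) (Ioc 0 1) :=
  (continuousOn_id.mul h.c1.cont).div h.c1.continuousOn fun x hx => (h.pos x hx).ne'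

theorem eta_continuousOn (h : Coef a b d q) : ContinuousOn (eta a b) (Icc 0 1) := by
  refine Real.continuous_exp.comp_continuousOn ?_
  have := intervalIntegral.continuousOn_primitive_interval' (μ := volume)
    (f := fun x => b x / a x) (a := 1 / 2) (b₁ := 0) (b₂ := 1)
    (by rw [intervalIntegrable_iff_integrableOn_Icc_of_le zero_le_one]; exact h.b_div_a_Icc)
    (by rw [uIcc_of_le zero_le_one]; constructor <;> norm_num)
  rwa [uIcc_of_le zero_le_one] at this

theorem eta_c1 (h : Coef a b d q) : HasC1 (eta a b) (fun x => eta a b x * (b x / a x)) := by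
  refine ⟨fun x hx => ?_,
    (h.eta_continuousOn.mono Ioc_subset_Icc_self).mul h.b_div_a_cont⟩
  have hx' : x ∈ Icc (0 : ℝ) 1 := Ioc_subset_Icc_self hx
  have : Fact (x ∈ Icc (0 : ℝ) 1) := ⟨hx'⟩
  have hint : IntervalIntegrable (fun x => b x / a x) volume (1 / 2) x := by
    rw [intervalIntegrable_iff]
    refine h.b_div_a_Icc.mono_set (uIoc_subset_uIcc.trans (uIcc_subset_Icc ?_ hx'))
    constructor <;> norm_num
  refine HasDerivWithinAt.exp (intervalIntegral.integral_hasDerivWithinAt_right hint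
    (t := Icc 0 1) ?_ ?_)
  · exact ⟨Icc 0 1, self_mem_nhdsWithin, h.b_div_a_Icc.aestronglyMeasurable⟩
  · refine (h.b_div_a_cont x hx).mono_of_mem_nhdsWithin ?_
    filter_upwards [self_mem_nhdsWithin, mem_nhdsWithin_of_mem_nhds (Ioi_mem_nhds hx.1)] with z h1 h2
    exact ⟨h2, h1.2⟩

theorem exists_eta_bounds (h : Coef a b d q) :
    ∃ c C : ℝ, 0 < c ∧ ∀ x ∈ Icc (0 : ℝ) 1, c ≤ eta a b x ∧ eta a b x ≤ C := by
  obtain ⟨x₀, -, h0⟩ := isCompact_Icc.exists_isMinOn ⟨0, left_mem_Icc.2 zero_le_one⟩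
    h.eta_continuousOn
  obtain ⟨x₁, -, h1⟩ := isCompact_Icc.exists_isMaxOn ⟨0, left_mem_Icc.2 zero_le_one⟩
    h.eta_continuousOn
  exact ⟨_, _, eta_pos x₀, fun x hx => ⟨h0 hx, h1 hx⟩⟩

theorem etaMin_pos (h : Coef a b d q) : 0 < etaMin a b := by
  obtain ⟨c, C, hc, hb⟩ := h.exists_eta_bounds
  refine hc.trans_le (le_csInf (nonempty_Icc.2 zero_le_one |>.image _) ?_)
  rintro _ ⟨x, hx, rfl⟩
  exact (hb x hx).1

theorem etaMin_le {x : ℝ} (hx : x ∈ Icc (0 : ℝ) 1) : etaMin a b ≤ eta a b x :=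
  csInf_le ⟨0, by rintro _ ⟨z, -, rfl⟩; exact (eta_pos z).le⟩ ⟨x, hx, rfl⟩

theorem c1_div_sigma (h : Coef a b d q) : HasC1 (fun x => x / sigma a b x)
    (fun x => (1 - x * dx a x / a x + x * b x / a x) / sigma a b x) := by
  have h1 := (HasC1.id.mul h.eta_c1).div h.deg_a.c1 fun x hx => (h.a_pos hx).ne'
  have e : (fun x => x / sigma a b x) = fun x => x * eta a b x / a x := by
    funext x; rw [sigma, div_div_eq_mul_div]
  rw [e]
  refine h1.congr' fun x hx => ?_
  have := (h.a_pos hx).ne'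
  have := (eta_pos (a := a) (b := b) x).ne'
  rw [sigma]; field_simp; ring

theorem c1_div_sigma_d (h : Coef a b d q) : HasC1 (fun x => x / (sigma a b x * d x))
    (fun x => (1 - x * dx a x / a x + x * b x / a x - x * dx d x / d x) /
      (sigma a b x * d x)) := by
  have h1 := h.c1_div_sigma.div h.deg_d.c1 fun x hx => (h.d_pos hx).ne'
  have e : (fun x => x / (sigma a b x * d x)) = fun x => x / sigma a b x / d x := by
    funext x; rw [div_div]
  rw [e]
  refine h1.congr' fun x hx => ?_
  have := (h.a_pos hx).ne'
  have := (h.d_pos hx).ne'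
  have := (h.sigma_pos hx).ne'
  field_simp

theorem c1_mul_eta (h : Coef a b d q) : HasC1 (fun x => x * eta a b x)
    (fun x => (1 + x * b x / a x) * eta a b x) := by
  refine (HasC1.id.mul h.eta_c1).congr' fun x hx => ?_
  ring

theorem c1_div_eta (h : Coef a b d q) : HasC1 (fun x => x / eta a b x)
    (fun x => (1 - x * b x / a x) / eta a b x) := by
  refine (HasC1.id.div h.eta_c1 fun x hx => (eta_pos x).ne').congr' fun x hx => ?_
  have := (h.a_pos hx).ne'
  have := (eta_pos (a := a) (b := b) x).ne'
  field_simp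

theorem c1_div_a (h : Coef a b d q) : HasC1 (fun x => x / a x)
    (fun x => (1 - x * dx a x / a x) * (1 / a x)) := by
  refine (HasC1.id.div h.deg_a.c1 fun x hx => (h.a_pos hx).ne').congr' fun x hx => ?_
  have := (h.a_pos hx).ne'
  field_simp

theorem c1_sq_div_a (h : Coef a b d q) : HasC1 (fun x => x ^ 2 / a x)
    (fun x => (2 - x * dx a x / a x) * (x / a x)) := by
  have e : (fun x => x ^ 2 / a x) = fun x => x * (x / a x) := by funext x; ring
  rw [e]
  refine (HasC1.id.mul h.c1_div_a).congr' fun x hx => ?_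
  have := (h.a_pos hx).ne'
  field_simp; ring

theorem c1_sq_div_a_d (h : Coef a b d q) : HasC1 (fun x => x ^ 2 / (a x * d x))
    (fun x => (2 - x * dx a x / a x - x * dx d x / d x) * (x / (a x * d x))) := by
  have e : (fun x => x ^ 2 / (a x * d x)) = fun x => x ^ 2 / a x / d x := by
    funext x; rw [div_div]
  rw [e]
  refine (h.c1_sq_div_a.div h.deg_d.c1 fun x hx => (h.d_pos hx).ne').congr' fun x hx => ?_
  have := (h.a_pos hx).ne'
  have := (h.d_pos hx).ne'
  field_simp

theorem index_a_le (h : Coef a b d q) : degIndex a + 2 * degIndex d + 2 * q ≤ 2 := by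
  linarith [h.q_add_index]

/-- The logarithmic derivative of `x²/a` is `(2 - x a'/a)/x`, which is nonnegative because `K_a <
2`. The quotient is therefore largest at `1`. -/
theorem sq_div_a_le (h : Coef a b d q) {x : ℝ} (hx : x ∈ Ioc (0 : ℝ) 1) :
    x ^ 2 / a x ≤ 1 / a 1 := by
  have := h.c1_sq_div_a.monotoneOn (fun z hz => ?_) hx one_mem hx.2
  · simpa using this
  · have hz' := Ioo_subset_Ioc_self hz
    have h1 := (abs_le.1 (h.deg_a.bound z hz')).2
    have h2 := h.a_pos hz'
    have h3 := hz.1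
    have h4 : 0 ≤ 2 - z * dx a z / a z := by
      linarith [h.index_a_le, h.q_pos, h.deg_d.index_pos]
    positivity

theorem sq_div_a_d_le (h : Coef a b d q) {x : ℝ} (hx : x ∈ Ioc (0 : ℝ) 1) :
    x ^ 2 / (a x * d x) ≤ 1 / (a 1 * d 1) := by
  have := h.c1_sq_div_a_d.monotoneOn (fun z hz => ?_) hx one_mem hx.2
  · simpa using this
  · have hz' := Ioo_subset_Ioc_self hz
    have h1 := (abs_le.1 (h.deg_a.bound z hz')).2
    have h1' := (abs_le.1 (h.deg_d.bound z hz')).2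
    have h2 := h.a_pos hz'
    have h2' := h.d_pos hz'
    have h3 := hz.1
    have h4 : 0 ≤ 2 - z * dx a z / a z - z * dx d z / d z := by
      linarith [h.index_a_le, h.q_pos, h.deg_d.index_pos]
    positivity

/-- Here `x/a` is itself nondecreasing, which requires `K_a ≤ 1`. This is why the constant `M` is
defined by two cases. -/
theorem div_a_le (h : Coef a b d q) (hK : degIndex a ≤ 1) {x : ℝ} (hx : x ∈ Ioc (0 : ℝ) 1) :
    x / a x ≤ 1 / a 1 := by
  have := h.c1_div_a.monotoneOn (fun z hz => ?_) hx one_mem hx.2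
  · simpa using this
  · have hz' := Ioo_subset_Ioc_self hz
    have h1 := (abs_le.1 (h.deg_a.bound z hz')).2
    have h2 := h.a_pos hz'
    have h4 : 0 ≤ 1 - z * dx a z / a z := by linarith
    positivity

/-- The function `x η` is nondecreasing since `1 + x b/a ≥ 0`, and `η(1/2) = 1` by normalization. -/
theorem half_le_eta_one (h : Coef a b d q) : 1 / 2 ≤ eta a b 1 := by
  have := h.c1_mul_eta.monotoneOn (fun z hz => ?_) (a := 1 / 2) (b := 1)
    ⟨by norm_num, by norm_num⟩ one_mem (by norm_num)
  · simpa [eta] using this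
  · have hz' := Ioo_subset_Ioc_self hz
    have h1 := (abs_le.1 (h.strong z hz')).1
    have h4 : 0 ≤ 1 + z * b z / a z := by
      linarith [h.q_pos, h.deg_d.index_pos, h.deg_a.index_pos]
    exact mul_nonneg h4 (eta_pos z).le

/-- The derivative of the bounded function `x²/(a d)` dominates `K_d x/(a d)`. This is where `K_a +
2K_d ≤ 2` and `K_d > 0` yield the Hardy–Poincaré inequality with the weight `1/(σ d)`. -/
theorem integrableOn_div_a_d (h : Coef a b d q) :
    IntegrableOn (fun x => x / (a x * d x)) (Ioo 0 1) := by
  have hK := h.deg_d.index_pos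
  have h2 : IntegrableOn (fun x => degIndex d * (x / (a x * d x))) (Ioo 0 1) := by
    refine integrableOn_of_le_deriv h.c1_sq_div_a_d (fun x hx => ?_) ?_ (fun x hx => ?_)
      (fun x hx => ?_)
    · have := h.a_pos hx; have := h.d_pos hx; positivity
    · exact continuousOn_const.mul (continuousOn_id.div
        ((h.deg_a.cont.mul h.deg_d.cont).mono Ioc_subset_Icc_self)
        fun x hx => (mul_pos (h.a_pos hx) (h.d_pos hx)).ne')
    · have := h.a_pos hx; have := h.d_pos hx; have := hx.1; positivity
    · have := h.a_pos hx; have := h.d_pos hx; have := hx.1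
      have h1 := (abs_le.1 (h.deg_a.bound x hx)).2
      have h1' := (abs_le.1 (h.deg_d.bound x hx)).2
      have : degIndex d ≤ 2 - x * dx a x / a x - x * dx d x / d x := by
        linarith [h.index_a_le, h.q_pos]
      gcongr
  refine (h2.const_mul (degIndex d)⁻¹).congr (Eventually.of_forall fun x => ?_)
  field_simp

theorem integrableOn_div_a (h : Coef a b d q) :
    IntegrableOn (fun x => x / a x) (Ioo 0 1) := by
  have hK : 0 < 2 - degIndex a := by linarith [h.index_a_le, h.q_pos, h.deg_d.index_pos]
  have h2 : IntegrableOn (fun x => (2 - degIndex a) * (x / a x)) (Ioo 0 1) := by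
    refine integrableOn_of_le_deriv h.c1_sq_div_a (fun x hx => ?_) ?_ (fun x hx => ?_)
      (fun x hx => ?_)
    · have := h.a_pos hx; positivity
    · exact continuousOn_const.mul h.c1_div_a.continuousOn
    · have := h.a_pos hx; have := hx.1; positivity
    · have := h.a_pos hx; have := hx.1
      have h1 := (abs_le.1 (h.deg_a.bound x hx)).2
      gcongr
  refine (h2.const_mul (2 - degIndex a)⁻¹).congr (Eventually.of_forall fun x => ?_)
  field_simp

theorem integrableOn_inv_eta (h : Coef a b d q) :
    IntegrableOn (fun x => 1 / eta a b x) (Ioo 0 1) := by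
  have : ContinuousOn (fun x => 1 / eta a b x) (Icc 0 1) :=
    continuousOn_const.div h.eta_continuousOn fun x _ => (eta_pos x).ne'
  exact (this.integrableOn_compact isCompact_Icc).mono_set Ioo_subset_Icc_self

/-- Integrate `(x/η)' = (1 - x b/a)/η ≥ q/η` over `(0,1)`. The result is the constant in the trace
inequality `sq_one_le`. -/
theorem q_mul_integral_inv_eta_le (h : Coef a b d q) :
    q * ∫ x in Ioo (0 : ℝ) 1, 1 / eta a b x ≤ 1 / eta a b 1 := by
  have hm : AEStronglyMeasurable (fun x => 1 - x * b x / a x) (volume.restrict (Ioo 0 1)) := by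
    apply aestronglyMeasurable_of_continuousOn
    exact continuousOn_const.sub h.drift_cont
  have hi : IntegrableOn (fun x => (1 - x * b x / a x) / eta a b x) (Ioo 0 1) := by
    have : IntegrableOn (fun x => (1 - x * b x / a x) * (1 / eta a b x)) (Ioo 0 1) := by
      refine Integrable.bdd_mul (c := 2) h.integrableOn_inv_eta hm
        (ae_restrict_Ioo_of_forall fun x hx => ?_)
      have h1 := abs_le.1 (h.strong x (Ioo_subset_Ioc_self hx))
      rw [Real.norm_eq_abs, abs_le]
      constructor <;> linarith [h.q_pos, h.deg_d.index_pos, h.deg_a.index_pos]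
    simpa only [mul_one_div] using this
  have e := integral_eq_of_absCont 1 (fun r hr => h.c1_div_eta.absCont hr)
    (ae_restrict_Ioo_of_forall fun x hx => h.c1_div_eta.hasDerivAt hx) hi
    (h.integrableOn_inv_eta.congr (ae_restrict_Ioo_of_forall fun x hx => by
      have := eta_pos (a := a) (b := b) x
      have := hx.1
      simp only
      rw [pow_one, abs_of_pos (by positivity)]; field_simp))
  rw [← e, ← integral_const_mul]
  refine setIntegral_mono_on (h.integrableOn_inv_eta.const_mul q) hi measurableSet_Ioo
    fun x hx => ?_
  have h1 := abs_le.1 (h.strong x (Ioo_subset_Ioc_self hx))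
  have := eta_pos (a := a) (b := b) x
  rw [mul_one_div]
  gcongr
  linarith [h.deg_d.index_pos, h.deg_a.index_pos]

end Coef

/-! ### Passage from curves of functions to curves in a normed space -/

open Classical in
/-- The class in `L²(0,1)` of a square integrable function, `0` for other functions. -/
noncomputable def emb (f : ℝ → ℝ) : Lp ℝ 2 (volume.restrict (Ioo (0 : ℝ) 1)) :=
  if h : MemLp f 2 (volume.restrict (Ioo (0 : ℝ) 1)) then h.toLp f else 0

section emb
variable {f g : ℝ → ℝ}

theorem emb_eq (h : MemLp f 2 (volume.restrict (Ioo (0 : ℝ) 1))) : emb f = h.toLp f := dif_pos h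

theorem inner_emb (hf : MemLp f 2 (volume.restrict (Ioo (0 : ℝ) 1)))
    (hg : MemLp g 2 (volume.restrict (Ioo (0 : ℝ) 1))) :
    ⟪emb f, emb g⟫ = ∫ x in Ioo (0 : ℝ) 1, f x * g x := by
  rw [emb_eq hf, emb_eq hg, L2.inner_def]
  apply integral_congr_ae
  filter_upwards [hf.coeFn_toLp, hg.coeFn_toLp] with x h1 h2
  rw [h1, h2]; simp [mul_comm]

theorem norm_sq_emb (hf : MemLp f 2 (volume.restrict (Ioo (0 : ℝ) 1))) :
    ‖emb f‖ ^ 2 = ∫ x in Ioo (0 : ℝ) 1, f x ^ 2 := by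
  rw [← real_inner_self_eq_norm_sq, inner_emb hf hf]
  simp only [sq]

theorem emb_congr (h : f =ᵐ[volume.restrict (Ioo (0 : ℝ) 1)] g) : emb f = emb g := by
  by_cases hf : MemLp f 2 (volume.restrict (Ioo (0 : ℝ) 1))
  · have hg := (memLp_congr_ae h).1 hf
    rw [emb_eq hf, emb_eq hg]
    exact MemLp.toLp_congr hf hg h
  · have hg : ¬ MemLp g 2 (volume.restrict (Ioo (0 : ℝ) 1)) := fun hg =>
      hf ((memLp_congr_ae h).2 hg)
    rw [emb, emb, dif_neg hf, dif_neg hg]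

theorem emb_sub (hf : MemLp f 2 (volume.restrict (Ioo (0 : ℝ) 1)))
    (hg : MemLp g 2 (volume.restrict (Ioo (0 : ℝ) 1))) :
    emb (fun x => f x - g x) = emb f - emb g := by
  rw [emb_eq hf, emb_eq hg, ← MemLp.toLp_sub hf hg]
  exact emb_eq (hf.sub hg)

theorem emb_smul (c : ℝ) (hf : MemLp f 2 (volume.restrict (Ioo (0 : ℝ) 1))) :
    emb (fun x => c * f x) = c • emb f := by
  rw [emb_eq hf, ← MemLp.toLp_const_smul c hf]
  exact emb_eq (hf.const_smul c)

end emb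

/-- Cauchy–Schwarz inequality. -/
theorem sq_integral_mul_le {s : Set ℝ} {f g : ℝ → ℝ} (hf : MemLp f 2 (volume.restrict s))
    (hg : MemLp g 2 (volume.restrict s)) :
    (∫ x in s, f x * g x) ^ 2 ≤ (∫ x in s, f x ^ 2) * ∫ x in s, g x ^ 2 := by
  have key : ∀ {f g : ℝ → ℝ} (hf : MemLp f 2 (volume.restrict s))
      (hg : MemLp g 2 (volume.restrict s)), ⟪hf.toLp f, hg.toLp g⟫ = ∫ x in s, f x * g x := by
    intro f g hf hg
    rw [L2.inner_def]
    apply integral_congr_ae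
    filter_upwards [hf.coeFn_toLp, hg.coeFn_toLp] with x h1 h2
    rw [h1, h2]; simp [mul_comm]
  have := real_inner_mul_inner_self_le (hf.toLp f) (hg.toLp g)
  rw [key, key, key] at this
  simpa only [sq] using this

/-- A class of functions stable under linear combinations. -/
structure IsLinClass (P : (ℝ → ℝ) → Prop) : Prop where
  sub : ∀ u v, P u → P v → P (fun x => u x - v x)
  smul : ∀ (c : ℝ) u, P u → P (fun x => c * u x)

/-- A linear map on the class `P`, bounded for the norm whose square is `N`. -/
structure BddMap {Z : Type*} [NormedAddCommGroup Z] [NormedSpace ℝ Z] (P : (ℝ → ℝ) → Prop)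
    (N : (ℝ → ℝ) → ℝ) (T : (ℝ → ℝ) → Z) : Prop where
  sub : ∀ u v, P u → P v → T (fun x => u x - v x) = T u - T v
  smul : ∀ (c : ℝ) u, P u → T (fun x => c * u x) = c • T u
  bound : ∃ C : ℝ, ∀ u, P u → ‖T u‖ ^ 2 ≤ C * N u

namespace BddMap
variable {Z : Type*} [NormedAddCommGroup Z] [NormedSpace ℝ Z] {P : (ℝ → ℝ) → Prop}
  {N : (ℝ → ℝ) → ℝ} {T : (ℝ → ℝ) → Z} {y v : ℝ → ℝ → ℝ}

theorem tendsto_zero (h : BddMap P N T) {l : Filter ℝ} {w : ℝ → ℝ → ℝ} (hw : ∀ᶠ t in l, P (w t))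
    (h0 : Tendsto (fun t => N (w t)) l (𝓝 0)) : Tendsto (fun t => T (w t)) l (𝓝 0) := by
  obtain ⟨C, hC⟩ := h.bound
  have h1 : Tendsto (fun t => ‖T (w t)‖ ^ 2) l (𝓝 0) := by
    refine tendsto_of_tendsto_of_tendsto_of_le_of_le' tendsto_const_nhds
      (by simpa using h0.const_mul C) (Eventually.of_forall fun t => sq_nonneg _) ?_
    filter_upwards [hw] with t ht using hC _ ht
  rw [tendsto_zero_iff_norm_tendsto_zero]
  simpa using h1.sqrt

/-- A bounded linear map commutes with difference quotients, so differentiability for the norm `N`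
becomes an ordinary derivative in `Z`. Product and chain rules are then available for the energies.
-/
theorem hasDerivWithinAt (h : BddMap P N T) (hP : IsLinClass P) (hy : ∀ t, 0 ≤ t → P (y t))
    (hv : ∀ t, 0 ≤ t → P (v t)) (hd : CurveDeriv N y v) {t₀ : ℝ} (ht₀ : 0 ≤ t₀) :
    HasDerivWithinAt (fun t => T (y t)) (T (v t₀)) (Ici 0) t₀ := by
  rw [hasDerivWithinAt_iff_tendsto_slope]
  have hmem : ∀ᶠ t in 𝓝[Ici 0 \ {t₀}] t₀, 0 ≤ t := by
    filter_upwards [self_mem_nhdsWithin] with t ht using ht.1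
  have hq : ∀ t, 0 ≤ t → P (fun x => (t - t₀)⁻¹ * (y t x - y t₀ x)) := fun t ht =>
    hP.smul _ _ (hP.sub _ _ (hy t ht) (hy t₀ ht₀))
  have hd' := hd t₀ ht₀
  simp only [div_eq_inv_mul] at hd'
  have := h.tendsto_zero (w := fun t x => (t - t₀)⁻¹ * (y t x - y t₀ x) - v t₀ x)
    (hmem.mono fun t ht => hP.sub _ _ (hq t ht) (hv t₀ ht₀)) hd'
  rw [← tendsto_sub_nhds_zero_iff]
  refine this.congr' ?_
  filter_upwards [hmem] with t ht
  rw [h.sub _ _ (hq t ht) (hv t₀ ht₀), h.smul _ _ (hP.sub _ _ (hy t ht) (hy t₀ ht₀)),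
    h.sub _ _ (hy t ht) (hy t₀ ht₀)]
  simp [slope]

theorem continuousOn (h : BddMap P N T) (hP : IsLinClass P) (hy : ∀ t, 0 ≤ t → P (y t))
    (hc : CurveCont N y) : ContinuousOn (fun t => T (y t)) (Ici 0) := by
  intro t₀ ht₀
  have := h.tendsto_zero (w := fun t x => y t x - y t₀ x) (l := 𝓝[Ici 0] t₀)
    (by filter_upwards [self_mem_nhdsWithin] with t ht using hP.sub _ _ (hy t ht) (hy t₀ ht₀))
    (hc t₀ ht₀)
  rw [ContinuousWithinAt, ← tendsto_sub_nhds_zero_iff]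
  refine this.congr' ?_
  filter_upwards [self_mem_nhdsWithin] with t ht
  exact h.sub _ _ (hy t ht) (hy t₀ ht₀)

end BddMap

/-! ### Functions in the weighted Sobolev space and Hardy–Poincaré inequalities -/

theorem dx_eq_deriv (u : ℝ → ℝ) {x : ℝ} (hx : x ∈ Ioo (0 : ℝ) 1) : dx u x = deriv u x :=
  derivWithin_of_mem_nhds (Icc_mem_nhds hx.1 hx.2)

theorem ae_hasDerivAt_of_absCont {u : ℝ → ℝ}
    (h : ∀ r ∈ Ioo (0 : ℝ) 1, AbsolutelyContinuousOnInterval u r 1) :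
    ∀ᵐ x ∂(volume.restrict (Ioo (0 : ℝ) 1)), HasDerivAt u (dx u x) x := by
  have h1 : ∀ n : ℕ, ∀ᵐ x : ℝ, x ∈ uIcc (1 / ((n : ℝ) + 2)) 1 → DifferentiableAt ℝ u x := by
    intro n
    refine (h _ ⟨by positivity, ?_⟩).ae_differentiableAt
    rw [div_lt_one (by positivity)]
    have : (0 : ℝ) ≤ n := n.cast_nonneg
    linarith
  rw [ae_restrict_iff' measurableSet_Ioo]
  filter_upwards [ae_all_iff.2 h1] with x hx hx01
  obtain ⟨n, hn⟩ := exists_nat_one_div_lt hx01.1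
  rw [dx_eq_deriv u hx01]
  refine (hx n ?_).hasDerivAt
  rw [mem_uIcc]
  refine Or.inl ⟨?_, hx01.2.le⟩
  refine le_trans ?_ hn.le
  gcongr
  norm_num

namespace MemH1
variable {a b d : ℝ → ℝ} {q : ℝ} {u v : ℝ → ℝ}

theorem absCont_Icc (h : MemH1 a b u) {r : ℝ} (hr : r ∈ Ioo (0 : ℝ) 1) :
    AbsolutelyContinuousOnInterval u r 1 :=
  h.absCont.mono (by
    rw [uIcc_of_le zero_le_one, uIcc_of_le hr.2.le]; exact Icc_subset_Icc_left hr.1.le)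

theorem ae_hasDerivAt (h : MemH1 a b u) :
    ∀ᵐ x ∂(volume.restrict (Ioo (0 : ℝ) 1)), HasDerivAt u (dx u x) x :=
  ae_hasDerivAt_of_absCont fun _ hr => h.absCont_Icc hr

theorem continuousOn (h : MemH1 a b u) : ContinuousOn u (Icc 0 1) := by
  have := h.absCont.continuousOn
  rwa [uIcc_of_le zero_le_one] at this

theorem eq_integral (h : MemH1 a b u) {x : ℝ} (hx : x ∈ Icc (0 : ℝ) 1) :
    u x = ∫ z in Ioo 0 x, dx u z := by
  have hac : AbsolutelyContinuousOnInterval u 0 x := h.absCont.mono (by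
    rw [uIcc_of_le zero_le_one, uIcc_of_le hx.1]; exact Icc_subset_Icc_right hx.2)
  have := hac.integral_deriv_eq_sub
  rw [h.zero, sub_zero, intervalIntegral.integral_of_le hx.1, integral_Ioc_eq_integral_Ioo] at this
  rw [← this]
  exact setIntegral_congr_fun measurableSet_Ioo fun z hz =>
    (dx_eq_deriv u ⟨hz.1, hz.2.trans_le hx.2⟩).symm

/-- Cauchy–Schwarz applied to `u(x) = ∫₀ˣ u'`. The factor `x` is what compensates the singular
weights at `0`. -/
theorem sq_le (h : MemH1 a b u) {x : ℝ} (hx : x ∈ Icc (0 : ℝ) 1) :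
    u x ^ 2 ≤ x * ∫ z in Ioo (0 : ℝ) 1, dx u z ^ 2 := by
  have hsub : Ioo 0 x ⊆ Ioo (0 : ℝ) 1 := Ioo_subset_Ioo_right hx.2
  have hm : MemLp (dx u) 2 (volume.restrict (Ioo 0 x)) :=
    h.deriv_memLp.mono_measure (Measure.restrict_mono hsub le_rfl)
  have h1 := sq_integral_mul_le (s := Ioo 0 x) (memLp_const (1 : ℝ)) hm
  have h2 : ∫ z in Ioo 0 x, dx u z ^ 2 ≤ ∫ z in Ioo (0 : ℝ) 1, dx u z ^ 2 :=
    setIntegral_mono_set h.deriv_memLp.integrable_sq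
      (Eventually.of_forall fun z => sq_nonneg _) hsub.eventuallyLE
  simp only [one_mul, one_pow, setIntegral_const, Measure.real, Real.volume_Ioo, sub_zero,
    smul_eq_mul, mul_one, ENNReal.toReal_ofReal hx.1] at h1
  rw [h.eq_integral hx]
  exact h1.trans (mul_le_mul_of_nonneg_left h2 hx.1)

end MemH1

/-- The weight `σ^{-1/2}`. -/
noncomputable def rhoSigma (a b : ℝ → ℝ) (x : ℝ) : ℝ := √(1 / sigma a b x)

/-- The weight `η^{1/2}`. -/
noncomputable def rhoEta (a b : ℝ → ℝ) (x : ℝ) : ℝ := √(eta a b x)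

/-- The weight `(σ d)^{-1/2}`. -/
noncomputable def rhoHardy (a b d : ℝ → ℝ) (x : ℝ) : ℝ := √(1 / (sigma a b x * d x))

/-- The weight `x σ^{-1/2}`. -/
noncomputable def rhoMult (a b : ℝ → ℝ) (x : ℝ) : ℝ := x * √(1 / sigma a b x)

namespace Coef
variable {a b d : ℝ → ℝ} {q : ℝ} {u v : ℝ → ℝ}

theorem sigma_cont (h : Coef a b d q) : ContinuousOn (sigma a b) (Ioc 0 1) :=
  h.deg_a.c1.continuousOn.div h.eta_c1.continuousOn fun x _ => (eta_pos x).ne'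

theorem rhoSigma_sq (h : Coef a b d q) {x : ℝ} (hx : x ∈ Ioo (0 : ℝ) 1) :
    rhoSigma a b x ^ 2 = 1 / sigma a b x :=
  Real.sq_sqrt (by have := h.sigma_pos (Ioo_subset_Ioc_self hx); positivity)

theorem rhoEta_sq (x : ℝ) : rhoEta a b x ^ 2 = eta a b x := Real.sq_sqrt (eta_pos x).le

theorem rhoHardy_sq (h : Coef a b d q) {x : ℝ} (hx : x ∈ Ioo (0 : ℝ) 1) :
    rhoHardy a b d x ^ 2 = 1 / (sigma a b x * d x) :=
  Real.sq_sqrt (by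
    have := h.sigma_pos (Ioo_subset_Ioc_self hx)
    have := h.d_pos (Ioo_subset_Ioc_self hx)
    positivity)

theorem rhoMult_sq (h : Coef a b d q) {x : ℝ} (hx : x ∈ Ioo (0 : ℝ) 1) :
    rhoMult a b x ^ 2 = x ^ 2 / sigma a b x := by
  rw [rhoMult, mul_pow]
  have := h.rhoSigma_sq hx
  rw [rhoSigma] at this
  rw [this]; ring

theorem rhoSigma_cont (h : Coef a b d q) : ContinuousOn (rhoSigma a b) (Ioc 0 1) :=
  (continuousOn_const.div h.sigma_cont fun _ hx => (h.sigma_pos hx).ne').sqrt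

theorem rhoEta_cont (h : Coef a b d q) : ContinuousOn (rhoEta a b) (Ioc 0 1) :=
  h.eta_c1.continuousOn.sqrt

theorem rhoHardy_cont (h : Coef a b d q) : ContinuousOn (rhoHardy a b d) (Ioc 0 1) :=
  (continuousOn_const.div (h.sigma_cont.mul h.deg_d.c1.continuousOn)
    fun _ hx => (mul_pos (h.sigma_pos hx) (h.d_pos hx)).ne').sqrt

theorem rhoMult_cont (h : Coef a b d q) : ContinuousOn (rhoMult a b) (Ioc 0 1) :=
  continuousOn_id.mul h.rhoSigma_cont

theorem memL2_iff (h : Coef a b d q) : MemL2 a b u ↔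
    MemLp u 2 (volume.restrict (Ioo 0 1)) ∧
      MemLp (fun x => rhoSigma a b x * u x) 2 (volume.restrict (Ioo 0 1)) := by
  refine and_congr_right fun hu => ?_
  have hm : AEStronglyMeasurable (fun x => rhoSigma a b x * u x) (volume.restrict (Ioo 0 1)) :=
    (aestronglyMeasurable_of_continuousOn h.rhoSigma_cont).mul hu.1
  rw [memLp_two_iff_integrable_sq hm]
  refine integrable_congr (ae_restrict_Ioo_of_forall fun x hx => ?_)
  simp only [mul_pow, h.rhoSigma_sq hx]
  ring

theorem sqL2_eq (h : Coef a b d q) :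
    sqL2 a b u = ∫ x in Ioo (0 : ℝ) 1, (rhoSigma a b x * u x) ^ 2 := by
  rw [sqL2, intervalIntegral_eq]
  refine setIntegral_congr_fun measurableSet_Ioo fun x hx => ?_
  simp only [mul_pow, h.rhoSigma_sq hx]
  ring

theorem isLinClass_memL2 (h : Coef a b d q) : IsLinClass (MemL2 a b) := by
  constructor
  · intro u v hu hv
    rw [h.memL2_iff] at *
    refine ⟨hu.1.sub hv.1, (hu.2.sub hv.2).ae_eq (Eventually.of_forall fun x => ?_)⟩
    simp only [Pi.sub_apply]; ring
  · intro c u hu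
    rw [h.memL2_iff] at *
    refine ⟨hu.1.const_mul c, (hu.2.const_mul c).ae_eq (Eventually.of_forall fun x => ?_)⟩
    simp only; ring

/-- Only almost everywhere: at points without differentiability `dx` takes a default value and need
not be additive. -/
theorem dx_sub_ae (hu : MemH1 a b u) (hv : MemH1 a b v) :
    dx (fun x => u x - v x) =ᵐ[volume.restrict (Ioo 0 1)] fun x => dx u x - dx v x := by
  filter_upwards [hu.ae_hasDerivAt, hv.ae_hasDerivAt, ae_restrict_mem measurableSet_Ioo]
    with x h1 h2 hx
  rw [dx_eq_deriv _ hx]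
  exact (h1.sub h2).deriv

theorem dx_smul_ae (c : ℝ) (hu : MemH1 a b u) :
    dx (fun x => c * u x) =ᵐ[volume.restrict (Ioo 0 1)] fun x => c * dx u x := by
  filter_upwards [hu.ae_hasDerivAt, ae_restrict_mem measurableSet_Ioo] with x h1 hx
  rw [dx_eq_deriv _ hx]
  exact (h1.const_mul c).deriv

theorem isLinClass_memH1 (h : Coef a b d q) : IsLinClass (MemH1 a b) := by
  constructor
  · intro u v hu hv
    exact ⟨h.isLinClass_memL2.sub _ _ hu.memL2 hv.memL2, hu.absCont.fun_sub hv.absCont,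
      (hu.deriv_memLp.sub hv.deriv_memLp).ae_eq (dx_sub_ae hu hv).symm,
      by simp [hu.zero, hv.zero]⟩
  · intro c u hu
    exact ⟨h.isLinClass_memL2.smul _ _ hu.memL2, hu.absCont.const_mul c,
      (hu.deriv_memLp.const_mul c).ae_eq (dx_smul_ae c hu).symm, by simp [hu.zero]⟩

theorem memLp_mul_of_sq_le {ρ θ f : ℝ → ℝ} {C : ℝ} (hρ : ContinuousOn ρ (Ioc 0 1))
    (hf : MemLp (fun x => θ x * f x) 2 (volume.restrict (Ioo 0 1)))
    (hm : AEStronglyMeasurable f (volume.restrict (Ioo 0 1)))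
    (hle : ∀ x ∈ Ioo (0 : ℝ) 1, ρ x ^ 2 ≤ C * θ x ^ 2) :
    MemLp (fun x => ρ x * f x) 2 (volume.restrict (Ioo 0 1)) ∧
      ∫ x in Ioo (0 : ℝ) 1, (ρ x * f x) ^ 2 ≤ C * ∫ x in Ioo (0 : ℝ) 1, (θ x * f x) ^ 2 := by
  have hρm : AEStronglyMeasurable (fun x => ρ x * f x) (volume.restrict (Ioo 0 1)) :=
    (aestronglyMeasurable_of_continuousOn hρ).mul hm
  have hb : ∀ x ∈ Ioo (0 : ℝ) 1, (ρ x * f x) ^ 2 ≤ C * (θ x * f x) ^ 2 := fun x hx => by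
    have := mul_le_mul_of_nonneg_right (hle x hx) (sq_nonneg (f x))
    rw [mul_pow, mul_pow]; linarith
  have h1 : MemLp (fun x => ρ x * f x) 2 (volume.restrict (Ioo 0 1)) := by
    rw [memLp_two_iff_integrable_sq hρm]
    refine Integrable.mono' (hf.integrable_sq.const_mul C) (hρm.pow 2)
      (ae_restrict_Ioo_of_forall fun x hx => ?_)
    rw [Real.norm_of_nonneg (sq_nonneg _)]
    exact hb x hx
  refine ⟨h1, ?_⟩
  rw [← integral_const_mul]
  exact setIntegral_mono_on h1.integrable_sq (hf.integrable_sq.const_mul C) measurableSet_Ioo hb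

theorem memLp_rhoEta (h : Coef a b d q) (hu : MemH1 a b u) :
    MemLp (fun x => rhoEta a b x * dx u x) 2 (volume.restrict (Ioo 0 1)) := by
  obtain ⟨c, C, -, hC⟩ := h.exists_eta_bounds
  refine (memLp_mul_of_sq_le (θ := fun _ => 1) (C := C) h.rhoEta_cont
    (by simpa using hu.deriv_memLp) hu.deriv_memLp.1 fun x hx => ?_).1
  rw [rhoEta_sq]
  simpa using (hC x (Ioo_subset_Icc_self hx)).2

theorem memLp_rhoSigma (h : Coef a b d q) (hu : MemL2 a b u) :
    MemLp (fun x => rhoSigma a b x * u x) 2 (volume.restrict (Ioo 0 1)) := (h.memL2_iff.1 hu).2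

/-- Since `x²/σ = (x²/a) η ≤ η/a(1)`, the multiplier `x u'` is controlled by the elastic energy.
This is the source of the term `1/a(1)` in `Θ`. -/
theorem memLp_rhoMult (h : Coef a b d q) (hu : MemH1 a b u) :
    MemLp (fun x => rhoMult a b x * dx u x) 2 (volume.restrict (Ioo 0 1)) ∧
      ∫ x in Ioo (0 : ℝ) 1, (rhoMult a b x * dx u x) ^ 2 ≤
        1 / a 1 * ∫ x in Ioo (0 : ℝ) 1, (rhoEta a b x * dx u x) ^ 2 := by
  refine memLp_mul_of_sq_le h.rhoMult_cont (h.memLp_rhoEta hu) hu.deriv_memLp.1 fun x hx => ?_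
  rw [rhoEta_sq, h.rhoMult_sq hx]
  have h1 := h.sq_div_a_le (Ioo_subset_Ioc_self hx)
  have := (eta_pos (a := a) (b := b) x)
  calc x ^ 2 / sigma a b x = x ^ 2 / a x * eta a b x := by rw [sigma]; field_simp
    _ ≤ _ := by gcongr

theorem integral_sq_le (h : Coef a b d q) (hu : MemH1 a b u) :
    ∫ x in Ioo (0 : ℝ) 1, dx u x ^ 2 ≤
      1 / etaMin a b * ∫ x in Ioo (0 : ℝ) 1, (rhoEta a b x * dx u x) ^ 2 := by
  rw [← integral_const_mul]
  refine setIntegral_mono_on hu.deriv_memLp.integrable_sq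
    ((h.memLp_rhoEta hu).integrable_sq.const_mul _) measurableSet_Ioo fun x hx => ?_
  rw [mul_pow, rhoEta_sq, one_div, le_inv_mul_iff₀ h.etaMin_pos]
  exact mul_le_mul_of_nonneg_right (etaMin_le (Ioo_subset_Icc_self hx)) (sq_nonneg _)

theorem sq_eval_le (h : Coef a b d q) (hu : MemH1 a b u) {x : ℝ} (hx : x ∈ Icc (0 : ℝ) 1) :
    u x ^ 2 ≤ 1 / etaMin a b * ∫ x in Ioo (0 : ℝ) 1, (rhoEta a b x * dx u x) ^ 2 := by
  refine (hu.sq_le hx).trans (le_trans ?_ (h.integral_sq_le hu))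
  have : 0 ≤ ∫ z in Ioo (0 : ℝ) 1, dx u z ^ 2 := integral_nonneg fun _ => sq_nonneg _
  exact mul_le_of_le_one_left this hx.2

/-- The value at `1` is controlled by the weighted Dirichlet integral. -/
theorem sq_one_le (h : Coef a b d q) (hu : MemH1 a b u) :
    q * u 1 ^ 2 ≤ 1 / eta a b 1 * ∫ x in Ioo (0 : ℝ) 1, (rhoEta a b x * dx u x) ^ 2 := by
  have h1 : MemLp (fun x => 1 / rhoEta a b x) 2 (volume.restrict (Ioo 0 1)) := by
    have hm : ContinuousOn (fun x => 1 / rhoEta a b x) (Ioc 0 1) :=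
      continuousOn_const.div h.rhoEta_cont fun x _ => (Real.sqrt_pos.2 (eta_pos x)).ne'
    rw [memLp_two_iff_integrable_sq (aestronglyMeasurable_of_continuousOn hm)]
    simp only [div_pow, rhoEta_sq, one_pow]
    exact h.integrableOn_inv_eta
  have h2 := sq_integral_mul_le h1 (h.memLp_rhoEta hu)
  -- Cauchy–Schwarz is applied to `u(1) = ∫ η^{-1/2} · η^{1/2} u'`.
  have e : ∫ x in Ioo (0 : ℝ) 1, 1 / rhoEta a b x * (rhoEta a b x * dx u x) = u 1 := by
    rw [hu.eq_integral ⟨zero_le_one, le_rfl⟩]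
    refine setIntegral_congr_fun measurableSet_Ioo fun x _ => ?_
    have : rhoEta a b x ≠ 0 := (Real.sqrt_pos.2 (eta_pos x)).ne'
    field_simp
  rw [e] at h2
  simp only [div_pow, rhoEta_sq, one_pow] at h2
  have h3 : 0 ≤ ∫ x in Ioo (0 : ℝ) 1, (rhoEta a b x * dx u x) ^ 2 :=
    integral_nonneg fun _ => sq_nonneg _
  nlinarith [mul_le_mul_of_nonneg_right h.q_mul_integral_inv_eta_le h3, h.q_pos]

/-- Hardy–Poincaré inequality for a weight `ρ` with `x ρ²` integrable. -/
theorem hardy_of_integrable {ρ : ℝ → ℝ} (hρ : ContinuousOn ρ (Ioc 0 1))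
    (hi : IntegrableOn (fun x => ρ x ^ 2 * x) (Ioo 0 1)) (hu : MemH1 a b u) :
    MemLp (fun x => ρ x * u x) 2 (volume.restrict (Ioo 0 1)) ∧
      ∫ x in Ioo (0 : ℝ) 1, (ρ x * u x) ^ 2 ≤
        (∫ x in Ioo (0 : ℝ) 1, ρ x ^ 2 * x) * ∫ x in Ioo (0 : ℝ) 1, dx u x ^ 2 := by
  have hm : AEStronglyMeasurable (fun x => ρ x * u x) (volume.restrict (Ioo 0 1)) :=
    aestronglyMeasurable_of_continuousOn (hρ.mul (hu.continuousOn.mono Ioc_subset_Icc_self))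
  have hb : ∀ x ∈ Ioo (0 : ℝ) 1,
      (ρ x * u x) ^ 2 ≤ (ρ x ^ 2 * x) * ∫ x in Ioo (0 : ℝ) 1, dx u x ^ 2 := fun x hx => by
    rw [mul_pow, mul_assoc]
    exact mul_le_mul_of_nonneg_left (hu.sq_le (Ioo_subset_Icc_self hx)) (sq_nonneg _)
  have h1 : MemLp (fun x => ρ x * u x) 2 (volume.restrict (Ioo 0 1)) := by
    rw [memLp_two_iff_integrable_sq hm]
    refine Integrable.mono' (hi.mul_const (∫ x in Ioo (0 : ℝ) 1, dx u x ^ 2)) (hm.pow 2) (ae_restrict_Ioo_of_forall fun x hx => ?_)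
    rw [Real.norm_of_nonneg (sq_nonneg _)]
    exact hb x hx
  refine ⟨h1, ?_⟩
  rw [← integral_mul_const]
  exact setIntegral_mono_on h1.integrable_sq (hi.mul_const _) measurableSet_Ioo hb

theorem integrableOn_rho {ρ g : ℝ → ℝ} (h : Coef a b d q) (hg : IntegrableOn g (Ioo 0 1))
    (e : ∀ x ∈ Ioo (0 : ℝ) 1, ρ x ^ 2 * x = eta a b x * g x) :
    IntegrableOn (fun x => ρ x ^ 2 * x) (Ioo 0 1) := by
  obtain ⟨c, C, hc, hC⟩ := h.exists_eta_bounds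
  have : IntegrableOn (fun x => eta a b x * g x) (Ioo 0 1) :=
    Integrable.bdd_mul (c := C) hg (aestronglyMeasurable_of_continuousOn h.eta_c1.continuousOn)
      (ae_restrict_Ioo_of_forall fun x hx => by
        rw [Real.norm_of_nonneg (eta_pos x).le]
        exact (hC x (Ioo_subset_Icc_self hx)).2)
  exact this.congr (ae_restrict_Ioo_of_forall fun x hx => (e x hx).symm)

theorem integrableOn_rhoHardy (h : Coef a b d q) :
    IntegrableOn (fun x => rhoHardy a b d x ^ 2 * x) (Ioo 0 1) :=
  h.integrableOn_rho h.integrableOn_div_a_d fun x hx => by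
    have := h.a_pos (Ioo_subset_Ioc_self hx)
    have := h.d_pos (Ioo_subset_Ioc_self hx)
    have := (eta_pos (a := a) (b := b) x)
    rw [h.rhoHardy_sq hx, sigma]; field_simp

theorem integrableOn_rhoSigma (h : Coef a b d q) :
    IntegrableOn (fun x => rhoSigma a b x ^ 2 * x) (Ioo 0 1) :=
  h.integrableOn_rho h.integrableOn_div_a fun x hx => by
    have := h.a_pos (Ioo_subset_Ioc_self hx)
    have := (eta_pos (a := a) (b := b) x)
    rw [h.rhoSigma_sq hx, sigma]; field_simp

theorem memLp_rhoHardy (h : Coef a b d q) (hu : MemH1 a b u) :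
    MemLp (fun x => rhoHardy a b d x * u x) 2 (volume.restrict (Ioo 0 1)) :=
  (hardy_of_integrable h.rhoHardy_cont h.integrableOn_rhoHardy hu).1

/-- The best constant of a family of inequalities is attained. -/
theorem le_sInf_mul {ι : Type*} {A B : ι → ℝ} (hB : ∀ i, 0 ≤ B i) (i : ι)
    (hne : ∃ C, 0 ≤ C ∧ ∀ i, A i ≤ C * B i) :
    A i ≤ sInf {C : ℝ | 0 ≤ C ∧ ∀ i, A i ≤ C * B i} * B i := by
  obtain ⟨C, hC⟩ := hne
  rcases (hB i).eq_or_lt with h0 | h0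
  · have := hC.2 i
    rw [← h0] at this ⊢
    simpa using this
  · rw [← div_le_iff₀ h0]
    refine le_csInf ⟨C, hC⟩ fun D hD => ?_
    rw [div_le_iff₀ h0]
    exact hD.2 i

theorem integral_rhoEta (u : ℝ → ℝ) : ∫ x in (0 : ℝ)..1, eta a b x * dx u x ^ 2 =
    ∫ x in Ioo (0 : ℝ) 1, (rhoEta a b x * dx u x) ^ 2 := by
  rw [intervalIntegral_eq]
  simp only [mul_pow, rhoEta_sq]

theorem integral_rhoHardy (h : Coef a b d q) (u : ℝ → ℝ) :
    ∫ x in (0 : ℝ)..1, u x ^ 2 / (sigma a b x * d x) =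
      ∫ x in Ioo (0 : ℝ) 1, (rhoHardy a b d x * u x) ^ 2 := by
  rw [intervalIntegral_eq]
  refine setIntegral_congr_fun measurableSet_Ioo fun x hx => ?_
  simp only [mul_pow, h.rhoHardy_sq hx]
  ring

theorem CHP_nonneg : 0 ≤ CHP a b d := Real.sInf_nonneg fun _ h => h.1

theorem CHPtilde_nonneg : 0 ≤ CHPtilde a b := Real.sInf_nonneg fun _ h => h.1

theorem le_CHP (h : Coef a b d q) (hu : MemH1 a b u) :
    ∫ x in Ioo (0 : ℝ) 1, (rhoHardy a b d x * u x) ^ 2 ≤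
      CHP a b d * ∫ x in Ioo (0 : ℝ) 1, (rhoEta a b x * dx u x) ^ 2 := by
  have := le_sInf_mul (ι := {u // MemH1 a b u})
    (A := fun u => ∫ x in (0 : ℝ)..1, u.1 x ^ 2 / (sigma a b x * d x))
    (B := fun u => ∫ x in (0 : ℝ)..1, eta a b x * dx u.1 x ^ 2)
    (fun u => by rw [integral_rhoEta]; exact integral_nonneg fun _ => sq_nonneg _) ⟨u, hu⟩ ?_
  · simp only [Subtype.forall] at this
    rw [h.integral_rhoHardy, integral_rhoEta] at this
    exact this
  -- Some finite admissible constant has to exist, since the infimum of an empty set is `0` by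
  -- default. The bound `u² ≤ x ∫ (u')²` supplies one.
  · have hnn : 0 ≤ ∫ x in Ioo (0 : ℝ) 1, rhoHardy a b d x ^ 2 * x :=
      setIntegral_nonneg measurableSet_Ioo fun x hx => mul_nonneg (sq_nonneg _) hx.1.le
    have := h.etaMin_pos
    refine ⟨(∫ x in Ioo (0 : ℝ) 1, rhoHardy a b d x ^ 2 * x) * (1 / etaMin a b), by positivity,
      fun u => ?_⟩
    rw [h.integral_rhoHardy, integral_rhoEta, mul_assoc]
    exact (hardy_of_integrable h.rhoHardy_cont h.integrableOn_rhoHardy u.2).2.trans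
      (mul_le_mul_of_nonneg_left (h.integral_sq_le u.2) hnn)

theorem le_CHPtilde (h : Coef a b d q) (hu : MemH1 a b u) :
    ∫ x in Ioo (0 : ℝ) 1, (rhoSigma a b x * u x) ^ 2 ≤
      CHPtilde a b / etaMin a b * ∫ x in Ioo (0 : ℝ) 1, (rhoEta a b x * dx u x) ^ 2 := by
  have := le_sInf_mul (ι := {u // MemH1 a b u})
    (A := fun u => ∫ x in (0 : ℝ)..1, u.1 x ^ 2 / sigma a b x)
    (B := fun u => ∫ x in (0 : ℝ)..1, dx u.1 x ^ 2)
    (fun u => by rw [intervalIntegral_eq]; exact integral_nonneg fun _ => sq_nonneg _) ⟨u, hu⟩ ?_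
  · simp only [Subtype.forall] at this
    change sqL2 a b u ≤ CHPtilde a b * _ at this
    rw [h.sqL2_eq, intervalIntegral_eq] at this
    refine this.trans ?_
    rw [div_eq_mul_one_div, mul_assoc]
    exact mul_le_mul_of_nonneg_left (h.integral_sq_le hu) CHPtilde_nonneg
  · have hnn : 0 ≤ ∫ x in Ioo (0 : ℝ) 1, rhoSigma a b x ^ 2 * x :=
      setIntegral_nonneg measurableSet_Ioo fun x hx => mul_nonneg (sq_nonneg _) hx.1.le
    refine ⟨∫ x in Ioo (0 : ℝ) 1, rhoSigma a b x ^ 2 * x, hnn, fun u => ?_⟩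
    change sqL2 a b u.1 ≤ _
    rw [h.sqL2_eq, intervalIntegral_eq]
    exact (hardy_of_integrable h.rhoSigma_cont h.integrableOn_rhoSigma u.2).2

end Coef

/-! ### Integration by parts in space and bounded maps on the weighted spaces -/

/-- Integrates `(φ w²)'`. Integrability of `φ w²/x` removes the boundary term at `0`, so the same
lemma serves the kinetic, elastic and potential identities with `φ = x/σ`, `x η` and `x/(σ d)`. -/
theorem integral_weight_mul_deriv {φ φ' w w' : ℝ → ℝ} (hφ : HasC1 φ φ')
    (h0 : ∀ x ∈ Ioo (0 : ℝ) 1, 0 ≤ φ x)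
    (hac : ∀ r ∈ Ioo (0 : ℝ) 1, AbsolutelyContinuousOnInterval w r 1)
    (hd : ∀ᵐ x ∂(volume.restrict (Ioo (0 : ℝ) 1)), HasDerivAt w (w' x) x)
    (h1 : IntegrableOn (fun x => φ' x * w x ^ 2) (Ioo 0 1))
    (h2 : IntegrableOn (fun x => 2 * (φ x * (w x * w' x))) (Ioo 0 1))
    (h3 : IntegrableOn (fun x => φ x * w x ^ 2 / x) (Ioo 0 1)) :
    ∫ x in Ioo (0 : ℝ) 1, 2 * (φ x * (w x * w' x)) =
      φ 1 * w 1 ^ 2 - ∫ x in Ioo (0 : ℝ) 1, φ' x * w x ^ 2 := by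
  have e := integral_eq_of_absCont (F := fun x => φ x * (w x * w x))
    (F' := fun x => φ' x * w x ^ 2 + 2 * (φ x * (w x * w' x))) 1
    (fun r hr => (hφ.absCont hr).fun_mul ((hac r hr).fun_mul (hac r hr))) ?_ (h1.add h2) ?_
  · rw [integral_add h1 h2] at e
    rw [sq]; linarith
  · filter_upwards [hd, ae_restrict_mem measurableSet_Ioo] with x hx hx01
    exact ((hφ.hasDerivAt hx01).mul (hx.mul hx)).congr_deriv (by simp only [Pi.mul_apply]; ring)
  · refine h3.congr (ae_restrict_Ioo_of_forall fun x hx => ?_)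
    simp only
    rw [pow_one, abs_of_nonneg (mul_nonneg (h0 x hx) (mul_self_nonneg _)), sq]

theorem sqH1_eq {a b d : ℝ → ℝ} {q : ℝ} (h : Coef a b d q) (u : ℝ → ℝ) :
    sqH1 a b u = (∫ x in Ioo (0 : ℝ) 1, (rhoSigma a b x * u x) ^ 2) +
      ∫ x in Ioo (0 : ℝ) 1, (rhoEta a b x * dx u x) ^ 2 := by
  rw [sqH1, h.sqL2_eq, Coef.integral_rhoEta]

theorem integral_sq_nonneg (f : ℝ → ℝ) : 0 ≤ ∫ x in Ioo (0 : ℝ) 1, f x ^ 2 :=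
  integral_nonneg fun _ => sq_nonneg _

theorem bddMap_val {P : (ℝ → ℝ) → Prop} {N : (ℝ → ℝ) → ℝ} {ρ : ℝ → ℝ}
    (hm : ∀ u, P u → MemLp (fun x => ρ x * u x) 2 (volume.restrict (Ioo 0 1)))
    (hb : ∃ C : ℝ, ∀ u, P u → ∫ x in Ioo (0 : ℝ) 1, (ρ x * u x) ^ 2 ≤ C * N u) :
    BddMap P N (fun u => emb (fun x => ρ x * u x)) := by
  refine ⟨fun u v hu hv => ?_, fun c u hu => ?_, ?_⟩
  · rw [← emb_sub (hm u hu) (hm v hv)]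
    simp only [mul_sub]
  · rw [← emb_smul c (hm u hu)]
    simp only [mul_left_comm]
  · obtain ⟨C, hC⟩ := hb
    exact ⟨C, fun u hu => by rw [norm_sq_emb (hm u hu)]; exact hC u hu⟩

theorem bddMap_der {a b : ℝ → ℝ} {N : (ℝ → ℝ) → ℝ} {ρ : ℝ → ℝ}
    (hm : ∀ u, MemH1 a b u → MemLp (fun x => ρ x * dx u x) 2 (volume.restrict (Ioo 0 1)))
    (hb : ∃ C : ℝ, ∀ u, MemH1 a b u → ∫ x in Ioo (0 : ℝ) 1, (ρ x * dx u x) ^ 2 ≤ C * N u) :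
    BddMap (MemH1 a b) N (fun u => emb (fun x => ρ x * dx u x)) := by
  refine ⟨fun u v hu hv => ?_, fun c u hu => ?_, ?_⟩
  · rw [← emb_sub (hm u hu) (hm v hv)]
    apply emb_congr
    filter_upwards [Coef.dx_sub_ae hu hv] with x hx
    rw [hx, mul_sub]
  · rw [← emb_smul c (hm u hu)]
    apply emb_congr
    filter_upwards [Coef.dx_smul_ae c hu] with x hx
    rw [hx, mul_left_comm]
  · obtain ⟨C, hC⟩ := hb
    exact ⟨C, fun u hu => by rw [norm_sq_emb (hm u hu)]; exact hC u hu⟩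

namespace Coef
variable {a b d : ℝ → ℝ} {q : ℝ} {u v : ℝ → ℝ}

theorem rhoEta_le_sqH1 (h : Coef a b d q) (u : ℝ → ℝ) :
    ∫ x in Ioo (0 : ℝ) 1, (rhoEta a b x * dx u x) ^ 2 ≤ sqH1 a b u := by
  rw [sqH1_eq h]
  linarith [integral_sq_nonneg fun x => rhoSigma a b x * u x]

theorem bddMap_rhoSigma_L2 (h : Coef a b d q) :
    BddMap (MemL2 a b) (sqL2 a b) (fun u => emb (fun x => rhoSigma a b x * u x)) :=
  bddMap_val (fun _ hu => h.memLp_rhoSigma hu) ⟨1, fun u _ => by rw [h.sqL2_eq, one_mul]⟩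

theorem bddMap_rhoSigma (h : Coef a b d q) :
    BddMap (MemH1 a b) (sqH1 a b) (fun u => emb (fun x => rhoSigma a b x * u x)) :=
  bddMap_val (fun _ hu => h.memLp_rhoSigma hu.memL2) ⟨1, fun u _ => by
    rw [sqH1_eq h, one_mul]
    linarith [integral_sq_nonneg fun x => rhoEta a b x * dx u x]⟩

theorem bddMap_rhoEta (h : Coef a b d q) :
    BddMap (MemH1 a b) (sqH1 a b) (fun u => emb (fun x => rhoEta a b x * dx u x)) :=
  bddMap_der (fun _ hu => h.memLp_rhoEta hu) ⟨1, fun u _ => by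
    rw [one_mul]; exact h.rhoEta_le_sqH1 u⟩

theorem bddMap_rhoHardy (h : Coef a b d q) :
    BddMap (MemH1 a b) (sqH1 a b) (fun u => emb (fun x => rhoHardy a b d x * u x)) :=
  bddMap_val (fun _ hu => h.memLp_rhoHardy hu) ⟨CHP a b d, fun u hu =>
    (h.le_CHP hu).trans (mul_le_mul_of_nonneg_left (h.rhoEta_le_sqH1 u) CHP_nonneg)⟩

theorem bddMap_rhoMult (h : Coef a b d q) :
    BddMap (MemH1 a b) (sqH1 a b) (fun u => emb (fun x => rhoMult a b x * dx u x)) :=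
  bddMap_der (fun _ hu => (h.memLp_rhoMult hu).1) ⟨1 / a 1, fun u hu =>
    (h.memLp_rhoMult hu).2.trans (mul_le_mul_of_nonneg_left (h.rhoEta_le_sqH1 u)
      (by have := h.a_pos one_mem; positivity))⟩

theorem sq_eval_le_sqH1 (h : Coef a b d q) (hu : MemH1 a b u) {x : ℝ} (hx : x ∈ Icc (0 : ℝ) 1) :
    u x ^ 2 ≤ 1 / etaMin a b * sqH1 a b u :=
  (h.sq_eval_le hu hx).trans (mul_le_mul_of_nonneg_left (h.rhoEta_le_sqH1 u)
      (by have := h.etaMin_pos; positivity))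

/-- Makes `t ↦ y(t,1)` differentiable with derivative `y_t(t,1)`, so that the trace can enter the
energy and the boundary terms. -/
theorem bddMap_eval (h : Coef a b d q) {x : ℝ} (hx : x ∈ Icc (0 : ℝ) 1) :
    BddMap (MemH1 a b) (sqH1 a b) (fun u => u x) :=
  ⟨fun _ _ _ _ => rfl, fun _ _ _ => rfl, ⟨1 / etaMin a b, fun u hu => by
    rw [Real.norm_eq_abs, sq_abs]; exact h.sq_eval_le_sqH1 hu hx⟩⟩

theorem integrable_bdd_mul_sq {κ f : ℝ → ℝ} {C : ℝ} (hκ : ContinuousOn κ (Ioc 0 1))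
    (hC : ∀ x ∈ Ioc (0 : ℝ) 1, |κ x| ≤ C) (hf : MemLp f 2 (volume.restrict (Ioo 0 1))) :
    IntegrableOn (fun x => κ x * f x ^ 2) (Ioo 0 1) :=
  Integrable.bdd_mul (c := C) hf.integrable_sq (aestronglyMeasurable_of_continuousOn hκ)
    (ae_restrict_Ioo_of_forall fun x hx => hC x (Ioo_subset_Ioc_self hx))

/-- The coefficient `1 - γ - x (a' - b) / a`. -/
noncomputable def kinCoef (a b : ℝ → ℝ) (γ x : ℝ) : ℝ := 1 - γ - x * dx a x / a x + x * b x / a x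

/-- The coefficient `1 + γ - x b / a`. -/
noncomputable def elCoef (a b : ℝ → ℝ) (γ x : ℝ) : ℝ := 1 + γ - x * b x / a x

/-- The coefficient `1 - γ - x (a' - b) / a - x d' / d`. -/
noncomputable def potCoef (a b d : ℝ → ℝ) (γ x : ℝ) : ℝ :=
  kinCoef a b γ x - x * dx d x / d x

theorem integrable_kinCoef (h : Coef a b d q) (γ : ℝ) {f : ℝ → ℝ}
    (hf : MemLp f 2 (volume.restrict (Ioo 0 1))) :
    IntegrableOn (fun x => kinCoef a b γ x * f x ^ 2) (Ioo 0 1) := by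
  refine integrable_bdd_mul_sq (C := 2 + |γ| + degIndex a)
    ((continuousOn_const.sub h.deg_a.ratio_cont).add h.drift_cont) (fun x hx => ?_) hf
  have h1 := abs_le.1 (h.strong x hx)
  have h2 := abs_le.1 (h.deg_a.bound x hx)
  have h3 := abs_le.1 (le_refl |γ|)
  have := h.q_pos
  have := h.deg_d.index_pos
  have := h.deg_a.index_pos
  rw [kinCoef, abs_le]
  constructor <;> linarith

theorem integrable_elCoef (h : Coef a b d q) (γ : ℝ) {f : ℝ → ℝ}
    (hf : MemLp f 2 (volume.restrict (Ioo 0 1))) :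
    IntegrableOn (fun x => elCoef a b γ x * f x ^ 2) (Ioo 0 1) := by
  refine integrable_bdd_mul_sq (C := 2 + |γ|)
    (continuousOn_const.sub h.drift_cont) (fun x hx => ?_) hf
  have h1 := abs_le.1 (h.strong x hx)
  have h3 := abs_le.1 (le_refl |γ|)
  have := h.q_pos
  have := h.deg_d.index_pos
  have := h.deg_a.index_pos
  rw [elCoef, abs_le]
  constructor <;> linarith

theorem integrable_potCoef (h : Coef a b d q) (γ : ℝ) {f : ℝ → ℝ}
    (hf : MemLp f 2 (volume.restrict (Ioo 0 1))) :
    IntegrableOn (fun x => potCoef a b d γ x * f x ^ 2) (Ioo 0 1) := by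
  have h2 := integrable_bdd_mul_sq h.deg_d.ratio_cont h.deg_d.bound hf
  refine ((h.integrable_kinCoef γ hf).sub h2).congr (Eventually.of_forall fun x => ?_)
  simp only [potCoef, Pi.sub_apply]; ring

/-- Integration by parts for `2 x v v' / σ`. -/
theorem integral_kinetic (h : Coef a b d q) (hv : MemH1 a b v) :
    2 * ∫ x in Ioo (0 : ℝ) 1, rhoSigma a b x * v x * (rhoMult a b x * dx v x) =
      1 / sigma a b 1 * v 1 ^ 2 -
        ∫ x in Ioo (0 : ℝ) 1, kinCoef a b 0 x * (rhoSigma a b x * v x) ^ 2 := by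
  have h1 := h.memLp_rhoSigma hv.memL2
  have e1 : ∀ x ∈ Ioo (0 : ℝ) 1, 2 * (rhoSigma a b x * v x * (rhoMult a b x * dx v x)) =
      2 * (x / sigma a b x * (v x * dx v x)) := fun x hx => by
    have := h.rhoSigma_sq hx
    rw [rhoMult, ← rhoSigma, div_eq_mul_one_div, ← this]; ring
  have e2 : ∀ x ∈ Ioo (0 : ℝ) 1, kinCoef a b 0 x * (rhoSigma a b x * v x) ^ 2 =
      (1 - x * dx a x / a x + x * b x / a x) / sigma a b x * v x ^ 2 := fun x hx => by
    rw [mul_pow, h.rhoSigma_sq hx, kinCoef]; ring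
  have i1 : IntegrableOn (fun x => 2 * (rhoSigma a b x * v x * (rhoMult a b x * dx v x)))
      (Ioo 0 1) := (h1.integrable_mul (h.memLp_rhoMult hv).1).const_mul 2
  rw [← integral_const_mul, setIntegral_congr_fun measurableSet_Ioo e1,
    setIntegral_congr_fun measurableSet_Ioo e2]
  refine integral_weight_mul_deriv h.c1_div_sigma (fun x hx => ?_)
    (fun r hr => hv.absCont_Icc hr) hv.ae_hasDerivAt
    ((h.integrable_kinCoef 0 h1).congr (ae_restrict_Ioo_of_forall e2))
    (i1.congr (ae_restrict_Ioo_of_forall e1))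
    (h1.integrable_sq.congr (ae_restrict_Ioo_of_forall fun x hx => ?_))
  · have := h.sigma_pos (Ioo_subset_Ioc_self hx); have := hx.1; positivity
  · have := hx.1.ne'
    simp only
    rw [mul_pow, h.rhoSigma_sq hx]; field_simp

/-- Integration by parts for `2 x u u' / (σ d)`. -/
theorem integral_potential (h : Coef a b d q) (hu : MemH1 a b u) :
    IntegrableOn (fun x => x / (sigma a b x * d x) * (u x * dx u x)) (Ioo 0 1) ∧
    2 * ∫ x in Ioo (0 : ℝ) 1, x / (sigma a b x * d x) * (u x * dx u x) =
      1 / (sigma a b 1 * d 1) * u 1 ^ 2 -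
        ∫ x in Ioo (0 : ℝ) 1, potCoef a b d 0 x * (rhoHardy a b d x * u x) ^ 2 := by
  have h1 := h.memLp_rhoHardy hu
  -- The quotient `x²/(a d)` is largest at `1`, so `x² /(σ d) ≤ η/(a(1) d(1))` and the product with
  -- `(σ d)^{-1/2} u` is integrable.
  have h2 : MemLp (fun x => x * rhoHardy a b d x * dx u x) 2 (volume.restrict (Ioo 0 1)) := by
    refine (memLp_mul_of_sq_le (C := 1 / (a 1 * d 1)) (continuousOn_id.mul h.rhoHardy_cont)
      (h.memLp_rhoEta hu) hu.deriv_memLp.1 fun x hx => ?_).1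
    have h3 := h.sq_div_a_d_le (Ioo_subset_Ioc_self hx)
    have := (eta_pos (a := a) (b := b) x)
    simp only [id, Pi.mul_apply]
    rw [rhoEta_sq, mul_pow, h.rhoHardy_sq hx]
    calc x ^ 2 * (1 / (sigma a b x * d x)) = x ^ 2 / (a x * d x) * eta a b x := by
          rw [sigma]; field_simp
      _ ≤ _ := by gcongr
  have i1 : IntegrableOn (fun x => x / (sigma a b x * d x) * (u x * dx u x)) (Ioo 0 1) := by
    refine (h1.integrable_mul h2).congr (ae_restrict_Ioo_of_forall fun x hx => ?_)
    have := h.rhoHardy_sq hx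
    simp only [Pi.mul_apply]
    rw [div_eq_mul_one_div, ← this]; ring
  refine ⟨i1, ?_⟩
  have e2 : ∀ x ∈ Ioo (0 : ℝ) 1, potCoef a b d 0 x * (rhoHardy a b d x * u x) ^ 2 =
      (1 - x * dx a x / a x + x * b x / a x - x * dx d x / d x) / (sigma a b x * d x)
        * u x ^ 2 := fun x hx => by
    rw [mul_pow, h.rhoHardy_sq hx, potCoef, kinCoef]; ring
  rw [← integral_const_mul, setIntegral_congr_fun measurableSet_Ioo e2]
  refine integral_weight_mul_deriv h.c1_div_sigma_d (fun x hx => ?_)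
    (fun r hr => hu.absCont_Icc hr) hu.ae_hasDerivAt
    ((h.integrable_potCoef 0 h1).congr (ae_restrict_Ioo_of_forall e2)) (i1.const_mul 2)
    (h1.integrable_sq.congr (ae_restrict_Ioo_of_forall fun x hx => ?_))
  · have := h.sigma_pos (Ioo_subset_Ioc_self hx); have := h.d_pos (Ioo_subset_Ioc_self hx)
    have := hx.1; positivity
  · have := hx.1.ne'
    simp only
    rw [mul_pow, h.rhoHardy_sq hx]; field_simp

theorem ae_hasDerivAt_dx (hu : MemDA a b u) :
    ∀ᵐ x ∂(volume.restrict (Ioo (0 : ℝ) 1)), HasDerivAt (dx u) (dx (dx u) x) x :=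
  ae_hasDerivAt_of_absCont hu.deriv_absCont

/-- Integration by parts for `2 x u' A u / σ`. -/
theorem integral_elastic (h : Coef a b d q) (hu : MemDA a b u) :
    2 * ∫ x in Ioo (0 : ℝ) 1, rhoSigma a b x * opA a b u x * (rhoMult a b x * dx u x) =
      eta a b 1 * dx u 1 ^ 2 -
        ∫ x in Ioo (0 : ℝ) 1, elCoef a b 0 x * (rhoEta a b x * dx u x) ^ 2 := by
  have h1 := h.memLp_rhoEta hu.memH1
  have i1 : IntegrableOn (fun x => 2 * (rhoSigma a b x * opA a b u x * (rhoMult a b x * dx u x)))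
      (Ioo 0 1) :=
    ((h.memLp_rhoSigma hu.opA_memL2).integrable_mul (h.memLp_rhoMult hu.memH1).1).const_mul 2
  have i2 := integrable_bdd_mul_sq h.drift_cont h.strong h1
  have i3 := h1.integrable_sq
  have i4 := h.integrable_elCoef 0 h1
  -- Since `1/σ = η/a`, the expression `2 x u' A u/σ` splits into `2 x η u' u''` and a drift term.
  -- The first part is integrated by parts; the drift from `A` and the one from `(x η)'` combine
  -- into `-x b/a`.
  have e1 : ∀ x ∈ Ioo (0 : ℝ) 1, 2 * (rhoSigma a b x * opA a b u x * (rhoMult a b x * dx u x)) -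
      2 * (x * b x / a x * (rhoEta a b x * dx u x) ^ 2) =
      2 * (x * eta a b x * (dx u x * dx (dx u) x)) := fun x hx => by
    have := h.rhoSigma_sq hx
    have ha := (h.a_pos (Ioo_subset_Ioc_self hx)).ne'
    have hη := (eta_pos (a := a) (b := b) x).ne'
    have e : rhoSigma a b x * opA a b u x * (rhoMult a b x * dx u x) =
        rhoSigma a b x ^ 2 * (x * dx u x * opA a b u x) := by
      rw [rhoMult, ← rhoSigma]; ring
    rw [e, this, mul_pow, rhoEta_sq, sigma, opA]; field_simp; ring
  have e2 : ∀ x ∈ Ioo (0 : ℝ) 1, (rhoEta a b x * dx u x) ^ 2 +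
      x * b x / a x * (rhoEta a b x * dx u x) ^ 2 =
      (1 + x * b x / a x) * eta a b x * dx u x ^ 2 := fun x hx => by
    rw [mul_pow, rhoEta_sq]; ring
  have key := integral_weight_mul_deriv h.c1_mul_eta (fun x hx => mul_nonneg hx.1.le (eta_pos x).le)
    hu.deriv_absCont (ae_hasDerivAt_dx hu)
    ((i3.add i2).congr (ae_restrict_Ioo_of_forall e2))
    ((i1.sub (i2.const_mul 2)).congr (ae_restrict_Ioo_of_forall e1))
    (i3.congr (ae_restrict_Ioo_of_forall fun x hx => by
      have := hx.1.ne'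
      simp only [mul_pow, rhoEta_sq]; field_simp))
  rw [← setIntegral_congr_fun measurableSet_Ioo e1, ← setIntegral_congr_fun measurableSet_Ioo e2,
    integral_sub i1 (i2.const_mul 2), integral_add i3 i2, integral_const_mul,
    integral_const_mul] at key
  have e4 : ∫ x in Ioo (0 : ℝ) 1, elCoef a b 0 x * (rhoEta a b x * dx u x) ^ 2 =
      (∫ x in Ioo (0 : ℝ) 1, (rhoEta a b x * dx u x) ^ 2) -
        ∫ x in Ioo (0 : ℝ) 1, x * b x / a x * (rhoEta a b x * dx u x) ^ 2 := by
    rw [← integral_sub i3 i2]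
    refine integral_congr_ae (Eventually.of_forall fun x => ?_)
    simp only [elCoef]; ring
  rw [e4]
  linarith

/-- Integration by parts for `v A u / σ`. -/
theorem integral_green (h : Coef a b d q) (hu : MemDA a b u) (hv : MemH1 a b v) :
    ∫ x in Ioo (0 : ℝ) 1, rhoSigma a b x * opA a b u x * (rhoSigma a b x * v x) =
      eta a b 1 * dx u 1 * v 1 -
        ∫ x in Ioo (0 : ℝ) 1, rhoEta a b x * dx u x * (rhoEta a b x * dx v x) := by
  have i1 : IntegrableOn (fun x => rhoSigma a b x * opA a b u x * (rhoSigma a b x * v x)) (Ioo 0 1) :=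
    (h.memLp_rhoSigma hu.opA_memL2).integrable_mul (h.memLp_rhoSigma hv.memL2)
  have i2 : IntegrableOn (fun x => rhoEta a b x * dx u x * (rhoEta a b x * dx v x)) (Ioo 0 1) :=
    (h.memLp_rhoEta hu.memH1).integrable_mul (h.memLp_rhoEta hv)
  obtain ⟨c, C, hc, hC⟩ := h.exists_eta_bounds
  have h1 := (h.memLp_rhoEta hu.memH1).integrable_sq
  set I := ∫ z in Ioo (0 : ℝ) 1, dx v z ^ 2 with hI
  have hI0 : 0 ≤ I := integral_sq_nonneg _
  have key := integral_eq_of_absCont (F := fun x => eta a b x * (dx u x * v x))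
    (F' := fun x => rhoSigma a b x * opA a b u x * (rhoSigma a b x * v x) +
      rhoEta a b x * dx u x * (rhoEta a b x * dx v x)) 2
    (fun r hr => (h.eta_c1.absCont hr).fun_mul ((hu.deriv_absCont r hr).fun_mul (hv.absCont_Icc hr)))
    ?_ (i1.add i2) ?_
  · rw [integral_add i1 i2] at key
    linarith
  · filter_upwards [ae_hasDerivAt_dx hu, hv.ae_hasDerivAt, ae_restrict_mem measurableSet_Ioo]
      with x h1 h2 hx
    refine ((h.eta_c1.hasDerivAt hx).mul (h1.mul h2)).congr_deriv ?_
    have ha := (h.a_pos (Ioo_subset_Ioc_self hx)).ne'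
    have hη := (eta_pos (a := a) (b := b) x).ne'
    have e : rhoSigma a b x * opA a b u x * (rhoSigma a b x * v x) +
      rhoEta a b x * dx u x * (rhoEta a b x * dx v x) =
        rhoSigma a b x ^ 2 * (opA a b u x * v x) + rhoEta a b x ^ 2 * (dx u x * dx v x) := by ring
    rw [e, h.rhoSigma_sq hx, rhoEta_sq, sigma, opA, Pi.mul_apply]; field_simp; ring
  -- The exponent `2` is essential: `u'` has no pointwise bound near `0`, but `(η u' v)²/x` is
  -- bounded by a multiple of the integrable function `η (u')²` because `v² ≤ x ∫ (v')²`.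
  · refine Integrable.mono' (h1.const_mul (C * I)) ?_ (ae_restrict_Ioo_of_forall fun x hx => ?_)
    · have m1 := hu.memH1.deriv_memLp.1
      have m2 := aestronglyMeasurable_of_continuousOn (hv.continuousOn.mono Ioc_subset_Icc_self)
      have m3 := aestronglyMeasurable_of_continuousOn h.eta_c1.continuousOn
      have m4 : AEMeasurable (fun x => eta a b x * (dx u x * v x)) (volume.restrict (Ioo 0 1)) :=
        (m3.mul (m1.mul m2)).aemeasurable
      simp only [sq_abs]
      exact ((m4.pow_const 2).div measurable_id.aemeasurable).aestronglyMeasurable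
    · have hx0 := hx.1
      rw [sq_abs, Real.norm_of_nonneg (by positivity), div_le_iff₀ hx0]
      have hv2 := hv.sq_le (Ioo_subset_Icc_self hx)
      have hη := hC x (Ioo_subset_Icc_self hx)
      have hη0 := eta_pos (a := a) (b := b) x
      rw [mul_pow (rhoEta a b x), rhoEta_sq]
      calc (eta a b x * (dx u x * v x)) ^ 2
          = eta a b x * (eta a b x * dx u x ^ 2) * v x ^ 2 := by ring
        _ ≤ C * (eta a b x * dx u x ^ 2) * (x * I) := by
            have hC0 : 0 ≤ C := hη0.le.trans hη.2
            gcongr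
            exact hη.2
        _ = _ := by ring

end Coef

/-! ### Energy dissipation and the multiplier identity -/

/-- The integral of `y_t² / σ`. -/
noncomputable def kin (a b : ℝ → ℝ) (y : ℝ → ℝ → ℝ) (t : ℝ) : ℝ :=
  ∫ x in Ioo (0 : ℝ) 1, (rhoSigma a b x * dt y t x) ^ 2

/-- The integral of `η y_x²`. -/
noncomputable def el (a b : ℝ → ℝ) (y : ℝ → ℝ → ℝ) (t : ℝ) : ℝ :=
  ∫ x in Ioo (0 : ℝ) 1, (rhoEta a b x * dx (y t) x) ^ 2

/-- The integral of `y² / (σ d)`. -/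
noncomputable def pot (a b d : ℝ → ℝ) (y : ℝ → ℝ → ℝ) (t : ℝ) : ℝ :=
  ∫ x in Ioo (0 : ℝ) 1, (rhoHardy a b d x * y t x) ^ 2

/-- The integral of `y_t (2 x y_x + γ y) / σ`. -/
noncomputable def cross (a b : ℝ → ℝ) (γ : ℝ) (y : ℝ → ℝ → ℝ) (t : ℝ) : ℝ :=
  2 * (∫ x in Ioo (0 : ℝ) 1, rhoSigma a b x * dt y t x * (rhoMult a b x * dx (y t) x)) +
    γ * ∫ x in Ioo (0 : ℝ) 1, rhoSigma a b x * dt y t x * (rhoSigma a b x * y t x)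

/-- The quadratic form produced by the multiplier `2 x y_x + γ y`. -/
noncomputable def multForm (a b d : ℝ → ℝ) (lam γ : ℝ) (y : ℝ → ℝ → ℝ) (t : ℝ) : ℝ :=
  (∫ x in Ioo (0 : ℝ) 1, Coef.kinCoef a b γ x * (rhoSigma a b x * dt y t x) ^ 2) +
    (∫ x in Ioo (0 : ℝ) 1, Coef.elCoef a b γ x * (rhoEta a b x * dx (y t) x) ^ 2) +
    lam * ∫ x in Ioo (0 : ℝ) 1, Coef.potCoef a b d γ x * (rhoHardy a b d x * y t x) ^ 2

/-- The boundary terms produced by the multiplier `2 x y_x + γ y`. -/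
noncomputable def bdryForm (a b d : ℝ → ℝ) (lam γ : ℝ) (y : ℝ → ℝ → ℝ) (t : ℝ) : ℝ :=
  1 / sigma a b 1 * dt y t 1 ^ 2 + eta a b 1 * dx (y t) 1 ^ 2 +
    lam * (1 / (sigma a b 1 * d 1) * y t 1 ^ 2) + γ * (eta a b 1 * dx (y t) 1 * y t 1)

namespace IsClassicalSolution
variable {a b d : ℝ → ℝ} {q lam β : ℝ} {y : ℝ → ℝ → ℝ} {t : ℝ}

theorem memH1 (hy : IsClassicalSolution a b d lam β y) (t : ℝ) (ht : 0 ≤ t) : MemH1 a b (y t) :=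
  (hy.mem_dom t ht).memDA.memH1

theorem density_eq (h : Coef a b d q) (y : ℝ → ℝ → ℝ) (t : ℝ) {x : ℝ} (hx : x ∈ Ioo (0 : ℝ) 1) :
    density a b d lam y t x = (rhoSigma a b x * dt y t x) ^ 2 + (rhoEta a b x * dx (y t) x) ^ 2 -
      lam * (rhoHardy a b d x * y t x) ^ 2 := by
  simp only [density, mul_pow, h.rhoSigma_sq hx, h.rhoHardy_sq hx, Coef.rhoEta_sq]
  ring

theorem integrable_density (h : Coef a b d q) (hy : IsClassicalSolution a b d lam β y)
    (ht : 0 ≤ t) : IntegrableOn (density a b d lam y t) (Ioo 0 1) ∧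
      ∫ x in Ioo (0 : ℝ) 1, density a b d lam y t x =
        kin a b y t + el a b y t - lam * pot a b d y t := by
  have i1 := (h.memLp_rhoSigma (hy.dt_mem t ht).memL2).integrable_sq
  have i2 := (h.memLp_rhoEta (hy.memH1 t ht)).integrable_sq
  have i3 := (h.memLp_rhoHardy (hy.memH1 t ht)).integrable_sq
  have i12 : IntegrableOn (fun x => (rhoSigma a b x * dt y t x) ^ 2 +
    (rhoEta a b x * dx (y t) x) ^ 2) (Ioo 0 1) := i1.add i2
  have i4 := i12.sub (i3.const_mul lam)
  have e : ∀ x ∈ Ioo (0 : ℝ) 1, density a b d lam y t x = _ := fun x hx =>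
    density_eq (lam := lam) h y t hx
  refine ⟨i4.congr (ae_restrict_Ioo_of_forall fun x hx => (e x hx).symm), ?_⟩
  rw [setIntegral_congr_fun measurableSet_Ioo e, integral_sub i12 (i3.const_mul lam),
    integral_add i1 i2, integral_const_mul]
  rfl

theorem energy_eq (h : Coef a b d q) (hy : IsClassicalSolution a b d lam β y) (ht : 0 ≤ t) :
    energy a b d lam β y t =
      1 / 2 * (kin a b y t + el a b y t - lam * pot a b d y t + β * y t 1 ^ 2) := by
  rw [energy, intervalIntegral_eq, (hy.integrable_density h ht).2]

/-- Substitutes the equation for the second time derivative inside an inner product. The product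
with `λ y/d` is handled through a separate integrable `g`, because `y/d` alone need not lie in the
weighted `L²` space. -/
theorem inner_second_deriv (h : Coef a b d q) (hy : IsClassicalSolution a b d lam β y) (ht : 0 ≤ t)
    {w f g : ℝ → ℝ} (hw : MemL2 a b w)
    (heq : ∀ᵐ x ∂(volume.restrict (Ioo (0 : ℝ) 1)),
      w x - a x * dx (dx (y t)) x - b x * dx (y t) x - lam / d x * y t x = 0)
    (hf : MemLp f 2 (volume.restrict (Ioo 0 1))) (hg : IntegrableOn g (Ioo 0 1))
    (e : ∀ x ∈ Ioo (0 : ℝ) 1, rhoSigma a b x * (y t x / d x) * f x = g x) :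
    ⟪emb (fun x => rhoSigma a b x * w x), emb f⟫ =
      (∫ x in Ioo (0 : ℝ) 1, rhoSigma a b x * opA a b (y t) x * f x) +
        lam * ∫ x in Ioo (0 : ℝ) 1, g x := by
  have i1 : IntegrableOn (fun x => rhoSigma a b x * opA a b (y t) x * f x) (Ioo 0 1) :=
    (h.memLp_rhoSigma (hy.mem_dom t ht).memDA.opA_memL2).integrable_mul hf
  rw [inner_emb (h.memLp_rhoSigma hw) hf, ← integral_const_mul,
    ← integral_add i1 (hg.const_mul lam)]
  apply integral_congr_ae
  filter_upwards [heq, ae_restrict_mem measurableSet_Ioo] with x hx h01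
  rw [← e x h01, opA]
  linear_combination rhoSigma a b x * f x * hx

theorem hasDeriv_emb (h : Coef a b d q) (hy : IsClassicalSolution a b d lam β y) (ht : 0 < t)
    {Z : Type*} [NormedAddCommGroup Z] [NormedSpace ℝ Z] {S : (ℝ → ℝ) → Z}
    (hS : BddMap (MemH1 a b) (sqH1 a b) S) :
    HasDerivAt (fun t => S (y t)) (S (dt y t)) t :=
  (hS.hasDerivWithinAt h.isLinClass_memH1 hy.memH1 hy.dt_mem hy.dt_deriv ht.le).hasDerivAt
    (Ici_mem_nhds ht)

theorem continuousOn_of_bddMap (h : Coef a b d q) (hy : IsClassicalSolution a b d lam β y)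
    {Z : Type*} [NormedAddCommGroup Z] [NormedSpace ℝ Z] {S : (ℝ → ℝ) → Z}
    (hS : BddMap (MemH1 a b) (sqH1 a b) S) : ContinuousOn (fun t => S (y t)) (Ici 0) := fun _ ht =>
  (hS.hasDerivWithinAt h.isLinClass_memH1 hy.memH1 hy.dt_mem hy.dt_deriv ht).continuousWithinAt

theorem continuousOn_dt_of_bddMap (h : Coef a b d q) (hy : IsClassicalSolution a b d lam β y)
    {Z : Type*} [NormedAddCommGroup Z] [NormedSpace ℝ Z] {S : (ℝ → ℝ) → Z}
    (hS : BddMap (MemH1 a b) (sqH1 a b) S) : ContinuousOn (fun t => S (dt y t)) (Ici 0) :=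
  hS.continuousOn h.isLinClass_memH1 hy.dt_mem hy.dt_cont

theorem one_mem_Icc : (1 : ℝ) ∈ Icc (0 : ℝ) 1 := ⟨zero_le_one, le_rfl⟩

theorem continuousOn_trace (h : Coef a b d q) (hy : IsClassicalSolution a b d lam β y) :
    ContinuousOn (fun t => y t 1) (Ici 0) :=
  hy.continuousOn_of_bddMap h (h.bddMap_eval one_mem_Icc)

theorem continuousOn_dt_trace (h : Coef a b d q) (hy : IsClassicalSolution a b d lam β y) :
    ContinuousOn (fun t => dt y t 1) (Ici 0) :=
  hy.continuousOn_dt_of_bddMap h (h.bddMap_eval one_mem_Icc)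

theorem hasDerivAt_trace (h : Coef a b d q) (hy : IsClassicalSolution a b d lam β y) (ht : 0 < t) :
    HasDerivAt (fun t => y t 1) (dt y t 1) t :=
  hy.hasDeriv_emb h ht (h.bddMap_eval one_mem_Icc)

theorem kin_eq (h : Coef a b d q) (hy : IsClassicalSolution a b d lam β y) (ht : 0 ≤ t) :
    kin a b y t = ‖emb (fun x => rhoSigma a b x * dt y t x)‖ ^ 2 :=
  (norm_sq_emb (h.memLp_rhoSigma (hy.dt_mem t ht).memL2)).symm

theorem el_eq (h : Coef a b d q) (hy : IsClassicalSolution a b d lam β y) (ht : 0 ≤ t) :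
    el a b y t = ‖emb (fun x => rhoEta a b x * dx (y t) x)‖ ^ 2 :=
  (norm_sq_emb (h.memLp_rhoEta (hy.memH1 t ht))).symm

theorem pot_eq (h : Coef a b d q) (hy : IsClassicalSolution a b d lam β y) (ht : 0 ≤ t) :
    pot a b d y t = ‖emb (fun x => rhoHardy a b d x * y t x)‖ ^ 2 :=
  (norm_sq_emb (h.memLp_rhoHardy (hy.memH1 t ht))).symm

theorem kin_continuousOn (h : Coef a b d q) (hy : IsClassicalSolution a b d lam β y) :
    ContinuousOn (kin a b y) (Ici 0) :=
  ((hy.continuousOn_dt_of_bddMap h h.bddMap_rhoSigma).norm.pow 2).congr fun _ ht => hy.kin_eq h ht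

theorem el_continuousOn (h : Coef a b d q) (hy : IsClassicalSolution a b d lam β y) :
    ContinuousOn (el a b y) (Ici 0) :=
  ((hy.continuousOn_of_bddMap h h.bddMap_rhoEta).norm.pow 2).congr fun _ ht => hy.el_eq h ht

theorem pot_continuousOn (h : Coef a b d q) (hy : IsClassicalSolution a b d lam β y) :
    ContinuousOn (pot a b d y) (Ici 0) :=
  ((hy.continuousOn_of_bddMap h h.bddMap_rhoHardy).norm.pow 2).congr fun _ ht => hy.pot_eq h ht

theorem energy_continuousOn (h : Coef a b d q) (hy : IsClassicalSolution a b d lam β y) :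
    ContinuousOn (energy a b d lam β y) (Ici 0) := by
  refine ContinuousOn.congr ?_ fun t ht => hy.energy_eq h ht
  exact continuousOn_const.mul ((((hy.kin_continuousOn h).add (hy.el_continuousOn h)).sub
    (continuousOn_const.mul (hy.pot_continuousOn h))).add
    (continuousOn_const.mul ((hy.continuousOn_trace h).pow 2)))

/-- Dissipation of the energy. -/
theorem hasDerivAt_energy (h : Coef a b d q) (hy : IsClassicalSolution a b d lam β y)
    (ht : 0 < t) : HasDerivAt (energy a b d lam β y) (-(dt y t 1) ^ 2) t := by
  obtain ⟨w, hw, hwd, -, heq⟩ := hy.second_deriv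
  have d1 := (h.bddMap_rhoSigma_L2.hasDerivWithinAt h.isLinClass_memL2
    (fun t ht => (hy.dt_mem t ht).memL2) hw hwd ht.le).hasDerivAt (Ici_mem_nhds ht)
  have d2 := hy.hasDeriv_emb h ht h.bddMap_rhoEta
  have d3 := hy.hasDeriv_emb h ht h.bddMap_rhoHardy
  have d4 := hy.hasDerivAt_trace h ht
  have key := ((((d1.norm_sq).add d2.norm_sq).sub (d3.norm_sq.const_mul lam)).add
    ((d4.pow 2).const_mul β)).const_mul (1 / 2 : ℝ)
  have hev : energy a b d lam β y =ᶠ[𝓝 t] _ :=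
    (Ici_mem_nhds ht : Ici (0 : ℝ) ∈ 𝓝 t) |> fun hm => by
      filter_upwards [hm] with τ hτ
      rw [hy.energy_eq h hτ, hy.kin_eq h hτ, hy.el_eq h hτ, hy.pot_eq h hτ]
  refine (key.congr_of_eventuallyEq hev).congr_deriv ?_
  have hv := hy.dt_mem t ht.le
  have hu := hy.memH1 t ht.le
  have e1 := hy.inner_second_deriv h ht.le (hw t ht.le) (heq t ht.le) (h.memLp_rhoSigma hv.memL2)
    ((h.memLp_rhoHardy hu).integrable_mul (h.memLp_rhoHardy hv)) (fun x hx => by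
      simp only [Pi.mul_apply]
      have h1 := h.rhoSigma_sq hx
      have h2 := h.rhoHardy_sq hx
      have hd := (h.d_pos (Ioo_subset_Ioc_self hx)).ne'
      have hs := (h.sigma_pos (Ioo_subset_Ioc_self hx)).ne'
      have e : rhoHardy a b d x * y t x * (rhoHardy a b d x * dt y t x) =
        rhoHardy a b d x ^ 2 * (y t x * dt y t x) := by ring
      have e' : rhoSigma a b x * (y t x / d x) * (rhoSigma a b x * dt y t x) =
        rhoSigma a b x ^ 2 * (y t x / d x * dt y t x) := by ring
      rw [e, e', h1, h2]; field_simp)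
  rw [h.integral_green (hy.mem_dom t ht.le).memDA hv] at e1
  rw [real_inner_comm, e1, inner_emb (h.memLp_rhoEta hu) (h.memLp_rhoEta hv),
    inner_emb (h.memLp_rhoHardy hu) (h.memLp_rhoHardy hv)]
  simp only [Pi.mul_apply]
  -- The interior terms cancel by Green's formula. What is left is `y_t(t,1)` times `η(1) y_x(t,1) +
  -- β y(t,1)`, which the boundary condition turns into `-y_t(t,1)²`.
  have hb := hy.boundary t ht
  simp only [Nat.cast_ofNat, Nat.reduceSub, pow_one]
  linear_combination dt y t 1 * hb

/-- The form is affine in `γ`. The `γ` part is exactly what Green's formula produces from the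
multiplier `γ y`, so the multiplier `2 x y_x` can be treated separately. -/
theorem multForm_eq (h : Coef a b d q) (hy : IsClassicalSolution a b d lam β y) (ht : 0 ≤ t)
    (γ : ℝ) : multForm a b d lam γ y t = multForm a b d lam 0 y t -
      γ * kin a b y t + γ * el a b y t - lam * γ * pot a b d y t := by
  have m1 := h.memLp_rhoSigma (hy.dt_mem t ht).memL2
  have m2 := h.memLp_rhoEta (hy.memH1 t ht)
  have m3 := h.memLp_rhoHardy (hy.memH1 t ht)
  have e1 : ∫ x in Ioo (0 : ℝ) 1, Coef.kinCoef a b γ x * (rhoSigma a b x * dt y t x) ^ 2 =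
      (∫ x in Ioo (0 : ℝ) 1, Coef.kinCoef a b 0 x * (rhoSigma a b x * dt y t x) ^ 2) -
        γ * kin a b y t := by
    rw [kin, ← integral_const_mul, ← integral_sub (h.integrable_kinCoef 0 m1)
      (m1.integrable_sq.const_mul γ)]
    congr with x; simp only [Coef.kinCoef]; ring
  have e2 : ∫ x in Ioo (0 : ℝ) 1, Coef.elCoef a b γ x * (rhoEta a b x * dx (y t) x) ^ 2 =
      (∫ x in Ioo (0 : ℝ) 1, Coef.elCoef a b 0 x * (rhoEta a b x * dx (y t) x) ^ 2) +
        γ * el a b y t := by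
    rw [el, ← integral_const_mul, ← integral_add (h.integrable_elCoef 0 m2)
      (m2.integrable_sq.const_mul γ)]
    congr with x; simp only [Coef.elCoef]; ring
  have e3 : ∫ x in Ioo (0 : ℝ) 1, Coef.potCoef a b d γ x * (rhoHardy a b d x * y t x) ^ 2 =
      (∫ x in Ioo (0 : ℝ) 1, Coef.potCoef a b d 0 x * (rhoHardy a b d x * y t x) ^ 2) -
        γ * pot a b d y t := by
    rw [pot, ← integral_const_mul, ← integral_sub (h.integrable_potCoef 0 m3)
      (m3.integrable_sq.const_mul γ)]
    congr with x; simp only [Coef.potCoef, Coef.kinCoef]; ring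
  rw [multForm, e1, e2, e3, multForm]; ring

/-- The multiplier identity. -/
theorem exists_deriv_cross (h : Coef a b d q) (hy : IsClassicalSolution a b d lam β y) (γ : ℝ) :
    ∃ G : ℝ → ℝ, ContinuousOn G (Ici 0) ∧ ∀ t, 0 < t → HasDerivAt (cross a b γ y) (G t) t ∧
      G t = bdryForm a b d lam γ y t - multForm a b d lam γ y t := by
  obtain ⟨w, hw, hwd, hwc, heq⟩ := hy.second_deriv
  let U : ℝ → _ := fun t => emb (fun x => rhoSigma a b x * dt y t x)
  let W : ℝ → _ := fun t => emb (fun x => rhoSigma a b x * w t x)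
  let X : ℝ → _ := fun t => emb (fun x => rhoMult a b x * dx (y t) x)
  let X' : ℝ → _ := fun t => emb (fun x => rhoMult a b x * dx (dt y t) x)
  let Y : ℝ → _ := fun t => emb (fun x => rhoSigma a b x * y t x)
  have cU : ContinuousOn U (Ici 0) := hy.continuousOn_dt_of_bddMap h h.bddMap_rhoSigma
  have cW : ContinuousOn W (Ici 0) := h.bddMap_rhoSigma_L2.continuousOn h.isLinClass_memL2 hw hwc
  have cX : ContinuousOn X (Ici 0) := hy.continuousOn_of_bddMap h h.bddMap_rhoMult
  have cX' : ContinuousOn X' (Ici 0) := hy.continuousOn_dt_of_bddMap h h.bddMap_rhoMult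
  have cY : ContinuousOn Y (Ici 0) := hy.continuousOn_of_bddMap h h.bddMap_rhoSigma
  refine ⟨fun t => 2 * (⟪U t, X' t⟫ + ⟪W t, X t⟫) + γ * (⟪U t, U t⟫ + ⟪W t, Y t⟫), ?_, ?_⟩
  · exact (continuousOn_const.mul ((cU.inner cX').add (cW.inner cX))).add
      (continuousOn_const.mul ((cU.inner cU).add (cW.inner cY)))
  intro t ht
  have hu := hy.memH1 t ht.le
  have hv := hy.dt_mem t ht.le
  constructor
  · have dU : HasDerivAt U (W t) t := (h.bddMap_rhoSigma_L2.hasDerivWithinAt h.isLinClass_memL2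
      (fun t ht => (hy.dt_mem t ht).memL2) hw hwd ht.le).hasDerivAt (Ici_mem_nhds ht)
    have dX : HasDerivAt X (X' t) t := hy.hasDeriv_emb h ht h.bddMap_rhoMult
    have dY : HasDerivAt Y (U t) t := hy.hasDeriv_emb h ht h.bddMap_rhoSigma
    refine (((dU.inner ℝ dX).const_mul 2).add ((dU.inner ℝ dY).const_mul γ)).congr_of_eventuallyEq ?_
    filter_upwards [Ici_mem_nhds ht] with τ hτ
    have hu := hy.memH1 τ hτ
    have hv := h.memLp_rhoSigma (hy.dt_mem τ hτ).memL2
    simp only [Pi.add_apply, U, X, Y]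
    rw [inner_emb hv (h.memLp_rhoMult hu).1, inner_emb hv (h.memLp_rhoSigma hu.memL2), cross]
  · have hDA := (hy.mem_dom t ht.le).memDA
    have m1 := h.memLp_rhoSigma hv.memL2
    have e1 : ⟪U t, X' t⟫ = _ := inner_emb m1 (h.memLp_rhoMult hv).1
    have e2 : ⟪U t, U t⟫ = kin a b y t := by
      rw [real_inner_self_eq_norm_sq, hy.kin_eq h ht.le]
    obtain ⟨ip, hp⟩ := h.integral_potential hu
    have e3 : ⟪W t, X t⟫ = _ := hy.inner_second_deriv h ht.le (hw t ht.le) (heq t ht.le)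
      (h.memLp_rhoMult hu).1 ip (fun x hx => by
        have h1 := h.rhoSigma_sq hx
        have e' : rhoSigma a b x * (y t x / d x) * (rhoMult a b x * dx (y t) x) =
          rhoSigma a b x ^ 2 * (x * y t x / d x * dx (y t) x) := by
          rw [rhoMult, ← rhoSigma]; ring
        rw [e', h1]; field_simp)
    have e4 : ⟪W t, Y t⟫ = _ := hy.inner_second_deriv h ht.le (hw t ht.le) (heq t ht.le)
      (h.memLp_rhoSigma hu.memL2) (h.memLp_rhoHardy hu).integrable_sq (fun x hx => by
        have h1 := h.rhoSigma_sq hx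
        have h2 := h.rhoHardy_sq hx
        have e' : rhoSigma a b x * (y t x / d x) * (rhoSigma a b x * y t x) =
          rhoSigma a b x ^ 2 * (y t x / d x * y t x) := by ring
        rw [e', h1, mul_pow, h2]; field_simp)
    have k1 := h.integral_kinetic hv
    have k2 := h.integral_elastic hDA
    have k3 := h.integral_green hDA hu
    have k4 : ∫ x in Ioo (0 : ℝ) 1, rhoEta a b x * dx (y t) x * (rhoEta a b x * dx (y t) x) =
      el a b y t := by simp only [el, sq]
    rw [k4] at k3
    simp only
    rw [e1, e2, e3, e4, hy.multForm_eq h ht.le, multForm, bdryForm, k3]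
    change _ + γ * (_ + (_ + lam * pot a b d y t)) = _
    linear_combination k1 + k2 + lam * hp

end IsClassicalSolution

/-! ### Measurability and integrability on the space-time cylinder -/

theorem CurveCont.of_le {M N : (ℝ → ℝ) → ℝ} {y : ℝ → ℝ → ℝ} (h : CurveCont N y)
    (h0 : ∀ u, 0 ≤ M u) (hle : ∀ u, M u ≤ N u) : CurveCont M y := fun t₀ ht₀ =>
  tendsto_of_tendsto_of_tendsto_of_le_of_le tendsto_const_nhds (h t₀ ht₀) (fun _ => h0 _)
    fun _ => hle _

namespace Coef
variable {a b d : ℝ → ℝ} {q : ℝ}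

/-- The energy norm controls values uniformly in `x`, so continuity in `t` for that norm combines
with continuity of each `f t` in `x`. -/
theorem continuousOn_uncurry (h : Coef a b d q) {f : ℝ → ℝ → ℝ} (hf : ∀ t, 0 ≤ t → MemH1 a b (f t))
    (hc : CurveCont (sqH1 a b) f) :
    ContinuousOn (fun p : ℝ × ℝ => f p.1 p.2) (Ici 0 ×ˢ Icc 0 1) := by
  rintro ⟨t₀, x₀⟩ ⟨ht₀, hx₀⟩
  simp only at ht₀ hx₀
  have h1 : Tendsto (fun p : ℝ × ℝ => p.1) (𝓝[Ici 0 ×ˢ Icc 0 1] (t₀, x₀)) (𝓝[Ici 0] t₀) := by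
    rw [nhdsWithin_prod_eq]; exact tendsto_fst
  have h2 : Tendsto (fun p : ℝ × ℝ => p.2) (𝓝[Ici 0 ×ˢ Icc 0 1] (t₀, x₀)) (𝓝[Icc 0 1] x₀) := by
    rw [nhdsWithin_prod_eq]; exact tendsto_snd
  have h3 := ((hf t₀ ht₀).continuousOn x₀ hx₀).tendsto.comp h2
  have h4 : Tendsto (fun p : ℝ × ℝ => f p.1 p.2 - f t₀ p.2) (𝓝[Ici 0 ×ˢ Icc 0 1] (t₀, x₀))
      (𝓝 0) := by
    have h5 := (((hc t₀ ht₀).comp h1).const_mul (1 / etaMin a b)).sqrt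
    simp only [mul_zero, Real.sqrt_zero] at h5
    rw [tendsto_zero_iff_norm_tendsto_zero]
    refine tendsto_of_tendsto_of_tendsto_of_le_of_le' tendsto_const_nhds h5
      (Eventually.of_forall fun _ => norm_nonneg _) ?_
    filter_upwards [self_mem_nhdsWithin] with p hp
    exact Real.abs_le_sqrt (h.sq_eval_le_sqH1
      (h.isLinClass_memH1.sub _ _ (hf p.1 hp.1) (hf t₀ ht₀)) hp.2)
  have h6 := h4.add h3
  simp only [Function.comp_def, sub_add_cancel, zero_add] at h6
  exact h6

end Coef

namespace IsClassicalSolution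
variable {a b d : ℝ → ℝ} {q lam β : ℝ} {y : ℝ → ℝ → ℝ} {s T : ℝ}

theorem curveCont (h : Coef a b d q) (hy : IsClassicalSolution a b d lam β y) :
    CurveCont (sqH1 a b) y := by
  refine hy.cont_dom.of_le (fun u => ?_) fun u => ?_
  · rw [sqH1_eq h]
    exact add_nonneg (integral_sq_nonneg _) (integral_sq_nonneg _)
  · rw [sqDAlam, h.sqL2_eq]
    linarith [integral_sq_nonneg fun x => rhoSigma a b x * opAlam a b d lam u x]

/-- Continuity in `t` for the energy norm says nothing directly about joint measurability of `y_x`.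
It follows from joint continuity of `y`, since the derivative in one variable of a jointly
continuous function is measurable. -/
theorem aestronglyMeasurable_dx (h : Coef a b d q) (hy : IsClassicalSolution a b d lam β y)
    (hs : 0 < s) : AEStronglyMeasurable (fun p : ℝ × ℝ => dx (y p.1) p.2)
      (volume.restrict (Ioo s T ×ˢ Ioo (0 : ℝ) 1)) := by
  -- Clamping both variables extends `y` continuously to the plane without changing it on the open
  -- cylinder.
  let Y : ℝ → ℝ → ℝ := fun t x => y (max t 0) (projIcc (0 : ℝ) 1 zero_le_one x)
  have hY : Continuous (Function.uncurry Y) := by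
    have hc := h.continuousOn_uncurry hy.memH1 (hy.curveCont h)
    refine hc.comp_continuous (f := fun p : ℝ × ℝ =>
      (max p.1 0, (projIcc (0 : ℝ) 1 zero_le_one p.2 : ℝ))) ?_ fun p => ?_
    · exact (continuous_fst.max continuous_const).prodMk
        (continuous_subtype_val.comp (continuous_projIcc.comp continuous_snd))
    · exact mem_prod.2 ⟨mem_Ici.2 (le_max_right p.1 0), Subtype.coe_prop _⟩
  refine (aestronglyMeasurable_deriv_with_param hY _).congr ?_
  refine (ae_restrict_iff' (measurableSet_Ioo.prod measurableSet_Ioo)).2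
    (Eventually.of_forall fun p hp => ?_)
  simp only
  rw [dx_eq_deriv _ hp.2]
  apply Filter.EventuallyEq.deriv_eq
  filter_upwards [Icc_mem_nhds hp.2.1 hp.2.2] with x hx
  simp only [Y, projIcc_of_mem zero_le_one hx, max_eq_left (hs.trans hp.1.1).le]

theorem aestronglyMeasurable_density (h : Coef a b d q) (hy : IsClassicalSolution a b d lam β y)
    (hs : 0 < s) : AEStronglyMeasurable (fun p : ℝ × ℝ => density a b d lam y p.1 p.2)
      (volume.restrict (Ioo s T ×ˢ Ioo (0 : ℝ) 1)) := by
  have hms : MeasurableSet (Ioo s T ×ˢ Ioo (0 : ℝ) 1) := measurableSet_Ioo.prod measurableSet_Ioo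
  have hsub : Ioo s T ×ˢ Ioo (0 : ℝ) 1 ⊆ Ici 0 ×ˢ Icc 0 1 :=
    prod_mono (fun t ht => (hs.trans ht.1).le) Ioo_subset_Icc_self
  have m1 := ((h.continuousOn_uncurry hy.memH1 (hy.curveCont h)).mono
    hsub).aestronglyMeasurable (μ := volume) hms |>.aemeasurable
  have m2 := ((h.continuousOn_uncurry hy.dt_mem hy.dt_cont).mono
    hsub).aestronglyMeasurable (μ := volume) hms |>.aemeasurable
  have m3 := (hy.aestronglyMeasurable_dx h hs (T := T)).aemeasurable
  have hsnd : ∀ {f : ℝ → ℝ}, ContinuousOn f (Ioc 0 1) → AEMeasurable (fun p : ℝ × ℝ => f p.2)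
      (volume.restrict (Ioo s T ×ˢ Ioo (0 : ℝ) 1)) := fun hf =>
    ((hf.comp continuousOn_snd fun p hp =>
      Ioo_subset_Ioc_self hp.2).aestronglyMeasurable (μ := volume) hms).aemeasurable
  have m4 := hsnd h.sigma_cont
  have m5 := hsnd h.deg_d.c1.continuousOn
  have m6 := hsnd h.eta_c1.continuousOn
  exact ((((m2.pow_const 2).div m4).add (m6.mul (m3.pow_const 2))).sub
    (((m1.pow_const 2).const_mul lam).div (m4.mul m5))).aestronglyMeasurable

theorem integrableOn_of_Ici {f : ℝ → ℝ} (hf : ContinuousOn f (Ici 0)) (hs : 0 < s) :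
    IntegrableOn f (Ioo s T) :=
  ((hf.mono fun _ ht => hs.le.trans ht.1).integrableOn_compact (μ := volume)
    (isCompact_Icc (a := s) (b := T))).mono_set Ioo_subset_Icc_self

theorem integrableOn_density (h : Coef a b d q) (hy : IsClassicalSolution a b d lam β y)
    (hs : 0 < s) : IntegrableOn (fun p : ℝ × ℝ => density a b d lam y p.1 p.2)
      (Ioo s T ×ˢ Ioo (0 : ℝ) 1) := by
  have hm := hy.aestronglyMeasurable_density h hs (T := T)
  rw [IntegrableOn]
  rw [Measure.volume_eq_prod, ← Measure.prod_restrict] at hm ⊢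
  have hI : ∀ t ∈ Ioo s T, 0 ≤ t := fun t ht => (hs.trans ht.1).le
  rw [integrable_prod_iff hm]
  constructor
  · exact (ae_restrict_iff' measurableSet_Ioo).2 (Eventually.of_forall fun t ht =>
      (hy.integrable_density h (hI t ht)).1)
  · have hc : ContinuousOn (fun t => kin a b y t + el a b y t + |lam| * pot a b d y t) (Ici 0) :=
      ((hy.kin_continuousOn h).add (hy.el_continuousOn h)).add
        (continuousOn_const.mul (hy.pot_continuousOn h))
    refine Integrable.mono' (integrableOn_of_Ici hc hs) hm.norm.integral_prod_right' ?_
    refine (ae_restrict_iff' measurableSet_Ioo).2 (Eventually.of_forall fun t ht => ?_)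
    have ht0 := hI t ht
    have i1 := (h.memLp_rhoSigma (hy.dt_mem t ht0).memL2).integrable_sq
    have i2 := (h.memLp_rhoEta (hy.memH1 t ht0)).integrable_sq
    have i3 := (h.memLp_rhoHardy (hy.memH1 t ht0)).integrable_sq
    have i12 : IntegrableOn (fun x => (rhoSigma a b x * dt y t x) ^ 2 +
      (rhoEta a b x * dx (y t) x) ^ 2) (Ioo 0 1) := i1.add i2
    rw [Real.norm_of_nonneg (integral_nonneg fun _ => norm_nonneg _), kin, el, pot,
      ← integral_const_mul, ← integral_add i1 i2, ← integral_add i12 (i3.const_mul _)]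
    refine setIntegral_mono_on (hy.integrable_density h ht0).1.norm (i12.add (i3.const_mul _))
      measurableSet_Ioo fun x hx => ?_
    rw [density_eq h y t hx, Real.norm_eq_abs, abs_le]
    have h1 := sq_nonneg (rhoSigma a b x * dt y t x)
    have h2 := sq_nonneg (rhoEta a b x * dx (y t) x)
    have h3 := sq_nonneg (rhoHardy a b d x * y t x)
    have h4 := mul_le_mul_of_nonneg_right (le_abs_self lam) h3
    have h5 := mul_le_mul_of_nonneg_right (neg_abs_le lam) h3
    constructor <;> linarith

theorem integral_density_prod (h : Coef a b d q) (hy : IsClassicalSolution a b d lam β y)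
    (hs : 0 < s) (hsT : s < T) :
    ∫ p in Ioo s T ×ˢ Ioo (0 : ℝ) 1, density a b d lam y p.1 p.2 =
      ∫ t in s..T, kin a b y t + el a b y t - lam * pot a b d y t := by
  have hi := hy.integrableOn_density h hs (T := T)
  rw [Measure.volume_eq_prod] at hi ⊢
  rw [setIntegral_prod _ hi, intervalIntegral.integral_of_le hsT.le, integral_Ioc_eq_integral_Ioo]
  exact setIntegral_congr_fun measurableSet_Ioo fun t ht =>
    (hy.integrable_density h (hs.trans ht.1).le).2

end IsClassicalSolution

/-! ### Bounds for the energy, the cross term, the boundary terms and the quadratic form -/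

theorem ae_abs_le_supNorm {f : ℝ → ℝ} (hf : MemLp f ⊤ (volume.restrict (Ioo (0 : ℝ) 1))) :
    ∀ᵐ x ∂(volume.restrict (Ioo (0 : ℝ) 1)), |f x| ≤ supNorm f := by
  have h1 : eLpNorm f ⊤ (volume.restrict (Ioo (0 : ℝ) 1)) ≠ ⊤ := hf.2.ne
  have h2 := ae_le_eLpNormEssSup (f := f) (μ := volume.restrict (Ioo (0 : ℝ) 1))
  rw [← eLpNorm_exponent_top] at h2
  filter_upwards [h2] with x hx
  have := ENNReal.toReal_mono h1 hx
  simpa [supNorm] using this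

theorem supNorm_nonneg (f : ℝ → ℝ) : 0 ≤ supNorm f := ENNReal.toReal_nonneg

theorem Assumptions.ae_drift_le {a b d : ℝ → ℝ} {lam ε₀ : ℝ} (hyp : Assumptions a b d lam ε₀) :
    ∀ᵐ x ∂(volume.restrict (Ioo (0 : ℝ) 1)), |x * b x / a x| ≤ constM a b := by
  have h := hyp.coef
  by_cases hK : degIndex a ≤ 1
  · have hb : MemLp b ⊤ (volume.restrict (Ioo (0 : ℝ) 1)) := by
      obtain ⟨C, hC⟩ := isCompact_Icc.exists_bound_of_continuousOn hyp.cont_b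
      exact memLp_top_of_bound
        (aestronglyMeasurable_of_continuousOn (hyp.cont_b.mono Ioc_subset_Icc_self)) C
        (ae_restrict_Ioo_of_forall fun x hx => hC x (Ioo_subset_Icc_self hx))
    filter_upwards [ae_abs_le_supNorm hb, ae_restrict_mem measurableSet_Ioo] with x hx h01
    have h01' := Ioo_subset_Ioc_self h01
    have h1 := h.div_a_le hK h01'
    have ha := h.a_pos h01'
    have ha1 := h.a_pos Coef.one_mem
    rw [constM, if_pos hK, abs_div, abs_mul, abs_of_pos h01.1, abs_of_pos ha]
    calc x * |b x| / a x = x / a x * |b x| := by ring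
      _ ≤ 1 / a 1 * supNorm b := by gcongr
      _ = supNorm b / a 1 := by ring
  · rw [constM, if_neg hK]
    exact ae_abs_le_supNorm (hyp.bdd (not_le.1 hK))

theorem Assumptions.constM_nonneg {a b d : ℝ → ℝ} {lam ε₀ : ℝ} (hyp : Assumptions a b d lam ε₀) :
    0 ≤ constM a b := by
  have := hyp.coef.a_pos Coef.one_mem
  rw [constM]
  split_ifs
  · exact div_nonneg (supNorm_nonneg _) this.le
  · exact supNorm_nonneg _

theorem Assumptions.oneEps_pos {a b d : ℝ → ℝ} {lam ε₀ : ℝ} (hyp : Assumptions a b d lam ε₀) :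
    0 < oneEps a b d lam ∧ oneEps a b d lam ≤ 1 := by
  rw [oneEps]
  split_ifs with hl
  · exact ⟨one_pos, le_rfl⟩
  · have hl' := not_le.1 hl
    have hC := (Coef.CHP_nonneg : 0 ≤ CHP a b d)
    rcases hC.eq_or_lt with h0 | h0
    -- If `C_HP` were `0`, then `1/C_HP` would be `0` by the convention on division, and `λ <
    -- 1/C_HP` would contradict `λ > 0`.
    · have := hyp.lam_lt
      rw [← h0, div_zero] at this
      linarith
    · have := (lt_div_iff₀ h0).1 hyp.lam_lt
      exact ⟨by linarith, by linarith [mul_nonneg hl'.le hC]⟩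

/-- The maximum occurring in `Theta`. -/
noncomputable def thetaMax (a b : ℝ → ℝ) : ℝ :=
  max (1 / a 1 + degIndex a * CHPtilde a b / (4 * etaMin a b)) (1 + degIndex a / 4)

theorem mul_integral_sq_le {κ f : ℝ → ℝ} {c : ℝ}
    (hi : IntegrableOn (fun x => κ x * f x ^ 2) (Ioo 0 1))
    (hf : MemLp f 2 (volume.restrict (Ioo 0 1)))
    (hc : ∀ᵐ x ∂(volume.restrict (Ioo (0 : ℝ) 1)), c ≤ κ x) :
    c * ∫ x in Ioo (0 : ℝ) 1, f x ^ 2 ≤ ∫ x in Ioo (0 : ℝ) 1, κ x * f x ^ 2 := by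
  rw [← integral_const_mul]
  refine integral_mono_ae (hf.integrable_sq.const_mul c) hi ?_
  filter_upwards [hc] with x hx
  exact mul_le_mul_of_nonneg_right hx (sq_nonneg _)

theorem integral_sq_mul_le {κ f : ℝ → ℝ} {c : ℝ}
    (hi : IntegrableOn (fun x => κ x * f x ^ 2) (Ioo 0 1))
    (hf : MemLp f 2 (volume.restrict (Ioo 0 1)))
    (hc : ∀ᵐ x ∂(volume.restrict (Ioo (0 : ℝ) 1)), κ x ≤ c) :
    ∫ x in Ioo (0 : ℝ) 1, κ x * f x ^ 2 ≤ c * ∫ x in Ioo (0 : ℝ) 1, f x ^ 2 := by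
  rw [← integral_const_mul]
  refine integral_mono_ae hi (hf.integrable_sq.const_mul c) ?_
  filter_upwards [hc] with x hx
  exact mul_le_mul_of_nonneg_right hx (sq_nonneg _)

theorem two_abs_integral_mul_le {f g : ℝ → ℝ} (hf : MemLp f 2 (volume.restrict (Ioo (0 : ℝ) 1)))
    (hg : MemLp g 2 (volume.restrict (Ioo (0 : ℝ) 1))) :
    2 * |∫ x in Ioo (0 : ℝ) 1, f x * g x| ≤
      (∫ x in Ioo (0 : ℝ) 1, f x ^ 2) + ∫ x in Ioo (0 : ℝ) 1, g x ^ 2 := by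
  rw [← inner_emb hf hg, ← norm_sq_emb hf, ← norm_sq_emb hg]
  have := abs_real_inner_le_norm (emb f) (emb g)
  nlinarith [sq_nonneg (‖emb f‖ - ‖emb g‖)]

namespace IsClassicalSolution
variable {a b d : ℝ → ℝ} {q lam β ε₀ γ θ : ℝ} {y : ℝ → ℝ → ℝ} {t s T : ℝ}

theorem kin_nonneg : 0 ≤ kin a b y t := integral_sq_nonneg _

theorem el_nonneg : 0 ≤ el a b y t := integral_sq_nonneg _

theorem pot_nonneg : 0 ≤ pot a b d y t := integral_sq_nonneg _

theorem pot_le (h : Coef a b d q) (hy : IsClassicalSolution a b d lam β y) (ht : 0 ≤ t) :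
    pot a b d y t ≤ CHP a b d * el a b y t := h.le_CHP (hy.memH1 t ht)

/-- For `λ > 0` the potential term is at most `λ C_HP` times the elastic energy, which leaves the
factor `1 - λ C_HP`. For `λ ≤ 0` it only increases the energy. -/
theorem oneEps_mul_le (hyp : Assumptions a b d lam ε₀) (hβ : 0 ≤ β)
    (hy : IsClassicalSolution a b d lam β y) (ht : 0 ≤ t) :
    oneEps a b d lam * (kin a b y t + el a b y t) ≤ 2 * energy a b d lam β y t := by
  have h := hyp.coef
  rw [hy.energy_eq h ht]
  have h1 : 0 ≤ β * y t 1 ^ 2 := by positivity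
  have h2 := kin_nonneg (a := a) (b := b) (y := y) (t := t)
  have h4 := pot_nonneg (a := a) (b := b) (d := d) (y := y) (t := t)
  rw [oneEps]
  split_ifs with hl
  · nlinarith
  · have h5 := mul_le_mul_of_nonneg_left (hy.pot_le h ht) (not_le.1 hl).le
    have h6 := mul_nonneg (mul_nonneg (not_le.1 hl).le (Coef.CHP_nonneg : 0 ≤ CHP a b d)) h2
    linarith

theorem energy_nonneg (hyp : Assumptions a b d lam ε₀) (hβ : 0 ≤ β)
    (hy : IsClassicalSolution a b d lam β y) (ht : 0 ≤ t) : 0 ≤ energy a b d lam β y t := by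
  have := hy.oneEps_mul_le hyp hβ ht
  have := mul_nonneg hyp.oneEps_pos.1.le
    (add_nonneg (kin_nonneg (a := a) (b := b) (y := y) (t := t))
      (el_nonneg (a := a) (b := b) (y := y) (t := t)))
  linarith

theorem thetaMax_mul_le (hyp : Assumptions a b d lam ε₀) (hβ : 0 ≤ β)
    (hy : IsClassicalSolution a b d lam β y) (ht : 0 ≤ t) :
    thetaMax a b * (kin a b y t + el a b y t) ≤ Theta a b d lam * energy a b d lam β y t := by
  have h1 := hyp.oneEps_pos.1
  have h2 := hy.oneEps_mul_le hyp hβ ht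
  have hK := hyp.coef.deg_a.index_pos
  have h0 : 0 ≤ thetaMax a b := le_trans (by positivity) (le_max_right _ _)
  rw [mul_comm (oneEps a b d lam), ← le_div_iff₀ h1] at h2
  calc thetaMax a b * (kin a b y t + el a b y t)
      ≤ thetaMax a b * (2 * energy a b d lam β y t / oneEps a b d lam) := by gcongr
    _ = _ := by rw [Theta, thetaMax]; ring

/-- Young's inequality on both products. The part `2 x y_x` gives the entries `1/a(1)` and `1` of
the maximum in `Θ`; the part `γ y`, with `|γ| ≤ K_a/2` and Hardy–Poincaré, gives the entries with
`K_a/4`. -/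
theorem abs_cross_le (h : Coef a b d q) (hy : IsClassicalSolution a b d lam β y) (ht : 0 ≤ t)
    (hγ : |γ| ≤ degIndex a / 2) :
    |cross a b γ y t| ≤ thetaMax a b * (kin a b y t + el a b y t) := by
  have hu := hy.memH1 t ht
  have m1 := h.memLp_rhoSigma (hy.dt_mem t ht).memL2
  have m2 := h.memLp_rhoMult hu
  have m3 := h.memLp_rhoSigma hu.memL2
  have c1 := two_abs_integral_mul_le m1 m2.1
  have c2 := two_abs_integral_mul_le m1 m3
  have c3 := h.le_CHPtilde hu
  have c4 := m2.2
  have hk := kin_nonneg (a := a) (b := b) (y := y) (t := t)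
  have he := el_nonneg (a := a) (b := b) (y := y) (t := t)
  have hK := h.deg_a.index_pos
  rw [← el] at c3 c4
  rw [← kin] at c1 c2
  set I := ∫ x in Ioo (0 : ℝ) 1, rhoSigma a b x * dt y t x * (rhoMult a b x * dx (y t) x)
  set J := ∫ x in Ioo (0 : ℝ) 1, rhoSigma a b x * dt y t x * (rhoSigma a b x * y t x)
  have hc : |cross a b γ y t| ≤ 2 * |I| + degIndex a / 2 * |J| := by
    rw [cross]
    refine (abs_add_le _ _).trans ?_
    rw [abs_mul, abs_mul, abs_two]
    gcongr
  have h5 : degIndex a / 2 * |J| ≤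
      degIndex a / 4 * (kin a b y t + CHPtilde a b / etaMin a b * el a b y t) := by
    have : 2 * |J| ≤ kin a b y t + CHPtilde a b / etaMin a b * el a b y t := by linarith
    nlinarith
  have h6 := mul_le_mul_of_nonneg_right (le_max_left (1 / a 1 + degIndex a * CHPtilde a b /
    (4 * etaMin a b)) (1 + degIndex a / 4)) he
  have h7 := mul_le_mul_of_nonneg_right (le_max_right (1 / a 1 + degIndex a * CHPtilde a b /
    (4 * etaMin a b)) (1 + degIndex a / 4)) hk
  rw [← thetaMax] at h6 h7
  have e : degIndex a * CHPtilde a b / (4 * etaMin a b) =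
    degIndex a / 4 * (CHPtilde a b / etaMin a b) := by ring
  rw [e] at h6
  linarith

/-- Bound for the cross term with a nonnegative zero order multiplier. -/
theorem abs_cross_le_of_nonneg (h : Coef a b d q) (hy : IsClassicalSolution a b d lam β y)
    (ht : 0 ≤ t) (h0 : 0 ≤ γ) (hγ : γ / 2 + degIndex a / 2 ≤ q) :
    |cross a b γ y t| ≤ thetaMax a b * (kin a b y t + el a b y t) +
      γ / 2 * (1 / sigma a b 1 * y t 1 ^ 2) := by
  have hu := hy.memH1 t ht
  have m1 := h.memLp_rhoSigma (hy.dt_mem t ht).memL2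
  have m2 := h.memLp_rhoMult hu
  have m3 := h.memLp_rhoSigma hu.memL2
  have i12 : IntegrableOn (fun x => rhoSigma a b x * dt y t x * (rhoMult a b x * dx (y t) x))
    (Ioo 0 1) := m1.integrable_mul m2.1
  have i13 : IntegrableOn (fun x => rhoSigma a b x * dt y t x * (rhoSigma a b x * y t x))
    (Ioo 0 1) := m1.integrable_mul m3
  have i32 : IntegrableOn (fun x => rhoSigma a b x * y t x * (rhoMult a b x * dx (y t) x))
    (Ioo 0 1) := m3.integrable_mul m2.1
  have m4 : MemLp (fun x => rhoMult a b x * dx (y t) x + γ / 2 * (rhoSigma a b x * y t x)) 2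
    (volume.restrict (Ioo 0 1)) := m2.1.add (m3.const_mul (γ / 2))
  have c1 := two_abs_integral_mul_le m1 m4
  have e1 : cross a b γ y t = 2 * ∫ x in Ioo (0 : ℝ) 1, rhoSigma a b x * dt y t x *
      (rhoMult a b x * dx (y t) x + γ / 2 * (rhoSigma a b x * y t x)) := by
    have : ∀ x, rhoSigma a b x * dt y t x *
        (rhoMult a b x * dx (y t) x + γ / 2 * (rhoSigma a b x * y t x)) =
        rhoSigma a b x * dt y t x * (rhoMult a b x * dx (y t) x) +
        γ / 2 * (rhoSigma a b x * dt y t x * (rhoSigma a b x * y t x)) := fun x => by ring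
    simp only [this]
    rw [integral_add i12 (i13.const_mul _), integral_const_mul, cross]; ring
  have e2 : ∫ x in Ioo (0 : ℝ) 1,
      (rhoMult a b x * dx (y t) x + γ / 2 * (rhoSigma a b x * y t x)) ^ 2 =
      (∫ x in Ioo (0 : ℝ) 1, (rhoMult a b x * dx (y t) x) ^ 2) +
      γ * (∫ x in Ioo (0 : ℝ) 1, rhoSigma a b x * y t x * (rhoMult a b x * dx (y t) x)) +
      γ ^ 2 / 4 * ∫ x in Ioo (0 : ℝ) 1, (rhoSigma a b x * y t x) ^ 2 := by
    have : ∀ x, (rhoMult a b x * dx (y t) x + γ / 2 * (rhoSigma a b x * y t x)) ^ 2 =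
        (rhoMult a b x * dx (y t) x) ^ 2 +
        γ * (rhoSigma a b x * y t x * (rhoMult a b x * dx (y t) x)) +
        γ ^ 2 / 4 * (rhoSigma a b x * y t x) ^ 2 := fun x => by ring
    simp only [this]
    have i5 : IntegrableOn (fun x => (rhoMult a b x * dx (y t) x) ^ 2 +
        γ * (rhoSigma a b x * y t x * (rhoMult a b x * dx (y t) x))) (Ioo 0 1) :=
      m2.1.integrable_sq.add (i32.const_mul γ)
    rw [integral_add i5 (m3.integrable_sq.const_mul _),
      integral_add m2.1.integrable_sq (i32.const_mul γ), integral_const_mul, integral_const_mul]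
  -- Expanding the square of `x y_x + γ y/2` yields `γ x y y_x/σ`, which is integrated by parts. The
  -- coefficient `1 - x(a' - b)/a` is at least `γ/2`, so the resulting negative integral of `y²/σ`
  -- absorbs `γ²/4 ∫ y²/σ` and only a trace remains.
  have c2 := h.integral_kinetic hu
  have c3 := mul_integral_sq_le (c := γ / 2) (h.integrable_kinCoef 0 m3) m3
    (ae_restrict_Ioo_of_forall fun x hx => by
      have h1 := abs_le.1 (h.strong x (Ioo_subset_Ioc_self hx))
      have h2 := abs_le.1 (h.deg_a.bound x (Ioo_subset_Ioc_self hx))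
      have := h.deg_d.index_pos
      rw [Coef.kinCoef]; linarith)
  have c4 := m2.2
  rw [← el] at c4
  rw [← kin] at c1
  have hk := kin_nonneg (a := a) (b := b) (y := y) (t := t)
  have he := el_nonneg (a := a) (b := b) (y := y) (t := t)
  have hK := h.deg_a.index_pos
  have hη := h.etaMin_pos
  have hC : 0 ≤ CHPtilde a b := Coef.CHPtilde_nonneg
  have h6 : 1 / a 1 * el a b y t ≤ thetaMax a b * el a b y t :=
    mul_le_mul_of_nonneg_right ((le_add_of_nonneg_right (by positivity)).trans (le_max_left _ _)) he
  have h7 : 1 * kin a b y t ≤ thetaMax a b * kin a b y t :=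
    mul_le_mul_of_nonneg_right ((le_add_of_nonneg_right (by positivity)).trans (le_max_right _ _)) hk
  have c5 := mul_le_mul_of_nonneg_left c3 (by positivity : 0 ≤ γ / 2)
  rw [e1, abs_mul, abs_two]
  rw [e2] at c1
  refine c1.trans ?_
  linear_combination c4 + h6 + h7 + c5 + γ / 2 * c2

/-- The boundary condition eliminates `y_x(t,1)`, and `2β y y_t ≤ β(y² + y_t²)` splits the square.
The `γ` term is kept exact because it is estimated differently according to the size of `γ`. -/
theorem bdryForm_le (hβ : 0 ≤ β) (hy : IsClassicalSolution a b d lam β y)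
    (ht : 0 < t) : bdryForm a b d lam γ y t ≤
      (1 / sigma a b 1 + 1 / eta a b 1 + β / eta a b 1) * dt y t 1 ^ 2 +
      (β ^ 2 / eta a b 1 + β / eta a b 1 + lam / (sigma a b 1 * d 1)) * y t 1 ^ 2 -
      γ * ((dt y t 1 + β * y t 1) * y t 1) := by
  have hη := Coef.eta_pos (a := a) (b := b) 1
  have hb : eta a b 1 * dx (y t) 1 = -(dt y t 1 + β * y t 1) := by linarith [hy.boundary t ht]
  have e : eta a b 1 * dx (y t) 1 ^ 2 = (dt y t 1 + β * y t 1) ^ 2 / eta a b 1 := by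
    rw [eq_div_iff hη.ne']
    linear_combination (eta a b 1 * dx (y t) 1 - (dt y t 1 + β * y t 1)) * hb
  have h1 : (dt y t 1 + β * y t 1) ^ 2 / eta a b 1 ≤
      (1 / eta a b 1 + β / eta a b 1) * dt y t 1 ^ 2 +
      (β ^ 2 / eta a b 1 + β / eta a b 1) * y t 1 ^ 2 := by
    have : (1 / eta a b 1 + β / eta a b 1) * dt y t 1 ^ 2 +
      (β ^ 2 / eta a b 1 + β / eta a b 1) * y t 1 ^ 2 =
      ((1 + β) * dt y t 1 ^ 2 + (β ^ 2 + β) * y t 1 ^ 2) / eta a b 1 := by ring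
    rw [this]
    gcongr
    nlinarith [mul_nonneg hβ (sq_nonneg (dt y t 1 - y t 1))]
  rw [bdryForm, e, hb]
  have e2 : lam * (1 / (sigma a b 1 * d 1) * y t 1 ^ 2) =
    lam / (sigma a b 1 * d 1) * y t 1 ^ 2 := by ring
  rw [e2]
  linarith

theorem abs_mul_trace_le (hK : |γ| ≤ degIndex a / 2) (hβ : 0 ≤ β) (u v : ℝ) :
    -γ * ((v + β * u) * u) ≤
      degIndex a / 4 * v ^ 2 + (degIndex a * β / 2 + degIndex a / 4) * u ^ 2 := by
  obtain ⟨h1, h2⟩ := abs_le.1 hK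
  have h3 : -γ * (v * u) ≤ degIndex a / 2 * ((v ^ 2 + u ^ 2) / 2) := by
    nlinarith [mul_nonneg (sub_nonneg.2 h2) (sq_nonneg (v - u)),
      mul_nonneg (neg_le_iff_add_nonneg.1 h1) (sq_nonneg (v + u)),
      mul_nonneg (sub_nonneg.2 h2) (sq_nonneg (v + u)),
      mul_nonneg (neg_le_iff_add_nonneg.1 h1) (sq_nonneg (v - u))]
  have h4 : -γ * (β * u ^ 2) ≤ degIndex a / 2 * (β * u ^ 2) :=
    mul_le_mul_of_nonneg_right (by linarith) (by positivity)
  linarith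

/-- The shift `-K_a/2` balances the coefficients: the kinetic one gains `K_a/2` against a loss of up
to `K_a` from `x a'/a`, and the elastic one loses `K_a/2`. The margin `K_d` then keeps the potential
coefficient nonnegative. -/
theorem le_multForm_of_nonneg (h : Coef a b d q) (hl : 0 ≤ lam)
    (hy : IsClassicalSolution a b d lam β y) (ht : 0 ≤ t) :
    q * (kin a b y t + el a b y t - lam * pot a b d y t) ≤
      multForm a b d lam (-(degIndex a / 2)) y t := by
  have m1 := h.memLp_rhoSigma (hy.dt_mem t ht).memL2
  have m2 := h.memLp_rhoEta (hy.memH1 t ht)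
  have m3 := h.memLp_rhoHardy (hy.memH1 t ht)
  have hq := h.q_pos
  have bd : ∀ x ∈ Ioo (0 : ℝ) 1, q ≤ Coef.kinCoef a b (-(degIndex a / 2)) x ∧
      q ≤ Coef.elCoef a b (-(degIndex a / 2)) x ∧
      0 ≤ Coef.potCoef a b d (-(degIndex a / 2)) x := fun x hx => by
    have h1 := abs_le.1 (h.strong x (Ioo_subset_Ioc_self hx))
    have h2 := abs_le.1 (h.deg_a.bound x (Ioo_subset_Ioc_self hx))
    have h3 := abs_le.1 (h.deg_d.bound x (Ioo_subset_Ioc_self hx))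
    have := h.deg_d.index_pos
    simp only [Coef.potCoef, Coef.elCoef, Coef.kinCoef]
    refine ⟨?_, ?_, ?_⟩ <;> linarith
  have c1 := mul_integral_sq_le (h.integrable_kinCoef _ m1) m1
    (ae_restrict_Ioo_of_forall fun x hx => (bd x hx).1)
  have c2 := mul_integral_sq_le (h.integrable_elCoef _ m2) m2
    (ae_restrict_Ioo_of_forall fun x hx => (bd x hx).2.1)
  have c3 := mul_integral_sq_le (h.integrable_potCoef _ m3) m3
    (ae_restrict_Ioo_of_forall fun x hx => (bd x hx).2.2)
  have c4 := mul_le_mul_of_nonneg_left c3 hl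
  have c5 : 0 ≤ q * (lam * pot a b d y t) := mul_nonneg hq.le (mul_nonneg hl pot_nonneg)
  rw [multForm]
  rw [← kin] at c1
  rw [← el] at c2
  simp only [zero_mul, mul_zero] at c4
  linarith

/-- The constant multiplying `-2 λ C_HP ∫ E` in the estimate for negative `λ`. -/
noncomputable def potConst (a b d : ℝ → ℝ) : ℝ :=
  1 + 3 / 2 * degIndex a + degIndex d + constM a b

/-- As `λ < 0`, an upper bound on the potential coefficient is needed, which is where `M` enters.
The parameter `θ` transfers weight from the kinetic to the elastic energy. -/
theorem le_multForm_of_neg (hyp : Assumptions a b d lam ε₀) (hl : lam < 0)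
    (hy : IsClassicalSolution a b d lam β y) (ht : 0 ≤ t) :
    (ε₀ / 2 + degIndex d - θ) * kin a b y t + (ε₀ / 2 + degIndex d + θ) * el a b y t +
      lam * (potConst a b d - θ) * pot a b d y t ≤
      multForm a b d lam (θ - degIndex a / 2) y t := by
  have h := hyp.coef
  have m1 := h.memLp_rhoSigma (hy.dt_mem t ht).memL2
  have m2 := h.memLp_rhoEta (hy.memH1 t ht)
  have m3 := h.memLp_rhoHardy (hy.memH1 t ht)
  have bd : ∀ x ∈ Ioo (0 : ℝ) 1,
      ε₀ / 2 + degIndex d - θ ≤ Coef.kinCoef a b (θ - degIndex a / 2) x ∧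
      ε₀ / 2 + degIndex d + θ ≤ Coef.elCoef a b (θ - degIndex a / 2) x := fun x hx => by
    have h1 := abs_le.1 (h.strong x (Ioo_subset_Ioc_self hx))
    have h2 := abs_le.1 (h.deg_a.bound x (Ioo_subset_Ioc_self hx))
    simp only [Coef.elCoef, Coef.kinCoef]
    refine ⟨?_, ?_⟩ <;> linarith
  have c1 := mul_integral_sq_le (h.integrable_kinCoef _ m1) m1
    (ae_restrict_Ioo_of_forall fun x hx => (bd x hx).1)
  have c2 := mul_integral_sq_le (h.integrable_elCoef _ m2) m2
    (ae_restrict_Ioo_of_forall fun x hx => (bd x hx).2)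
  have c3 := integral_sq_mul_le (c := potConst a b d - θ)
    (h.integrable_potCoef (θ - degIndex a / 2) m3) m3 (by
      filter_upwards [hyp.ae_drift_le, ae_restrict_mem measurableSet_Ioo] with x h1 hx
      have h1 := abs_le.1 h1
      have h2 := abs_le.1 (h.deg_a.bound x (Ioo_subset_Ioc_self hx))
      have h3 := abs_le.1 (h.deg_d.bound x (Ioo_subset_Ioc_self hx))
      simp only [Coef.potCoef, Coef.kinCoef, potConst]
      linarith)
  have c4 := mul_le_mul_of_nonpos_left c3 hl.le
  rw [multForm]
  rw [← kin] at c1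
  rw [← el] at c2
  rw [← pot] at c4
  linarith

theorem energy_sub_eq (h : Coef a b d q) (hy : IsClassicalSolution a b d lam β y) (hs : 0 < s)
    (hsT : s < T) : ∫ t in s..T, dt y t 1 ^ 2 =
      energy a b d lam β y s - energy a b d lam β y T := by
  have hsub : uIcc s T ⊆ Ici 0 := by
    rw [uIcc_of_le hsT.le]; exact fun t ht => hs.le.trans ht.1
  have := intervalIntegral.integral_eq_sub_of_hasDerivAt (a := s) (b := T)
    (f := energy a b d lam β y) (f' := fun t => -(dt y t 1) ^ 2)
    (fun t ht => by
      rw [uIcc_of_le hsT.le] at ht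
      exact hy.hasDerivAt_energy h (hs.trans_le ht.1))
    (((hy.continuousOn_dt_trace h).pow 2).neg.mono hsub).intervalIntegrable
  rw [intervalIntegral.integral_neg] at this
  linarith

theorem energy_le (h : Coef a b d q) (hy : IsClassicalSolution a b d lam β y) (hs : 0 < s)
    (hsT : s < T) : energy a b d lam β y T ≤ energy a b d lam β y s := by
  have h1 := hy.energy_sub_eq h hs hsT
  have h2 : 0 ≤ ∫ t in s..T, dt y t 1 ^ 2 :=
    intervalIntegral.integral_nonneg hsT.le fun t _ => sq_nonneg _
  linarith

/-- Integration in time of a differential inequality. -/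
theorem integral_density_le (h : Coef a b d q) (hy : IsClassicalSolution a b d lam β y)
    (hs : 0 < s) (hsT : s < T) {Φ Φ' : ℝ → ℝ} {p B c e : ℝ} (hc : ContinuousOn Φ' (Ici 0))
    (hd : ∀ t, 0 < t → HasDerivAt Φ (Φ' t) t)
    (hle : ∀ t, 0 < t → p * (kin a b y t + el a b y t - lam * pot a b d y t) ≤
      -Φ' t + B * dt y t 1 ^ 2 + c * y t 1 ^ 2 + e * energy a b d lam β y t) :
    p * ∫ t in s..T, (kin a b y t + el a b y t - lam * pot a b d y t) ≤
      Φ s - Φ T + B * (energy a b d lam β y s - energy a b d lam β y T) +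
        c * (∫ t in s..T, y t 1 ^ 2) + e * ∫ t in s..T, energy a b d lam β y t := by
  have hsub : uIcc s T ⊆ Ici 0 := by
    rw [uIcc_of_le hsT.le]; exact fun t ht => hs.le.trans ht.1
  have hii : ∀ {f : ℝ → ℝ}, ContinuousOn f (Ici 0) → IntervalIntegrable f volume s T :=
    fun hf => (hf.mono hsub).intervalIntegrable
  have hn : ContinuousOn (fun t => p * (kin a b y t + el a b y t - lam * pot a b d y t)) (Ici 0) :=
    continuousOn_const.mul (((hy.kin_continuousOn h).add (hy.el_continuousOn h)).sub
      (continuousOn_const.mul (hy.pot_continuousOn h)))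
  have i2 := hii (f := fun t => B * dt y t 1 ^ 2)
    (continuousOn_const.mul ((hy.continuousOn_dt_trace h).pow 2))
  have i3 := hii (f := fun t => c * y t 1 ^ 2)
    (continuousOn_const.mul ((hy.continuousOn_trace h).pow 2))
  have i4 := hii (f := fun t => e * energy a b d lam β y t)
    (continuousOn_const.mul (hy.energy_continuousOn h))
  have i1 : IntervalIntegrable (fun t => -Φ' t) volume s T := hii hc.neg
  have i12 : IntervalIntegrable (fun t => -Φ' t + B * dt y t 1 ^ 2) volume s T := i1.add i2
  have i123 : IntervalIntegrable (fun t => -Φ' t + B * dt y t 1 ^ 2 + c * y t 1 ^ 2) volume s T :=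
    i12.add i3
  have hΦ := intervalIntegral.integral_eq_sub_of_hasDerivAt (a := s) (b := T)
    (fun t ht => by
      rw [uIcc_of_le hsT.le] at ht
      exact hd t (hs.trans_le ht.1)) (hii hc)
  have key := intervalIntegral.integral_mono_on hsT.le (hii hn) (i123.add i4)
    fun t ht => hle t (hs.trans_le ht.1)
  rw [intervalIntegral.integral_add i123 i4, intervalIntegral.integral_add i12 i3,
    intervalIntegral.integral_add i1 i2, intervalIntegral.integral_neg, hΦ,
    intervalIntegral.integral_const_mul, intervalIntegral.integral_const_mul,
    intervalIntegral.integral_const_mul, intervalIntegral.integral_const_mul,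
    hy.energy_sub_eq h hs hsT] at key
  linarith

end IsClassicalSolution

/-! ### Coercivity for negative `λ` and the estimates integrated in time -/

namespace IsClassicalSolution
variable {a b d : ℝ → ℝ} {q lam β ε₀ γ θ : ℝ} {y : ℝ → ℝ → ℝ} {t s T : ℝ}

theorem one_le_potConst (hyp : Assumptions a b d lam ε₀) : 1 ≤ potConst a b d := by
  have := hyp.coef.deg_a.index_pos
  have := hyp.coef.deg_d.index_pos
  have := hyp.constM_nonneg
  rw [potConst]; linarith

theorem density_le_energy (h : Coef a b d q) (hβ : 0 ≤ β) (hy : IsClassicalSolution a b d lam β y)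
    (ht : 0 ≤ t) : kin a b y t + el a b y t - lam * pot a b d y t ≤ 2 * energy a b d lam β y t := by
  rw [hy.energy_eq h ht]
  have : 0 ≤ β * y t 1 ^ 2 := by positivity
  linarith

/-- Coercivity of the quadratic form for negative `λ`, with the zero order multiplier corrected by
`z (ε₀/2 - z S)`, where `z = |λ| C_HP` and `S` is the constant `potConst`. -/
theorem density_le_multForm_of_neg (hyp : Assumptions a b d lam ε₀) (hl : lam < 0) (hβ : 0 ≤ β)
    (hy : IsClassicalSolution a b d lam β y) (ht : 0 ≤ t) {z : ℝ} (hz : z = -lam * CHP a b d)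
    (hzS : z * potConst a b d ≤ ε₀ / 2) :
    ε₀ / 2 * (kin a b y t + el a b y t - lam * pot a b d y t) ≤
      multForm a b d lam (z * (ε₀ / 2 - z * potConst a b d) - degIndex a / 2) y t +
        2 * z * potConst a b d * energy a b d lam β y t := by
  have h := hyp.coef
  have hS := one_le_potConst hyp
  have hKa := h.deg_a.index_pos
  have hKd := h.deg_d.index_pos
  have hq1 : ε₀ / 2 ≤ 1 := by linarith [h.q_add_index]
  have hz0 : 0 ≤ z := by
    rw [hz]; exact mul_nonneg (neg_nonneg.2 hl.le) Coef.CHP_nonneg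
  have hl0 : 0 ≤ -lam := neg_nonneg.2 hl.le
  have h1 := hy.le_multForm_of_neg hyp hl ht (θ := z * (ε₀ / 2 - z * potConst a b d))
  have h2 := mul_le_mul_of_nonneg_left (hy.density_le_energy h hβ ht)
    (mul_nonneg hz0 (zero_le_one.trans hS))
  have h3 := mul_le_mul_of_nonneg_left (hy.pot_le h ht) hl0
  rw [← mul_assoc, ← hz] at h3
  have hk := kin_nonneg (a := a) (b := b) (y := y) (t := t)
  have he := el_nonneg (a := a) (b := b) (y := y) (t := t)
  have hp := pot_nonneg (a := a) (b := b) (d := d) (y := y) (t := t)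
  set k := kin a b y t
  set e := el a b y t
  set p := pot a b d y t
  set S := potConst a b d
  set r := ε₀ / 2 - z * S with hr
  have hr0 : 0 ≤ r := by linarith
  -- Since `r ≤ q ≤ 1 ≤ S`, the kinetic loss `z r` is covered by the contribution `z S` of the
  -- energy term.
  have hθS : z * r ≤ z * S :=
    mul_le_mul_of_nonneg_left (by linarith [mul_nonneg hz0 (zero_le_one.trans hS)]) hz0
  have k1 : 0 ≤ (degIndex d + (z * S - z * r)) * k := mul_nonneg (by linarith) hk
  have k2 : 0 ≤ degIndex d * e := mul_nonneg hKd.le he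
  -- Here `z e ≥ |λ| p` is used twice: with factor `S` it pays for the potential part of the form,
  -- with factor `r = q - z S` for the part of the density not yet covered.
  have k3 : 0 ≤ S * (z * e - -lam * p) := mul_nonneg (by linarith) (by linarith)
  have k4 : 0 ≤ r * (z * e - -lam * p) := mul_nonneg hr0 (by linarith)
  have k5 : 0 ≤ -lam * (z * r) * p := mul_nonneg (mul_nonneg hl0 (mul_nonneg hz0 hr0)) hp
  have hq : ε₀ / 2 = r + z * S := by linarith
  rw [hq] at h1 ⊢
  linarith

/-- Because `S ≥ 1`, the left side is at most `z(p - z)`, whose maximum is `p²/4`. With `p = q` this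
bounds the corrected multiplier. -/
theorem mul_sub_mul_le {z p S : ℝ} (hS : 1 ≤ S) : z * (p - z * S) ≤ p ^ 2 / 4 := by
  nlinarith [sq_nonneg (p / 2 - z), mul_nonneg (sub_nonneg.2 hS) (sq_nonneg z)]

/-- The estimate when the zero order multiplier has size at most `K_a / 2`. -/
theorem integral_density_le_of_abs_le (hyp : Assumptions a b d lam ε₀) (hβ : 0 ≤ β)
    (hy : IsClassicalSolution a b d lam β y) (hs : 0 < s) (hsT : s < T) {p e : ℝ}
    (hγ : |γ| ≤ degIndex a / 2)
    (hle : ∀ t, 0 < t → p * (kin a b y t + el a b y t - lam * pot a b d y t) ≤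
      multForm a b d lam γ y t + e * energy a b d lam β y t) :
    p * ∫ t in s..T, (kin a b y t + el a b y t - lam * pot a b d y t) ≤
      (2 * Theta a b d lam + 1 / sigma a b 1 + 1 / eta a b 1 + β / eta a b 1 + degIndex a / 4)
          * energy a b d lam β y s
        + (β ^ 2 / eta a b 1 + degIndex a * β / 2 + β / eta a b 1 + degIndex a / 4
          + lam / (sigma a b 1 * d 1)) * (∫ t in s..T, y t 1 ^ 2)
        + e * ∫ t in s..T, energy a b d lam β y t := by
  have h := hyp.coef
  obtain ⟨G, hGc, hG⟩ := hy.exists_deriv_cross h γ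
  have key := hy.integral_density_le h hs hsT (p := p) (e := e)
    (B := 1 / sigma a b 1 + 1 / eta a b 1 + β / eta a b 1 + degIndex a / 4)
    (c := β ^ 2 / eta a b 1 + degIndex a * β / 2 + β / eta a b 1 + degIndex a / 4
          + lam / (sigma a b 1 * d 1)) hGc (fun t ht => (hG t ht).1) fun t ht => by
      have h1 := hle t ht
      have h2 := (hG t ht).2
      have h3 := hy.bdryForm_le (γ := γ) hβ ht
      have h4 := abs_mul_trace_le hγ hβ (y t 1) (dt y t 1)
      linarith
  have hT := hs.trans hsT
  have c1 := (hy.abs_cross_le h hs.le hγ).trans (hy.thetaMax_mul_le hyp hβ hs.le)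
  have c2 := (hy.abs_cross_le h hT.le hγ).trans (hy.thetaMax_mul_le hyp hβ hT.le)
  have hE := hy.energy_le h hs hsT
  have hE0 := hy.energy_nonneg hyp hβ hT.le
  have hη := Coef.eta_pos (a := a) (b := b) 1
  have hσ := h.sigma_pos Coef.one_mem
  have hK := h.deg_a.index_pos
  have hB : 0 ≤ (1 / sigma a b 1 + 1 / eta a b 1 + β / eta a b 1 + degIndex a / 4) *
    energy a b d lam β y T := by positivity
  have hΘ : 0 ≤ Theta a b d lam := by
    have := hyp.oneEps_pos.1
    exact mul_nonneg (by positivity) (le_trans (by positivity) (le_max_right _ _))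
  have h5 := mul_le_mul_of_nonneg_left hE hΘ
  have h6 := (abs_le.1 c1).2
  have h7 := (abs_le.1 c2).1
  linarith

/-- The estimate when the zero order multiplier is positive and small. -/
theorem integral_density_le_of_pos (hyp : Assumptions a b d lam ε₀) (hβ : 0 ≤ β) (hl : lam < 0)
    (hy : IsClassicalSolution a b d lam β y) (hs : 0 < s) (hsT : s < T) {p e : ℝ}
    (hγ : degIndex a / 2 < γ) (hγ' : γ ≤ (ε₀ / 2) ^ 2 / 4)
    (hle : ∀ t, 0 < t → p * (kin a b y t + el a b y t - lam * pot a b d y t) ≤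
      multForm a b d lam γ y t + e * energy a b d lam β y t) :
    p * ∫ t in s..T, (kin a b y t + el a b y t - lam * pot a b d y t) ≤
      (2 * Theta a b d lam + 1 / sigma a b 1 + 1 / eta a b 1 + β / eta a b 1 + degIndex a / 4)
          * energy a b d lam β y s
        + (β ^ 2 / eta a b 1 + degIndex a * β / 2 + β / eta a b 1 + degIndex a / 4)
          * (∫ t in s..T, y t 1 ^ 2)
        + e * ∫ t in s..T, energy a b d lam β y t := by
  have h := hyp.coef
  have hη := Coef.eta_pos (a := a) (b := b) 1
  have hσ := h.sigma_pos Coef.one_mem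
  have ha := h.a_pos Coef.one_mem
  have hK := h.deg_a.index_pos
  have hq := h.q_pos
  have hq1 : ε₀ / 2 ≤ 1 := by linarith [h.q_add_index, h.deg_d.index_pos]
  have hγ0 : 0 < γ := lt_trans (by linarith) hγ
  have hT := hs.trans hsT
  obtain ⟨G, hGc, hG⟩ := hy.exists_deriv_cross h γ
  have key := hy.integral_density_le h hs hsT (p := p) (e := e)
    -- The boundary term `γ y y_t` at `1` is the time derivative of `γ y²/2`, so it is moved into
    -- the integrated quantity instead of being estimated.
    (Φ := fun t => cross a b γ y t + γ / 2 * y t 1 ^ 2)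
    (Φ' := fun t => G t + γ * (y t 1 * dt y t 1))
    (B := 1 / sigma a b 1 + 1 / eta a b 1 + β / eta a b 1)
    (c := β ^ 2 / eta a b 1 + β / eta a b 1)
    (hGc.add (continuousOn_const.mul ((hy.continuousOn_trace h).mul (hy.continuousOn_dt_trace h))))
    (fun t ht => by
      refine ((hG t ht).1.add (((hy.hasDerivAt_trace h ht).pow 2).const_mul (γ / 2))).congr_deriv ?_
      simp only [Nat.cast_ofNat, Nat.reduceSub, pow_one]; ring) fun t ht => by
      have h1 := hle t ht
      have h2 := (hG t ht).2
      have h3 := hy.bdryForm_le (γ := γ) hβ ht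
      have h4 : 0 ≤ γ * (β * y t 1 ^ 2) := by positivity
      have h5 : lam / (sigma a b 1 * d 1) * y t 1 ^ 2 ≤ 0 :=
        mul_nonpos_of_nonpos_of_nonneg (div_nonpos_of_nonpos_of_nonneg hl.le
          (mul_pos hσ (h.d_pos Coef.one_mem)).le) (sq_nonneg _)
      linarith
  -- From `K_a/2 < γ ≤ q²/4` and `q ≤ 1` the left side is at most `3q²/8`.
  have hcr : γ / 2 + degIndex a / 2 ≤ ε₀ / 2 := by nlinarith
  have hone : oneEps a b d lam = 1 := if_pos hl.le
  -- The trace inequality `q y(t,1)² ≤ (1/η(1)) ∫ η y_x²` beats `γ`, since `γ ≤ q²/4 ≤ q/4`.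
  have tr : ∀ t, 0 ≤ t → γ / 2 * y t 1 ^ 2 ≤ 1 / (4 * eta a b 1) * energy a b d lam β y t := by
    intro t ht
    have h1 := h.sq_one_le (hy.memH1 t ht)
    rw [← el] at h1
    have h2 := hy.oneEps_mul_le hyp hβ ht
    rw [hone] at h2
    have hk := kin_nonneg (a := a) (b := b) (y := y) (t := t)
    have h3 : 1 / eta a b 1 * el a b y t ≤ 1 / eta a b 1 * (2 * energy a b d lam β y t) := by
      gcongr; linarith
    have h4 : γ * y t 1 ^ 2 ≤ 1 / 4 * (ε₀ / 2 * y t 1 ^ 2) := by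
      have : γ ≤ 1 / 4 * (ε₀ / 2) := by nlinarith
      nlinarith [mul_le_mul_of_nonneg_right this (sq_nonneg (y t 1))]
    have e1 : 1 / (4 * eta a b 1) * energy a b d lam β y t =
      1 / 8 * (1 / eta a b 1 * (2 * energy a b d lam β y t)) := by field_simp; ring
    rw [e1]; linarith
  have cr : ∀ t, 0 ≤ t → |cross a b γ y t| ≤ Theta a b d lam * energy a b d lam β y t +
      1 / (4 * a 1) * energy a b d lam β y t := by
    intro t ht
    refine (hy.abs_cross_le_of_nonneg h ht hγ0.le hcr).trans
      (add_le_add (hy.thetaMax_mul_le hyp hβ ht) ?_)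
    have h1 := mul_le_mul_of_nonneg_left (tr t ht) (by positivity : 0 ≤ 1 / sigma a b 1)
    have e1 : 1 / sigma a b 1 * (1 / (4 * eta a b 1) * energy a b d lam β y t) =
      1 / (4 * a 1) * energy a b d lam β y t := by rw [sigma]; field_simp
    rw [e1] at h1
    linarith
  have hE := hy.energy_le h hs hsT
  have hE0 := hy.energy_nonneg hyp hβ hT.le
  have h6 := (abs_le.1 (cr s hs.le)).2
  have h7 := (abs_le.1 (cr T hT.le)).1
  have h8 := tr s hs.le
  have h9 : 0 ≤ γ / 2 * y T 1 ^ 2 := by positivity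
  have hη2 : 1 / eta a b 1 ≤ 2 := by
    rw [div_le_iff₀ hη]; linarith [h.half_le_eta_one]
  have hσ2 : 1 / (2 * a 1) ≤ 1 / sigma a b 1 := by
    rw [sigma, one_div_div, one_div, mul_inv, ← div_eq_mul_inv]
    gcongr
    linarith [h.half_le_eta_one]
  -- For `λ < 0` the factor in front of the maximum is `2`, and the maximum is at least both `1` and
  -- `1/a(1)`.
  have hΘ : 1 + 1 / a 1 ≤ Theta a b d lam := by
    have hC : 0 ≤ CHPtilde a b := Coef.CHPtilde_nonneg
    have hm := h.etaMin_pos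
    have h1 : 1 / a 1 ≤ thetaMax a b :=
      (le_add_of_nonneg_right (by positivity)).trans (le_max_left _ _)
    have h2 : 1 ≤ thetaMax a b :=
      (le_add_of_nonneg_right (by positivity)).trans (le_max_right _ _)
    rw [Theta, hone, ← thetaMax]; linarith
  have e1 : 1 / (4 * eta a b 1) = 1 / 4 * (1 / eta a b 1) := by field_simp
  have e2 : 1 / (4 * a 1) = 1 / 4 * (1 / a 1) := by field_simp
  have e3 : 1 / (2 * a 1) = 1 / 2 * (1 / a 1) := by field_simp
  have hI : 0 ≤ (degIndex a * β / 2 + degIndex a / 4) * ∫ t in s..T, y t 1 ^ 2 :=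
    mul_nonneg (by positivity) (intervalIntegral.integral_nonneg hsT.le fun t _ => sq_nonneg _)
  have hr : 0 < 1 / a 1 := by positivity
  -- The extra terms `E/(4η(1))` and `E/(4a(1))` are absorbed in two pieces. On `E(s) - E(T)` they
  -- are paid by one `Θ`, using `1/η(1) ≤ 2`; on `E(T)` by the unused part `1/σ(1) + 1/η(1)` of the
  -- dissipation, using `η(1) ≥ 1/2`.
  have f1 : 0 ≤ (Theta a b d lam - 1 / (4 * eta a b 1) - 1 / (4 * a 1)) *
      (energy a b d lam β y s - energy a b d lam β y T) :=
    mul_nonneg (by rw [e1, e2]; linarith) (by linarith)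
  have f2 : 0 ≤ (1 / sigma a b 1 + 1 / eta a b 1 - 1 / (4 * eta a b 1) - 2 * (1 / (4 * a 1))) *
      energy a b d lam β y T := mul_nonneg (by
        rw [e1, e2]; rw [e3] at hσ2; linarith [(by positivity : 0 < 1 / eta a b 1)]) hE0
  have f3 : 0 ≤ β / eta a b 1 * energy a b d lam β y T := by positivity
  have f4 : 0 ≤ degIndex a / 4 * energy a b d lam β y s :=
    mul_nonneg (by positivity) (hE0.trans hE)
  linarith

end IsClassicalSolution
end DegWave

/-! ### The proposition -/

open DegWave DegWave.IsClassicalSolution in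
theorem proposition3p5 (a b d : ℝ → ℝ) (lam β ε₀ : ℝ) (hβ : 0 ≤ β)
    (hyp : DegWave.Assumptions a b d lam ε₀)
    (y : ℝ → ℝ → ℝ) (hy : DegWave.IsClassicalSolution a b d lam β y)
    (s T : ℝ) (hs : 0 < s) (hsT : s < T) :
    IntegrableOn (fun p : ℝ × ℝ => DegWave.density a b d lam y p.1 p.2)
      (Ioo s T ×ˢ Ioo (0 : ℝ) 1) ∧
    (0 ≤ lam →
      ε₀ / 2 * ∫ p in Ioo s T ×ˢ Ioo (0 : ℝ) 1, DegWave.density a b d lam y p.1 p.2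
        ≤ (2 * DegWave.Theta a b d lam + 1 / DegWave.sigma a b 1 + 1 / DegWave.eta a b 1
              + β / DegWave.eta a b 1 + DegWave.degIndex a / 4)
            * DegWave.energy a b d lam β y s
          + (β ^ 2 / DegWave.eta a b 1 + DegWave.degIndex a * β / 2 + β / DegWave.eta a b 1
              + DegWave.degIndex a / 4 + lam / (DegWave.sigma a b 1 * d 1))
            * ∫ t in s..T, y t 1 ^ 2) ∧
    (lam < 0 →
      ε₀ / 2 * ∫ p in Ioo s T ×ˢ Ioo (0 : ℝ) 1, DegWave.density a b d lam y p.1 p.2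
        ≤ (2 * DegWave.Theta a b d lam + 1 / DegWave.sigma a b 1 + 1 / DegWave.eta a b 1
              + β / DegWave.eta a b 1 + DegWave.degIndex a / 4)
            * DegWave.energy a b d lam β y s
          + (β ^ 2 / DegWave.eta a b 1 + DegWave.degIndex a * β / 2 + β / DegWave.eta a b 1
              + DegWave.degIndex a / 4)
            * (∫ t in s..T, y t 1 ^ 2)
          - 2 * lam * DegWave.CHP a b d
            * (1 + 3 / 2 * DegWave.degIndex a + DegWave.degIndex d + DegWave.constM a b)
            * ∫ t in s..T, DegWave.energy a b d lam β y t) := by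
  have h := hyp.coef
  have hKa := h.deg_a.index_pos
  rw [hy.integral_density_prod h hs hsT]
  refine ⟨hy.integrableOn_density h hs, fun hl => ?_, fun hl => ?_⟩
  · have := hy.integral_density_le_of_abs_le hyp hβ hs hsT (p := ε₀ / 2) (e := 0)
      (γ := -(degIndex a / 2)) (by rw [abs_neg, abs_of_nonneg (by positivity)]) fun t ht => by
        rw [zero_mul, add_zero]
        exact hy.le_multForm_of_nonneg h hl ht.le
    linarith
  rw [← potConst]
  obtain ⟨z, hz⟩ : ∃ z, z = -lam * CHP a b d := ⟨_, rfl⟩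
  have hS := one_le_potConst hyp
  have hz0 : 0 ≤ z := by
    rw [hz]; exact mul_nonneg (neg_nonneg.2 hl.le) Coef.CHP_nonneg
  have e : 2 * lam * CHP a b d * potConst a b d = -(2 * z * potConst a b d) := by rw [hz]; ring
  rw [e, neg_mul, sub_neg_eq_add]
  have hη := Coef.eta_pos (a := a) (b := b) 1
  have hσ := h.sigma_pos Coef.one_mem
  have hI : 0 ≤ ∫ t in s..T, y t 1 ^ 2 :=
    intervalIntegral.integral_nonneg hsT.le fun t _ => sq_nonneg _
  have hE0 := hy.energy_nonneg hyp hβ hs.le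
  have hΘ : 0 ≤ Theta a b d lam := by
    have := hyp.oneEps_pos.1
    exact mul_nonneg (by positivity) (le_trans (by positivity) (le_max_right _ _))
  -- If `q ≤ z S`, the energy integral alone bounds the left side and no multiplier is needed; the
  -- remaining terms on the right are nonnegative.
  rcases le_or_gt (ε₀ / 2) (z * potConst a b d) with hzS | hzS
  · have key := hy.integral_density_le h hs hsT (Φ := fun _ => 0) (Φ' := fun _ => 0) (p := ε₀ / 2)
      (B := 0) (c := 0) (e := 2 * z * potConst a b d) continuousOn_const
      (fun t _ => hasDerivAt_const t 0) fun t ht => by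
        have h1 := mul_le_mul_of_nonneg_left (hy.density_le_energy h hβ ht.le) h.q_pos.le
        have h2 := mul_le_mul_of_nonneg_right hzS (hy.energy_nonneg hyp hβ ht.le)
        linarith
    have t1 : 0 ≤ (2 * Theta a b d lam + 1 / sigma a b 1 + 1 / eta a b 1 + β / eta a b 1 +
      degIndex a / 4) * energy a b d lam β y s := by positivity
    have t2 : 0 ≤ (β ^ 2 / eta a b 1 + degIndex a * β / 2 + β / eta a b 1 + degIndex a / 4) *
      ∫ t in s..T, y t 1 ^ 2 := by positivity
    linarith
  · have hle := fun (t : ℝ) (ht : 0 < t) =>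
      hy.density_le_multForm_of_neg hyp hl hβ ht.le hz hzS.le
    have hθ0 : 0 ≤ z * (ε₀ / 2 - z * potConst a b d) := mul_nonneg hz0 (by linarith)
    have hθ1 : z * (ε₀ / 2 - z * potConst a b d) ≤ (ε₀ / 2) ^ 2 / 4 := mul_sub_mul_le hS
    -- Always `γ ≥ -K_a/2`, so `γ ≤ K_a/2` is the only condition for the bound by `Θ`. It can fail
    -- when `K_a` is small compared with `q²`.
    rcases le_or_gt (z * (ε₀ / 2 - z * potConst a b d) - degIndex a / 2) (degIndex a / 2)
      with hγ | hγ
    · have := hy.integral_density_le_of_abs_le hyp hβ hs hsT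
        (abs_le.2 ⟨by linarith, hγ⟩) hle
      have h5 : lam / (sigma a b 1 * d 1) * ∫ t in s..T, y t 1 ^ 2 ≤ 0 :=
        mul_nonpos_of_nonpos_of_nonneg (div_nonpos_of_nonpos_of_nonneg hl.le
          (mul_pos hσ (h.d_pos Coef.one_mem)).le) hI
      linarith
    · exact hy.integral_density_le_of_pos hyp hβ hl hs hsT hγ (by linarith) hle
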